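/- **Theorem 3.2.** Let $d \ge 2$ be an integer, $\eta > 0$, $\alpha > d$, $\beta > 1$, $\xi \in \mathbb{R}$, and let $k \ge 0$ be an integer. For $s > 0$ let $\mathcal{P}_s$ be a homogeneous Poisson point process of intensity $s$ on the unit cube $S = (-\frac12, \frac12]^d$, that is, $\mathcal{P}_s = \sum_{i=1}^{N_s} \delta_{X_i}$ with $N_s$ a Poisson random variable with mean $s$ and $X_1, X_2, \dots$ independent, uniformly distributed on $S$ and independent of $N_s$. Attach to the points independent weights distributed as $W$, where $P(W > w) = w^{-\beta}$ for $w \ge 1$, independent of $\mathcal{P}_s$. Let $d(x,y) = \inf\{\|x-y-z\| : z \in \mathbb{Z}^d\}$ be the toroidal metric on $S$ ($\|\cdot\|$ the Euclidean norm). For $r > 0$ let $G(\mathcal{P}_s, r)$ be the random graph with vertex set $\mathcal{P}_s$ in which, given the points and the weights, any two distinct vertices $x, y$ are joined by an edge, independently of all other pairs, with probability $$1 - \exp\left(-\frac{\eta\, W_x W_y}{(d(x,y)/r)^{\alpha}}\right).$$ Put $$c_0 = \frac{\sigma_d\, \alpha\beta}{d(\alpha\beta - d)}\, \eta^{d/\alpha}\,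 \Gamma\left(1 - \frac{d}{\alpha}\right), \qquad \sigma_d = \frac{2\pi^{d/2}}{\Gamma(d/2)}$$ (so $\sigma_d$ is the surface area of the unit sphere of $\mathbb{R}^d$), and for all sufficiently large $s$ define $r_s > 0$ by $$r_s^d = \frac{1}{c_0 s}\left(\log s + (k-1)\log\log s + \xi + \log\left(\frac{\alpha\beta}{k!\, d}\right)\right).$$ Let $D_k = D_{k,s}$ be the number of vertices of degree $k$ in $G(\mathcal{P}_s, r_s)$. If $$\alpha\beta > \max\{2d,\ (k+1)d,\ (2k+3)(\alpha - d)\},$$ then, as $s \to \infty$, the law of $D_k$ converges in total variation distance to the Poisson distribution with mean $e^{-\xi}$; in particular $D_k$ converges in distribution to a Poisson random variable with mean $e^{-\xi}$. -/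

import Mathlib

open MeasureTheory ProbabilityTheory Filter Topology

noncomputable section

namespace ScaleFreeRCM

/-- The unit cube `S = (-1/2, 1/2]^d` in Euclidean space. -/
def unitCube (d : ℕ) : Set (EuclideanSpace ℝ (Fin d)) :=
  {x | ∀ i, x i ∈ Set.Ioc (-(1 / 2) : ℝ) (1 / 2)}

/-- The toroidal metric `d(x, y) = inf { ‖x - y - z‖ : z ∈ ℤ^d }`, with the Euclidean norm. -/
def torusDist {d : ℕ} (x y : EuclideanSpace ℝ (Fin d)) : ℝ :=
  ⨅ z : Fin d → ℤ, ‖x - y - WithLp.toLp 2 (fun i => (z i : ℝ))‖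

theorem torusDist_comm {d : ℕ} (x y : EuclideanSpace ℝ (Fin d)) :
    torusDist x y = torusDist y x := by
  unfold torusDist
  refine (Equiv.neg (Fin d → ℤ)).iInf_congr (fun z => ?_)
  rw [← norm_neg]
  congr 1
  ext i
  simp
  ring

/-- The connection function
`g(x, w; y, v) = 1 - exp (- η w v / (d(x, y) / r) ^ α)` with scaling parameter `r`. -/
def connectionProb {d : ℕ} (α η r : ℝ) (x : EuclideanSpace ℝ (Fin d)) (w : ℝ)
    (y : EuclideanSpace ℝ (Fin d)) (v : ℝ) : ℝ :=
  1 - Real.exp (-(η * w * v / (torusDist x y / r) ^ α))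

theorem connectionProb_comm {d : ℕ} (α η r : ℝ) (x : EuclideanSpace ℝ (Fin d)) (w : ℝ)
    (y : EuclideanSpace ℝ (Fin d)) (v : ℝ) :
    connectionProb α η r x w y v = connectionProb α η r y v x w := by
  unfold connectionProb
  rw [torusDist_comm x y, mul_right_comm]

/-- The uniform distribution on the unit cube: Lebesgue measure restricted to it. -/
def uniformCube (d : ℕ) : Measure (EuclideanSpace ℝ (Fin d)) :=
  volume.restrict (unitCube d)

instance instIsProbabilityMeasureUniformCube (d : ℕ) : IsProbabilityMeasure (uniformCube d) := by
  constructor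
  have h := (EuclideanSpace.volume_preserving_symm_measurableEquiv_toLp (Fin d)).measure_preimage_equiv
    (Set.univ.pi fun _ : Fin d => Set.Ioc (-(1 / 2) : ℝ) (1 / 2))
  have hS : unitCube d = (MeasurableEquiv.toLp 2 (Fin d → ℝ)).symm ⁻¹'
      (Set.univ.pi fun _ : Fin d => Set.Ioc (-(1 / 2) : ℝ) (1 / 2)) := by
    ext x
    simp [unitCube]
  rw [uniformCube, Measure.restrict_apply_univ, hS, h, Real.volume_pi_Ioc]
  norm_num

/-- The uniform distribution on `[0, 1]`. -/
def uniformUnit : Measure ℝ := volume.restrict (Set.Icc 0 1)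

instance instIsProbabilityMeasureUniformUnit : IsProbabilityMeasure uniformUnit := by
  constructor
  simp [uniformUnit]

/-- A realization of the randomness of the model: the number `N` of points, the positions
`X 0, X 1, …`, the weights `W 0, W 1, …`, and one edge mark `U {i, j}` for every unordered pair of
indices. The point process consists of the first `N` points `X 0, …, X (N - 1)`. -/
abbrev Sample (d : ℕ) : Type :=
  ℕ × (ℕ → EuclideanSpace ℝ (Fin d)) × (ℕ → ℝ) × (Sym2 ℕ → ℝ)

/-- The law of the randomness: `N` is Poisson with mean `s`, the `X i` are uniform on the unit cube
(so that `∑ i < N, δ_{X i}` is a homogeneous Poisson process of intensity `s` on the cube), the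
weights are Pareto distributed with `P (W > w) = w ^ (-β)` for `w ≥ 1`, the edge marks are uniform
on `[0, 1]`, and all these random variables are independent. -/
def sampleLaw (d : ℕ) (β : ℝ) (hβ : 0 < β) (s : ℝ) : Measure (Sample d) :=
  haveI : IsProbabilityMeasure (paretoMeasure 1 β) :=
    isProbabilityMeasure_paretoMeasure one_pos hβ
  (poissonMeasure s.toNNReal).prod
    ((Measure.infinitePi fun _ : ℕ => uniformCube d).prod
      ((Measure.infinitePi fun _ : ℕ => paretoMeasure 1 β).prod
        (Measure.infinitePi fun _ : Sym2 ℕ => uniformUnit)))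

instance instIsProbabilityMeasureSampleLaw (d : ℕ) (β : ℝ) (hβ : 0 < β) (s : ℝ) :
    IsProbabilityMeasure (sampleLaw d β hβ s) := by
  have : IsProbabilityMeasure (paretoMeasure 1 β) :=
    isProbabilityMeasure_paretoMeasure one_pos hβ
  unfold sampleLaw
  infer_instance

/-- The random graph with scaling parameter `r`: its vertices are the `N` points of the process
(labelled by `Fin N`), and distinct `i`, `j` are joined iff the edge mark `U {i, j}` lies below the
connection probability, so that, given positions and weights, the edges are independent and present
with these probabilities. -/
def randomGraph {d : ℕ} (α η r : ℝ) (ω : Sample d) : SimpleGraph (Fin ω.1) where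
  Adj i j := i ≠ j ∧
    ω.2.2.2 s((i : ℕ), (j : ℕ)) <
      connectionProb α η r (ω.2.1 i) (ω.2.2.1 i) (ω.2.1 j) (ω.2.2.1 j)
  symm := ⟨fun i j h => ⟨h.1.symm, by
    rw [Sym2.eq_swap, connectionProb_comm]
    exact h.2⟩⟩
  loopless := ⟨fun _ h => h.1 rfl⟩

open Classical in
/-- `D_k`: the number of vertices of degree `k`. -/
def numDegree {d : ℕ} (α η r : ℝ) (k : ℕ) (ω : Sample d) : ℕ :=
  (Finset.univ.filter fun i : Fin ω.1 => (randomGraph α η r ω).degree i = k).card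

/-- The constant
`c₀ = σ_d α β / (d (α β - d)) * η ^ (d / α) * Γ (1 - d / α)`, where
`σ_d = 2 π ^ (d / 2) / Γ (d / 2)` is the surface area of the unit sphere of `ℝ^d`
(so `σ_2 = 2 π`). -/
def c₀ (d : ℕ) (α β η : ℝ) : ℝ :=
  (2 * Real.pi ^ ((d : ℝ) / 2) / Real.Gamma ((d : ℝ) / 2)) * (α * β) / (d * (α * β - d))
    * η ^ ((d : ℝ) / α) * Real.Gamma (1 - (d : ℝ) / α)

/-- The scaling `r_s(ξ)`, the nonnegative number (for all large `s`) with
`r_s ^ d = (log s + (k - 1) log log s + ξ + log (α β / (k! d))) / (c₀ s)`. -/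
def scaling (d : ℕ) (α β η ξ : ℝ) (k : ℕ) (s : ℝ) : ℝ :=
  (1 / (c₀ d α β η * s) *
    (Real.log s + ((k : ℝ) - 1) * Real.log (Real.log s) + ξ
      + Real.log (α * β / (Nat.factorial k * d)))) ^ (1 / (d : ℝ))

/-- Total variation distance `sup_A |μ(A) - ν(A)|` of probability measures on `ℕ`. -/
def tvDist (μ ν : Measure ℕ) : ℝ := ⨆ A : Set ℕ, |μ.real A - ν.real A|

end ScaleFreeRCM

end

/-! An added point `x` has a Poisson degree with mean `s * joinProb x`. For weight `w` this mean is
close to `w ^ (d / α) * L`, where `L = c₀ s r ^ d` is `meanLevel`. As `L ~ log s`, vertices of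
degree `k` are rare, have weight near 1 and hardly influence each other, whence a Poisson limit. The
proof makes this quantitative by Stein's method.

Stein's equation (`measureReal_sub_poissonMeasure_eq`) expresses `P(D ∈ A) - Po(A)` as `E[l f(D + 1)
- D f(D)]` with a bounded `f`. A Mecke formula (`integral_degreeCount_mul`) turns `E[D f(D)]` into
`s ∫ E[1{x has degree k} f(D' + 1)] dx`, where `D'` counts the other vertices of degree `k` once `x`
is added. Let `R` be the count in the graph with all neighbours of `x` deleted. By Poisson thinning
(`integral_joinedCount_mul`) `R` is independent of the degree of `x`. Both `D'` and `D` differ from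
`R` only if there is an `Exceptional` vertex `y`: adjacent to `x` or sharing a neighbour with `x`,
and with at most `k` neighbours not joined to `x`. An exponential Markov bound on the relevant
degrees leads to the integral of `pairBound` over pairs `(x, y)`. This gives
`tvDist_map_degreeCount_le`, valid for any symmetric measurable connection function with values in
`[0, 1]`: the distance is controlled by that pair integral and by the error in the first moment.

First moment (`tendsto_mul_integral_joinProb`): translation invariance of the torus reduces
`joinProb` to a radial integral, equal to its whole-space value up to an error linear in the weight
and of order `r ^ α`, and `s r ^ α → 0`. The remaining Pareto integral is of Laplace type and
concentrates at weight 1; the choice of `L` makes `s` times it converge to `exp (-ξ)`.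

Pair integral (`exists_lintegral_pairBound_le`): since `s exp (-L) ≤ C L`, it is enough to gain a
factor `exp (-δ L)` over `s ^ 2 exp (-2 L)` up to powers of `L`. A heavy point has mean degree at
least `3 L - 1`. Two light points far apart are unlikely to be adjacent or to share a neighbour. Two
light points close together occupy little volume, and their joint neighbourhood has mean at least
`(1 + e) L - 1` for a fixed `e > 0`. -/

noncomputable section

namespace ScaleFreeRCM

/-! ### Splitting and zipping infinite product measures -/

section InfinitePi

open Measure

variable {ι κ : Type*} {Z : Type*} [MeasurableSpace Z]

theorem measurePreserving_infinitePi_comp (μ : Measure Z) [IsProbabilityMeasure μ]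
    {f : κ → ι} (hf : Function.Injective f) :
    MeasurePreserving (fun (ω : ι → Z) i => ω (f i)) (infinitePi fun _ => μ)
      (infinitePi fun _ => μ) :=
  ⟨by fun_prop, map_infinitePi_infinitePi_of_inj (P := fun _ : ι => μ) hf⟩

/-- Infinite products are determined by boxes over finite index sets, and such a box factors along
`toLeft` and `toRight`. -/
theorem measurePreserving_sumPi {X : ι ⊕ κ → Type*} [∀ i, MeasurableSpace (X i)]
    (μ : ∀ i, Measure (X i)) [∀ i, IsProbabilityMeasure (μ i)] :
    MeasurePreserving (MeasurableEquiv.sumPiEquivProdPi X) (infinitePi μ)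
      ((infinitePi fun i => μ (.inl i)).prod (infinitePi fun i => μ (.inr i))) := by
  have h : MeasurePreserving (MeasurableEquiv.sumPiEquivProdPi X).symm
      ((infinitePi fun i => μ (.inl i)).prod (infinitePi fun i => μ (.inr i)))
      (infinitePi μ) := by
    refine ⟨MeasurableEquiv.measurable _, eq_infinitePi _ fun s t ht => ?_⟩
    rw [MeasurableEquiv.map_apply]
    have : (MeasurableEquiv.sumPiEquivProdPi X).symm ⁻¹' Set.pi s t =
        (Set.pi (s.toLeft : Set ι) fun i => t (.inl i)) ×ˢ
          (Set.pi (s.toRight : Set κ) fun i => t (.inr i)) := by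
      ext ⟨x, y⟩
      simp [Set.mem_pi, MeasurableEquiv.coe_sumPiEquivProdPi_symm, Equiv.sumPiEquivProdPi]
    rw [this, prod_prod, infinitePi_pi _ fun i _ => ht _, infinitePi_pi _ fun i _ => ht _]
    conv_rhs => rw [← s.toLeft_disjSum_toRight, Finset.prod_disjSum]
  exact h.symm

theorem measurePreserving_infinitePi_split (μ : Measure Z) [IsProbabilityMeasure μ]
    {α β : Type*} {f : α → ι} {g : β → ι} (h : Function.Injective (Sum.elim f g)) :
    MeasurePreserving (fun (ω : ι → Z) => ((fun i => ω (f i)), fun i => ω (g i)))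
      (infinitePi fun _ => μ) ((infinitePi fun _ => μ).prod (infinitePi fun _ => μ)) :=
  (measurePreserving_sumPi (X := fun _ : α ⊕ β => Z) fun _ => μ).comp
    (measurePreserving_infinitePi_comp μ h)

/-- A family indexed by `ι ⊕ ι` makes both components of every pair coordinates of one product, to
which uniqueness on finite boxes applies. -/
theorem measurePreserving_unzip_sum {X : ι ⊕ ι → Type*} [∀ i, MeasurableSpace (X i)]
    (m : ∀ i, Measure (X i)) [∀ i, IsProbabilityMeasure (m i)] :
    MeasurePreserving
      (fun (ω : ∀ i : ι, X (.inl i) × X (.inr i)) => ((fun i => (ω i).1), fun i => (ω i).2))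
      (infinitePi fun i => (m (.inl i)).prod (m (.inr i)))
      ((infinitePi fun i => m (.inl i)).prod (infinitePi fun i => m (.inr i))) := by
  classical
  let u : (∀ i : ι, X (.inl i) × X (.inr i)) → (∀ i, X i) :=
    fun ω => Sum.rec (fun i => (ω i).1) (fun i => (ω i).2)
  have hu : Measurable u := by
    refine measurable_pi_iff.2 ?_
    rintro (i | i)
    · exact (measurable_pi_apply i).fst
    · exact (measurable_pi_apply i).snd
  have h : MeasurePreserving u (infinitePi fun i => (m (.inl i)).prod (m (.inr i))) (infinitePi m) := by
    refine ⟨hu, eq_infinitePi _ fun s t ht => ?_⟩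
    -- A coordinate constrained on one side only receives `univ` on the other, which contributes the
    -- factor 1.
    have hp : u ⁻¹' Set.pi s t = Set.pi ((s.toLeft ∪ s.toRight : Finset ι) : Set ι) fun i =>
        (if i ∈ s.toLeft then t (.inl i) else Set.univ) ×ˢ
          (if i ∈ s.toRight then t (.inr i) else Set.univ) := by
      ext ω
      simp only [Set.mem_preimage, Set.mem_pi, Finset.mem_coe, Finset.mem_union, Set.mem_prod]
      constructor
      · intro h i _
        constructor
        · split_ifs with h1
          · exact h (.inl i) (by simpa using h1)
          · trivial
        · split_ifs with h1
          · exact h (.inr i) (by simpa using h1)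
          · trivial
      · rintro h (i | i) hi
        · have h1 : i ∈ s.toLeft := by simpa using hi
          have := (h i (.inl h1)).1
          rwa [if_pos h1] at this
        · have h1 : i ∈ s.toRight := by simpa using hi
          have := (h i (.inr h1)).2
          rwa [if_pos h1] at this
    rw [Measure.map_apply hu (.pi s.countable_toSet fun i _ => ht i), hp, infinitePi_pi]
    · simp_rw [prod_prod]
      rw [Finset.prod_mul_distrib]
      conv_rhs => rw [← s.toLeft_disjSum_toRight, Finset.prod_disjSum]
      congr 1
      · rw [← Finset.prod_subset (Finset.subset_union_left (s₂ := s.toRight))]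
        · exact Finset.prod_congr rfl fun i hi => by rw [if_pos hi]
        · intro i _ hi
          rw [if_neg hi, measure_univ]
      · rw [← Finset.prod_subset (Finset.subset_union_right (s₁ := s.toLeft))]
        · exact Finset.prod_congr rfl fun i hi => by rw [if_pos hi]
        · intro i _ hi
          rw [if_neg hi, measure_univ]
    · intro i _
      refine MeasurableSet.prod ?_ ?_
      · split_ifs
        · exact ht (.inl i)
        · exact .univ
      · split_ifs
        · exact ht (.inr i)
        · exact .univ
  exact (measurePreserving_sumPi m).comp h

theorem measurePreserving_unzip {Y Z : Type} [mY : MeasurableSpace Y] [mZ : MeasurableSpace Z]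
    (μ : Measure Y) (ν : Measure Z) [hμ : IsProbabilityMeasure μ] [hν : IsProbabilityMeasure ν] :
    MeasurePreserving (fun (ω : ι → Y × Z) => ((fun i => (ω i).1), fun i => (ω i).2))
      (infinitePi fun _ => μ.prod ν) ((infinitePi fun _ => μ).prod (infinitePi fun _ => ν)) :=
  -- The types, σ-algebras and measures of the two components differ, so all of them are defined by
  -- recursion on the sum.
  @measurePreserving_unzip_sum ι (fun i => Sum.rec (fun _ => Y) (fun _ => Z) i)
    (fun i => Sum.rec (fun _ => mY) (fun _ => mZ) i) (fun i => Sum.rec (fun _ => μ) (fun _ => ν) i)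
    (fun i => Sum.rec (fun _ => hμ) (fun _ => hν) i)

theorem measurePreserving_zip {Y Z : Type} [MeasurableSpace Y] [MeasurableSpace Z]
    (μ : Measure Y) (ν : Measure Z) [IsProbabilityMeasure μ]
    [IsProbabilityMeasure ν] :
    MeasurePreserving (fun (ω : (ι → Y) × (ι → Z)) i => (ω.1 i, ω.2 i))
      ((infinitePi fun _ => μ).prod (infinitePi fun _ => ν)) (infinitePi fun _ => μ.prod ν) := by
  refine ⟨by fun_prop, ?_⟩
  have h := measurePreserving_unzip (ι := ι) μ ν
  rw [← h.map_eq, Measure.map_map (by fun_prop) h.measurable]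
  exact Measure.map_id

theorem measurePreserving_fst_comp {Y Z : Type} [MeasurableSpace Y] [MeasurableSpace Z]
    (μ : Measure Y) (ν : Measure Z) [IsProbabilityMeasure μ]
    [IsProbabilityMeasure ν] :
    MeasurePreserving (fun (ω : ι → Y × Z) i => (ω i).1)
      (infinitePi fun _ => μ.prod ν) (infinitePi fun _ => μ) :=
  measurePreserving_fst.comp (measurePreserving_unzip μ ν)

end InfinitePi

/-! ### Marked configurations and the exploration of one vertex -/

section Config

/-- A configuration: one mark in `Z` for every vertex and one real mark for every pair. -/
abbrev Config (Z : Type) : Type := (ℕ → Z) × (Sym2 ℕ → ℝ)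

variable {Y Z : Type} [MeasurableSpace Y] [MeasurableSpace Z]

/-- Independent vertex marks with law `ν`, independent uniform marks on the pairs. -/
def configLaw (ν : Measure Z) [IsProbabilityMeasure ν] : Measure (Config Z) :=
  (Measure.infinitePi fun _ => ν).prod (Measure.infinitePi fun _ => uniformUnit)

instance (ν : Measure Z) [IsProbabilityMeasure ν] : IsProbabilityMeasure (configLaw ν) := by
  unfold configLaw
  infer_instance

/-- Relabelling of the vertices. -/
def Config.relabel (f : ℕ → ℕ) (ω : Config Z) : Config Z :=
  (fun i => ω.1 (f i), fun e => ω.2 (e.map f))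

/-- Isolate vertex `0`; the marks of its pairs become marks of the other vertices. -/
def Config.pop (ω : Config Z) : Z × Config (Z × ℝ) :=
  (ω.1 0, fun i => (ω.1 (i + 1), ω.2 s(0, i + 1)), fun e => ω.2 (e.map Nat.succ))

/-- Forget the second component of the vertex marks. -/
def Config.forget (ω : Config (Z × Y)) : Config Z := (fun i => (ω.1 i).1, ω.2)

theorem measurePreserving_relabel (ν : Measure Z) [IsProbabilityMeasure ν] {f : ℕ → ℕ}
    (hf : Function.Injective f) :
    MeasurePreserving (Config.relabel f) (configLaw ν) (configLaw ν) :=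
  (measurePreserving_infinitePi_comp ν hf).prod
    (measurePreserving_infinitePi_comp uniformUnit (Sym2.map.injective hf))

theorem measurePreserving_forget (ν : Measure Z) (ρ : Measure Y) [IsProbabilityMeasure ν]
    [IsProbabilityMeasure ρ] :
    MeasurePreserving Config.forget (configLaw (ν.prod ρ)) (configLaw ν) :=
  (measurePreserving_fst_comp ν ρ).prod (.id _)

theorem measurePreserving_zero_succ (ν : Measure Z) [IsProbabilityMeasure ν] :
    MeasurePreserving (fun z : ℕ → Z => (z 0, fun i => z (i + 1)))
      (Measure.infinitePi fun _ => ν) (ν.prod (Measure.infinitePi fun _ => ν)) := by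
  have h := measurePreserving_infinitePi_split ν (f := fun _ : Unit => 0) (g := Nat.succ)
    (by
      rintro (a | a) (b | b) h
      · rfl
      · simp at h
      · simp at h
      · simpa using h)
  exact ((measurePreserving_eval_infinitePi (fun _ : Unit => ν) ()).prod (.id _)).comp h

/-- The pairs `{0, i + 1}` and `{i + 1, j + 1}` are distinct coordinates, so their marks are
independent. The unused mark of `{0, 0}` is dropped: only injectivity of the index map matters.
Every conditioning on a single vertex goes through this map. -/
theorem measurePreserving_pop (ν : Measure Z) [IsProbabilityMeasure ν] :
    MeasurePreserving Config.pop (configLaw ν)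
      (ν.prod (configLaw (ν.prod uniformUnit))) := by
  have hU := measurePreserving_infinitePi_split uniformUnit
    (f := fun i : ℕ => s(0, i + 1)) (g := Sym2.map Nat.succ) (by
      rintro (a | a) (b | b) h
      · simpa using h
      · induction b with | _ b c => simp at h
      · induction a with | _ b c => simp at h
      · simpa using Sym2.map.injective Nat.succ_injective h)
  have h1 := (measurePreserving_zero_succ ν).prod hU
  have h2 := measurePreserving_prodAssoc ν (Measure.infinitePi fun _ : ℕ => ν)
    ((Measure.infinitePi fun _ : ℕ => uniformUnit).prod
      (Measure.infinitePi fun _ : Sym2 ℕ => uniformUnit))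
  have h3 := (measurePreserving_prodAssoc (Measure.infinitePi fun _ : ℕ => ν)
    (Measure.infinitePi fun _ : ℕ => uniformUnit)
      (Measure.infinitePi fun _ : Sym2 ℕ => uniformUnit)).symm
  have h4 := (measurePreserving_zip (ι := ℕ) ν uniformUnit).prod
    (.id (Measure.infinitePi fun _ : Sym2 ℕ => uniformUnit))
  exact ((MeasurePreserving.id ν).prod (h4.comp h3)).comp (h2.comp h1)

end Config


/-! ### Size biasing and tail bounds for Poisson laws -/

section Poisson

open scoped NNReal ENNReal Nat

theorem lintegral_poissonMeasure (r : ℝ≥0) (h : ℕ → ℝ≥0∞) :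
    ∫⁻ n, h n ∂poissonMeasure r =
      ∑' n : ℕ, ENNReal.ofReal (Real.exp (-r) * r ^ n / n !) * h n := by
  rw [poissonMeasure, lintegral_sum_measure]
  simp [lintegral_smul_measure, lintegral_dirac]

theorem poisson_weight_succ (r : ℝ≥0) (n : ℕ) :
    Real.exp (-r) * (r : ℝ) ^ (n + 1) / (n + 1)! * (n + 1 : ℕ) =
      r * (Real.exp (-r) * r ^ n / n !) := by
  rw [Nat.factorial_succ]
  push_cast
  have : (n ! : ℝ) ≠ 0 := by positivity
  have : (n + 1 : ℝ) ≠ 0 := by positivity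
  field_simp
  ring

/-- Size biasing: `n P(N = n) = r P(N = n - 1)`. Together with exchangeability it yields the Mecke
formula. Both sides are series that agree term by term, so no integrability is needed. -/
theorem integral_nat_mul_poissonMeasure (r : ℝ≥0) (h : ℕ → ℝ) :
    ∫ n, (n : ℝ) * h n ∂poissonMeasure r = r * ∫ n, h (n + 1) ∂poissonMeasure r := by
  rw [integral_poissonMeasure, integral_poissonMeasure, ← tsum_mul_left]
  rw [← (Nat.succ_injective).tsum_eq]
  · refine tsum_congr fun n => ?_
    simp only [Nat.succ_eq_add_one, smul_eq_mul]
    rw [← mul_assoc, poisson_weight_succ, mul_assoc]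
  · intro n hn
    cases n with
    | zero => simp at hn
    | succ n => exact ⟨n, rfl⟩

theorem lintegral_nat_mul_poissonMeasure (r : ℝ≥0) (h : ℕ → ℝ≥0∞) :
    ∫⁻ n, (n : ℝ≥0∞) * h n ∂poissonMeasure r = r * ∫⁻ n, h (n + 1) ∂poissonMeasure r := by
  rw [lintegral_poissonMeasure, lintegral_poissonMeasure, ← ENNReal.tsum_mul_left]
  rw [← (Nat.succ_injective).tsum_eq]
  · refine tsum_congr fun n => ?_
    simp only [Nat.succ_eq_add_one]
    rw [← mul_assoc, ← mul_assoc]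
    congr 1
    have := congrArg ENNReal.ofReal (poisson_weight_succ r n)
    rw [ENNReal.ofReal_mul (by positivity), ENNReal.ofReal_natCast,
      ENNReal.ofReal_mul (by positivity), ENNReal.ofReal_coe_nnreal] at this
    exact this
  · intro n hn
    cases n with
    | zero => simp at hn
    | succ n => exact ⟨n, rfl⟩

theorem integrable_natCast_poissonMeasure (r : ℝ≥0) :
    Integrable (fun n : ℕ => (n : ℝ)) (poissonMeasure r) := by
  refine ⟨by fun_prop, ?_⟩
  have := lintegral_nat_mul_poissonMeasure r (fun _ => 1)
  simp only [mul_one, lintegral_const, measure_univ] at this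
  rw [HasFiniteIntegral]
  refine lt_of_eq_of_lt (lintegral_congr fun n => ?_) (this.trans_lt (by simp))
  rw [Real.enorm_of_nonneg (Nat.cast_nonneg n), ENNReal.ofReal_natCast]

theorem lintegral_pow_poissonMeasure (r : ℝ≥0) {q : ℝ} (hq : 0 ≤ q) :
    ∫⁻ n, ENNReal.ofReal q ^ n ∂poissonMeasure r =
      ENNReal.ofReal (Real.exp (-(r * (1 - q)))) := by
  rw [lintegral_poissonMeasure]
  have h := (NormedSpace.expSeries_div_hasSum_exp ((r : ℝ) * q)).mul_left (Real.exp (-r))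
  rw [← Real.exp_eq_exp_ℝ, ← Real.exp_add] at h
  have e : -(r : ℝ) + r * q = -(r * (1 - q)) := by ring
  rw [e] at h
  rw [← h.tsum_eq, ENNReal.ofReal_tsum_of_nonneg (fun n => by positivity) h.summable]
  refine tsum_congr fun n => ?_
  rw [← ENNReal.ofReal_pow hq, ← ENNReal.ofReal_mul (by positivity)]
  congr 1
  rw [mul_pow]
  ring

/-- The mass `exp (-m) m ^ k / k!` of the Poisson law with mean `m` at `k`. -/
def poissonMass (k : ℕ) (m : ℝ) : ℝ := Real.exp (-m) * m ^ k / k !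

theorem poissonMass_nonneg (k : ℕ) {m : ℝ} (hm : 0 ≤ m) : 0 ≤ poissonMass k m := by
  unfold poissonMass
  positivity

theorem poissonMass_le_one (k : ℕ) {m : ℝ} (hm : 0 ≤ m) : poissonMass k m ≤ 1 := by
  have h := Real.pow_div_factorial_le_exp m hm k
  unfold poissonMass
  calc Real.exp (-m) * m ^ k / k ! = Real.exp (-m) * (m ^ k / k !) := by ring
    _ ≤ Real.exp (-m) * Real.exp m := by gcongr
    _ = 1 := by rw [← Real.exp_add]; simp

/-- A small part of the exponential absorbs the power, since `(θ m) ^ k / k! ≤ exp (θ m)`. The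
result has the shape of the exponential Markov bounds below, with which it is later multiplied. -/
theorem poissonMass_le (k : ℕ) {m θ : ℝ} (hm : 0 ≤ m) (hθ : 0 < θ) :
    poissonMass k m ≤ θ⁻¹ ^ k * Real.exp (-((1 - θ) * m)) := by
  have h := Real.pow_div_factorial_le_exp (θ * m) (by positivity) k
  unfold poissonMass
  calc Real.exp (-m) * m ^ k / k ! = θ⁻¹ ^ k * (Real.exp (-m) * ((θ * m) ^ k / k !)) := by
        have : θ⁻¹ ^ k * θ ^ k = 1 := by rw [← mul_pow, inv_mul_cancel₀ hθ.ne', one_pow]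
        rw [mul_pow]
        linear_combination (-(Real.exp (-m) * m ^ k / k !)) * this
    _ ≤ θ⁻¹ ^ k * (Real.exp (-m) * Real.exp (θ * m)) := by gcongr
    _ = _ := by rw [← Real.exp_add]; ring_nf

end Poisson

/-! ### The Stein equation of the Poisson law -/

section Stein

open scoped NNReal Nat

/-- The solution of the Stein equation of the Poisson law with mean `r` for the indicator of `A`. -/
def steinSolution (r : ℝ≥0) (A : Set ℕ) : ℕ → ℝ
  | 0 => 0
  | j + 1 => j ! / (r : ℝ) ^ (j + 1) *
      ∑ i ∈ Finset.range (j + 1), (A.indicator 1 i - (poissonMeasure r).real A) * (r ^ i / i !)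

theorem steinSolution_equation {r : ℝ≥0} (hr : 0 < r) (A : Set ℕ) (j : ℕ) :
    r * steinSolution r A (j + 1) - j * steinSolution r A j =
      A.indicator 1 j - (poissonMeasure r).real A := by
  have hr' : (r : ℝ) ≠ 0 := by exact_mod_cast hr.ne'
  cases j with
  | zero => simp [steinSolution]; field_simp
  | succ j =>
    have h1 : (j ! : ℝ) ≠ 0 := by positivity
    have h2 : (j + 1 : ℝ) ≠ 0 := by positivity
    simp only [steinSolution]
    rw [Finset.sum_range_succ _ (j + 1), Nat.factorial_succ]
    push_cast
    field_simp
    ring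

theorem integral_centered_indicator (m : Measure ℕ) [IsProbabilityMeasure m] (A : Set ℕ) (c : ℝ) :
    Integrable (fun i : ℕ => A.indicator (1 : ℕ → ℝ) i - c) m ∧
      ∫ i, (A.indicator (1 : ℕ → ℝ) i - c) ∂m = m.real A - c := by
  have h : Integrable (A.indicator (1 : ℕ → ℝ)) m :=
    (integrable_const (1 : ℝ)).indicator .of_discrete
  refine ⟨h.sub (integrable_const _), ?_⟩
  rw [integral_sub h (integrable_const _), integral_indicator_one .of_discrete]
  simp

/-- Because the full series vanishes, the partial sums defining `steinSolution` can be traded for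
tails. -/
theorem hasSum_centered_indicator (r : ℝ≥0) (A : Set ℕ) :
    HasSum (fun i : ℕ => (A.indicator 1 i - (poissonMeasure r).real A) * ((r : ℝ) ^ i / i !)) 0 := by
  obtain ⟨hint, hval⟩ := integral_centered_indicator (poissonMeasure r) A
    ((poissonMeasure r).real A)
  have h := hasSum_integral_poissonMeasure hint
  rw [hval] at h
  have h' := h.mul_left (Real.exp r)
  simp only [smul_eq_mul, sub_self, mul_zero] at h'
  refine h'.congr_fun ?_
  intro i
  have : Real.exp (r : ℝ) * Real.exp (-r) = 1 := by rw [← Real.exp_add]; simp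
  linear_combination (-(A.indicator 1 i - (poissonMeasure r).real A) * ((r : ℝ) ^ i / i !)) * this

/-- The partial sum equals minus the tail, and `j! i! ≤ (i + j + 1)!` bounds the normalised tail by
the exponential series of `r`. This crude constant suffices because the limiting mean is fixed. -/
theorem abs_steinSolution_le {r : ℝ≥0} (hr : 0 < r) (A : Set ℕ) (j : ℕ) :
    |steinSolution r A j| ≤ Real.exp r := by
  have hr' : (0 : ℝ) < r := by exact_mod_cast hr
  cases j with
  | zero => simp [steinSolution]; positivity
  | succ j =>
    have h0 := hasSum_centered_indicator r A
    set a : ℕ → ℝ := fun i => (A.indicator 1 i - (poissonMeasure r).real A) * ((r : ℝ) ^ i / i !)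
    have hsum : ∑ i ∈ Finset.range (j + 1), a i = - ∑' i, a (i + (j + 1)) := by
      have := h0.summable.sum_add_tsum_nat_add (j + 1)
      rw [h0.tsum_eq] at this
      linarith
    have hexp := NormedSpace.expSeries_div_hasSum_exp (r : ℝ)
    rw [← Real.exp_eq_exp_ℝ] at hexp
    have hterm : ∀ i, ‖(j ! / (r : ℝ) ^ (j + 1)) * a (i + (j + 1))‖ ≤ (r : ℝ) ^ i / i ! := by
      intro i
      have hP : |A.indicator 1 (i + (j + 1)) - (poissonMeasure r).real A| ≤ 1 := by
        have h1 : 0 ≤ (poissonMeasure r).real A := measureReal_nonneg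
        have h2 : (poissonMeasure r).real A ≤ 1 := measureReal_le_one
        rw [abs_le]
        by_cases hi : i + (j + 1) ∈ A
        · simp only [Set.indicator_of_mem hi, Pi.one_apply]
          constructor <;> linarith
        · simp only [Set.indicator_of_notMem hi]
          constructor <;> linarith
      have hfac : (j ! : ℝ) * i ! ≤ (i + (j + 1))! := by
        have h1 : j ! * i ! ≤ (j + i)! :=
          Nat.le_of_dvd (Nat.factorial_pos _) (Nat.factorial_mul_factorial_dvd_factorial_add j i)
        have h2 : (j + i)! ≤ (i + (j + 1))! := Nat.factorial_le (by omega)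
        exact_mod_cast h1.trans h2
      rw [Real.norm_eq_abs, abs_mul, abs_mul, abs_of_nonneg (by positivity : (0 : ℝ) ≤ j ! / r ^ (j + 1)),
        abs_of_nonneg (by positivity : (0 : ℝ) ≤ r ^ (i + (j + 1)) / (i + (j + 1))!)]
      calc (j ! / (r : ℝ) ^ (j + 1)) * (|A.indicator 1 (i + (j + 1)) - (poissonMeasure r).real A| *
              (r ^ (i + (j + 1)) / (i + (j + 1))!))
          ≤ (j ! / (r : ℝ) ^ (j + 1)) * (1 * (r ^ (i + (j + 1)) / (i + (j + 1))!)) := by gcongr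
        _ = r ^ i * (j ! / (i + (j + 1))!) := by
            rw [pow_add]; field_simp; ring
        _ ≤ r ^ i * (1 / i !) := by
            refine mul_le_mul_of_nonneg_left ?_ (by positivity)
            rw [div_le_div_iff₀ (by positivity) (by positivity)]
            linarith
        _ = _ := by ring
    have := tsum_of_norm_bounded hexp hterm
    simp only [steinSolution]
    change |_ * ∑ i ∈ Finset.range (j + 1), a i| ≤ _
    rw [hsum, mul_neg, abs_neg, ← tsum_mul_left]
    exact this

theorem measureReal_sub_poissonMeasure_eq {r : ℝ≥0} (hr : 0 < r) (A : Set ℕ) {m : Measure ℕ}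
    [IsProbabilityMeasure m] (hm : Integrable (fun n : ℕ => (n : ℝ)) m) :
    m.real A - (poissonMeasure r).real A =
      r * ∫ n, steinSolution r A (n + 1) ∂m - ∫ n, n * steinSolution r A n ∂m := by
  have hb := abs_steinSolution_le hr A
  have h1 : Integrable (fun n => steinSolution r A (n + 1)) m :=
    .of_bound (by fun_prop) (Real.exp r) (ae_of_all _ fun n => hb _)
  have h2 : Integrable (fun n : ℕ => n * steinSolution r A n) m := by
    refine (hm.mul_const (Real.exp r)).mono' (by fun_prop) (ae_of_all _ fun n => ?_)
    rw [Real.norm_eq_abs, abs_mul, Nat.abs_cast]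
    gcongr
    exact hb n
  rw [← integral_const_mul, ← integral_sub (h1.const_mul _) h2]
  simp_rw [steinSolution_equation hr]
  exact (integral_centered_indicator m A _).2.symm

end Stein


/-! ### Deterministic counting of vertices of degree `k` -/

section Counting

open Classical in
/-- The number of `i < n` with `p i`. -/
def countBelow (n : ℕ) (p : ℕ → Prop) : ℕ := (Finset.filter (fun i => p i) (Finset.range n)).card

theorem countBelow_zero (p : ℕ → Prop) : countBelow 0 p = 0 := by simp [countBelow]

theorem countBelow_le (n : ℕ) (p : ℕ → Prop) : countBelow n p ≤ n := by
  classical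
  exact (Finset.card_filter_le _ _).trans (by simp)

theorem countBelow_eq_sum (n : ℕ) (p : ℕ → Prop) [DecidablePred p] :
    countBelow n p = ∑ i ∈ Finset.range n, if p i then 1 else 0 := by
  rw [countBelow, ← Finset.card_filter]
  congr

theorem countBelow_mono {n : ℕ} {p q : ℕ → Prop} (h : ∀ i < n, p i → q i) :
    countBelow n p ≤ countBelow n q := by
  classical
  refine Finset.card_le_card fun i hi => ?_
  simp only [Finset.mem_filter, Finset.mem_range] at hi ⊢
  exact ⟨hi.1, h i hi.1 hi.2⟩

theorem countBelow_congr {n : ℕ} {p q : ℕ → Prop} (h : ∀ i < n, (p i ↔ q i)) :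
    countBelow n p = countBelow n q :=
  le_antisymm (countBelow_mono fun i hi => (h i hi).1) (countBelow_mono fun i hi => (h i hi).2)

theorem countBelow_le_add {n : ℕ} {p q t : ℕ → Prop} (h : ∀ i < n, p i → q i ∨ t i) :
    countBelow n p ≤ countBelow n q + countBelow n t := by
  classical
  refine (countBelow_mono (q := fun i => q i ∨ t i) h).trans ?_
  unfold countBelow
  refine le_trans (le_of_eq ?_) (Finset.card_union_le _ _)
  congr 1
  ext i
  simp [and_or_left]

theorem countBelow_add_of_disjoint {n : ℕ} {p q t : ℕ → Prop} (h : ∀ i < n, (t i ↔ p i ∨ q i))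
    (hd : ∀ i < n, p i → ¬ q i) : countBelow n t = countBelow n p + countBelow n q := by
  classical
  rw [countBelow_congr h]
  unfold countBelow
  rw [← Finset.card_union_of_disjoint]
  · congr 1
    ext i
    simp [and_or_left]
  · rw [Finset.disjoint_filter]
    exact fun i hi => hd i (Finset.mem_range.1 hi)

theorem countBelow_pos_iff {n : ℕ} {p : ℕ → Prop} : 0 < countBelow n p ↔ ∃ i < n, p i := by
  classical
  simp [countBelow, Finset.card_pos, Finset.Nonempty]

theorem countBelow_succ' (n : ℕ) (p : ℕ → Prop) [Decidable (p 0)] :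
    countBelow (n + 1) p = (if p 0 then 1 else 0) + countBelow n fun i => p (i + 1) := by
  classical
  rw [countBelow_eq_sum, countBelow_eq_sum, Finset.sum_range_succ', add_comm]
  congr

theorem countBelow_perm {n : ℕ} (σ : Equiv.Perm ℕ) (hσ : ∀ i, σ i < n ↔ i < n) (p : ℕ → Prop) :
    countBelow n (fun i => p (σ i)) = countBelow n p := by
  classical
  refine Finset.card_bij (fun i _ => σ i) ?_ ?_ ?_
  · intro i hi
    simpa [hσ] using hi
  · intro i _ j _ h
    exact σ.injective h
  · intro i hi
    refine ⟨σ.symm i, ?_, by simp⟩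
    have := hσ (σ.symm i)
    simp only [Equiv.apply_symm_apply] at this
    simpa [← this] using hi

/-- The degree of `i` in the graph induced by `R` on the `j < n` with `b j`. -/
def degreeOn (R : ℕ → ℕ → Prop) (b : ℕ → Prop) (n i : ℕ) : ℕ := countBelow n fun j => b j ∧ R i j

/-- The number of vertices of degree `k` in the graph induced by `R` on the `j < n` with `b j`. -/
def countDegree (R : ℕ → ℕ → Prop) (b : ℕ → Prop) (k n : ℕ) : ℕ :=
  countBelow n fun i => b i ∧ degreeOn R b n i = k

open Classical in
/-- The number of `i < n` whose degree is `k` after joining a new vertex to the `i` with `a i`. -/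
def countDegreeJoined (R : ℕ → ℕ → Prop) (a : ℕ → Prop) (k n : ℕ) : ℕ :=
  countBelow n fun i => degreeOn R (fun _ => True) n i + (if a i then 1 else 0) = k

/-- Vertex `i` is marked or adjacent to a marked vertex, and has at most `k` unmarked neighbours. -/
def Exceptional (R : ℕ → ℕ → Prop) (a : ℕ → Prop) (k n i : ℕ) : Prop :=
  (a i ∨ ∃ j < n, a j ∧ R i j) ∧ degreeOn R (fun j => ¬ a j) n i ≤ k

theorem degreeOn_true_eq (R : ℕ → ℕ → Prop) (a : ℕ → Prop) (n i : ℕ) :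
    degreeOn R (fun _ => True) n i = degreeOn R (fun j => ¬ a j) n i + degreeOn R a n i := by
  refine countBelow_add_of_disjoint ?_ ?_
  · intro j _
    tauto
  · intro j _
    tauto

/-- A non-exceptional vertex either is unmarked without marked neighbours, and deleting the marked
vertices changes nothing for it, or has more than `k` unmarked neighbours, so that its degree
exceeds `k` in each of the graphs compared. -/
theorem countDegreeJoined_iff {R : ℕ → ℕ → Prop} {a : ℕ → Prop} {k n i : ℕ}
    (h : ¬ Exceptional R a k n i) (c : ℕ) (hc : ¬ a i → c = 0) :
    degreeOn R (fun _ => True) n i + c = k ↔ ¬ a i ∧ degreeOn R (fun j => ¬ a j) n i = k := by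
  have e := degreeOn_true_eq R a n i
  by_cases hA : a i ∨ ∃ j < n, a j ∧ R i j
  · have h2 : k < degreeOn R (fun j => ¬ a j) n i := by
      by_contra h2
      exact h ⟨hA, not_lt.1 h2⟩
    constructor
    · intro h3; omega
    · rintro ⟨_, h3⟩; omega
  · have h1 : ¬ a i := fun h => hA (.inl h)
    have h2 : degreeOn R a n i = 0 := by
      by_contra h2
      exact hA (.inr (countBelow_pos_iff.1 (Nat.pos_of_ne_zero h2)))
    rw [e, h2, hc h1]
    simp [h1]

/-- Without exceptional vertices the two counts agree; with at least one, the trivial bound `2 C` is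
enough. Thus only boundedness of `f` enters. -/
theorem abs_sub_le_exceptional {f : ℕ → ℝ} {C : ℝ} (hC : 0 ≤ C) (hf : ∀ i, |f i| ≤ C)
    (R : ℕ → ℕ → Prop) (a : ℕ → Prop) (k n : ℕ) {p : ℕ → Prop}
    (h : ∀ i < n, ¬ Exceptional R a k n i →
      (p i ↔ ¬ a i ∧ degreeOn R (fun j => ¬ a j) n i = k)) :
    |f (countBelow n p) - f (countDegree R (fun j => ¬ a j) k n)| ≤
      2 * C * countBelow n (Exceptional R a k n) := by
  by_cases h0 : countBelow n (Exceptional R a k n) = 0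
  · have : countBelow n p = countDegree R (fun j => ¬ a j) k n := by
      refine countBelow_congr fun i hi => h i hi fun hE => ?_
      exact h0.not_gt (countBelow_pos_iff.2 ⟨i, hi, hE⟩)
    rw [this]
    simp [h0]
  · have h1 : (1 : ℝ) ≤ countBelow n (Exceptional R a k n) := by
      exact_mod_cast Nat.pos_of_ne_zero h0
    calc _ ≤ |f (countBelow n p)| + |f (countDegree R (fun j => ¬ a j) k n)| := abs_sub _ _
      _ ≤ C + C := add_le_add (hf _) (hf _)
      _ = 2 * C * 1 := by ring
      _ ≤ _ := by gcongr

theorem abs_sub_countDegreeJoined_le {f : ℕ → ℝ} {C : ℝ} (hC : 0 ≤ C) (hf : ∀ i, |f i| ≤ C)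
    (R : ℕ → ℕ → Prop) (a : ℕ → Prop) (k n : ℕ) :
    |f (countDegreeJoined R a k n) - f (countDegree R (fun j => ¬ a j) k n)| ≤
      2 * C * countBelow n (Exceptional R a k n) := by
  classical
  refine abs_sub_le_exceptional hC hf R a k n fun i _ hE => ?_
  exact countDegreeJoined_iff hE _ fun h => if_neg h

theorem abs_sub_countDegree_le {f : ℕ → ℝ} {C : ℝ} (hC : 0 ≤ C) (hf : ∀ i, |f i| ≤ C)
    (R : ℕ → ℕ → Prop) (a : ℕ → Prop) (k n : ℕ) :
    |f (countDegree R (fun _ => True) k n) - f (countDegree R (fun j => ¬ a j) k n)| ≤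
      2 * C * countBelow n (Exceptional R a k n) := by
  refine abs_sub_le_exceptional hC hf R a k n fun i _ hE => ?_
  simpa using countDegreeJoined_iff hE 0 fun _ => rfl

section Perm

variable {n : ℕ} (σ : Equiv.Perm ℕ) (hσ : ∀ i, σ i < n ↔ i < n) (R : ℕ → ℕ → Prop)
include hσ

theorem degreeOn_perm (b : ℕ → Prop) (i : ℕ) :
    degreeOn (fun i j => R (σ i) (σ j)) (fun j => b (σ j)) n i = degreeOn R b n (σ i) :=
  countBelow_perm σ hσ fun j => b j ∧ R (σ i) j

theorem countDegree_perm (b : ℕ → Prop) (k : ℕ) :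
    countDegree (fun i j => R (σ i) (σ j)) (fun j => b (σ j)) k n = countDegree R b k n := by
  unfold countDegree
  simp_rw [degreeOn_perm σ hσ R b]
  exact countBelow_perm σ hσ fun i => b i ∧ degreeOn R b n i = k

theorem exceptional_perm (a : ℕ → Prop) (k i : ℕ) :
    Exceptional (fun i j => R (σ i) (σ j)) (fun j => a (σ j)) k n i ↔
      Exceptional R a k n (σ i) := by
  unfold Exceptional
  rw [degreeOn_perm σ hσ R (fun j => ¬ a j)]
  have : (∃ j < n, a (σ j) ∧ R (σ i) (σ j)) ↔ ∃ j < n, a j ∧ R (σ i) j := by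
    constructor
    · rintro ⟨j, hj, h⟩
      exact ⟨σ j, (hσ j).2 hj, h⟩
    · rintro ⟨j, hj, h⟩
      refine ⟨σ.symm j, ?_, by simpa using h⟩
      have := hσ (σ.symm j)
      simp only [Equiv.apply_symm_apply] at this
      exact this.1 hj
  rw [this]

end Perm

theorem swap_lt_iff {n i : ℕ} (hi : i < n) (j : ℕ) : Equiv.swap 0 i j < n ↔ j < n := by
  rw [Equiv.swap_apply_def]
  split_ifs with h1 h2 <;> omega

end Counting

/-! ### Measurability of the counts -/

section Measurability

variable {Ω : Type*} [MeasurableSpace Ω]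

theorem measurable_countBelow {n : ℕ} {p : Ω → ℕ → Prop}
    (hp : ∀ i, Measurable fun ω => p ω i) : Measurable fun ω => countBelow n (p ω) := by
  classical
  simp_rw [countBelow_eq_sum]
  exact Finset.measurable_sum _ fun i _ =>
    Measurable.ite (measurableSet_setOfPred.2 (hp i)) measurable_const measurable_const

variable {R : Ω → ℕ → ℕ → Prop} (hR : ∀ i j, Measurable fun ω => R ω i j)
include hR

theorem measurable_degreeOn {b : Ω → ℕ → Prop} (hb : ∀ i, Measurable fun ω => b ω i)
    (n i : ℕ) : Measurable fun ω => degreeOn (R ω) (b ω) n i :=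
  measurable_countBelow fun j => (hb j).and (hR i j)

theorem measurable_countDegree {b : Ω → ℕ → Prop} (hb : ∀ i, Measurable fun ω => b ω i)
    (k n : ℕ) : Measurable fun ω => countDegree (R ω) (b ω) k n :=
  measurable_countBelow fun i => (hb i).and
    (measurableSet_setOfPred.1 ((measurable_degreeOn hR hb n i) (measurableSet_singleton k)))

theorem measurable_countDegreeJoined {a : Ω → ℕ → Prop} (ha : ∀ i, Measurable fun ω => a ω i)
    (k n : ℕ) : Measurable fun ω => countDegreeJoined (R ω) (a ω) k n := by
  classical
  refine measurable_countBelow fun i => measurableSet_setOfPred.1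
    ((Measurable.add (measurable_degreeOn hR (fun _ => measurable_const) n i)
      (Measurable.ite (measurableSet_setOfPred.2 (ha i)) measurable_const measurable_const))
        (measurableSet_singleton k))

theorem measurable_exceptional {a : Ω → ℕ → Prop} (ha : ∀ i, Measurable fun ω => a ω i)
    (k n i : ℕ) : Measurable fun ω => Exceptional (R ω) (a ω) k n i :=
  ((ha i).or (Measurable.exists fun j => measurable_const.and ((ha j).and (hR i j)))).and
    (measurableSet_setOfPred.1 ((measurable_degreeOn hR (fun j => (ha j).not) n i) measurableSet_Iic))

end Measurability

/-! ### The random connection model on configurations -/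

section Config

variable {Z : Type}

/-- Adjacency in the random connection model with connection function `g`. -/
def Config.adj (g : Z → Z → ℝ) (ω : Config Z) (i j : ℕ) : Prop :=
  i ≠ j ∧ ω.2 s(i, j) < g (ω.1 i) (ω.1 j)

/-- The vertices joined to an additional vertex at `x`. -/
def Config.joined (g : Z → Z → ℝ) (x : Z) (ω : Config (Z × ℝ)) (i : ℕ) : Prop :=
  (ω.1 i).2 < g x (ω.1 i).1

theorem Config.adj_relabel (g : Z → Z → ℝ) {f : ℕ → ℕ} (hf : Function.Injective f)
    (ω : Config Z) (i j : ℕ) : (ω.relabel f).adj g i j ↔ ω.adj g (f i) (f j) := by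
  simp [Config.adj, Config.relabel, hf.eq_iff]

theorem Config.joined_relabel (g : Z → Z → ℝ) (x : Z) (f : ℕ → ℕ)
    (ω : Config (Z × ℝ)) (i : ℕ) : (ω.relabel f).joined g x i ↔ ω.joined g x (f i) := Iff.rfl

theorem Config.adj_zero_succ (g : Z → Z → ℝ) (ω : Config Z) (j : ℕ) :
    ω.adj g 0 (j + 1) ↔ ω.pop.2.joined g ω.pop.1 j := by
  simp [Config.adj, Config.pop, Config.joined]

theorem Config.adj_succ_zero {g : Z → Z → ℝ} (hg : ∀ x y, g x y = g y x) (ω : Config Z) (j : ℕ) :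
    ω.adj g (j + 1) 0 ↔ ω.pop.2.joined g ω.pop.1 j := by
  rw [← Config.adj_zero_succ]
  simp only [Config.adj]
  rw [Sym2.eq_swap, hg, ne_comm]

theorem Config.adj_succ_succ (g : Z → Z → ℝ) (ω : Config Z) (i j : ℕ) :
    ω.adj g (i + 1) (j + 1) ↔ ω.pop.2.forget.adj g i j := by
  simp [Config.adj, Config.pop, Config.forget]

theorem Config.adj_zero_zero (g : Z → Z → ℝ) (ω : Config Z) : ¬ ω.adj g 0 0 := by
  simp [Config.adj]

theorem degreeOn_zero_pop (g : Z → Z → ℝ) (ω : Config Z) (n : ℕ) :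
    degreeOn (ω.adj g) (fun _ => True) (n + 1) 0 =
      countBelow n (ω.pop.2.joined g ω.pop.1) := by
  classical
  unfold degreeOn
  rw [countBelow_succ', if_neg (by simp [Config.adj_zero_zero]), zero_add]
  exact countBelow_congr fun j _ => by rw [Config.adj_zero_succ]; simp

/-- Vertex 0 is the `+ 1`; every other vertex gains one degree exactly when it is joined to vertex
0. -/
theorem countDegree_pop {g : Z → Z → ℝ} (hg : ∀ x y, g x y = g y x) (ω : Config Z) (k n : ℕ)
    (h : degreeOn (ω.adj g) (fun _ => True) (n + 1) 0 = k) :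
    countDegree (ω.adj g) (fun _ => True) k (n + 1) =
      countDegreeJoined (ω.pop.2.forget.adj g) (ω.pop.2.joined g ω.pop.1) k n + 1 := by
  classical
  unfold countDegree
  rw [countBelow_succ', if_pos ⟨trivial, h⟩, add_comm]
  congr 1
  refine countBelow_congr fun i _ => ?_
  simp only [true_and]
  unfold degreeOn
  rw [countBelow_succ']
  have h1 : (True ∧ ω.adj g (i + 1) 0) ↔ ω.pop.2.joined g ω.pop.1 i := by
    rw [true_and, Config.adj_succ_zero hg]
  simp only [h1, Config.adj_succ_succ]
  rw [add_comm]

variable [MeasurableSpace Z]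

theorem Config.measurable_adj {g : Z → Z → ℝ} (hg : Measurable fun p : Z × Z => g p.1 p.2)
    (i j : ℕ) : Measurable fun ω : Config Z => ω.adj g i j := by
  refine measurable_const.and (measurableSet_setOfPred.1 (measurableSet_lt (by fun_prop) ?_))
  exact hg.comp (by fun_prop : Measurable fun ω : Config Z => (ω.1 i, ω.1 j))

theorem Config.measurable_forget : Measurable (Config.forget : Config (Z × ℝ) → Config Z) := by
  unfold Config.forget
  fun_prop

theorem Config.measurable_joined {g : Z → Z → ℝ} (hg : Measurable fun p : Z × Z => g p.1 p.2)
    (i : ℕ) : Measurable fun p : Z × Config (Z × ℝ) => p.2.joined g p.1 i := by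
  refine measurableSet_setOfPred.1 (measurableSet_lt (by fun_prop) ?_)
  exact hg.comp (by fun_prop : Measurable fun p : Z × Config (Z × ℝ) => (p.1, (p.2.1 i).1))

theorem Config.measurable_adj_forget {g : Z → Z → ℝ}
    (hg : Measurable fun p : Z × Z => g p.1 p.2) (i j : ℕ) :
    Measurable fun p : Z × Config (Z × ℝ) => p.2.forget.adj g i j :=
  (Config.measurable_adj hg i j).comp (Config.measurable_forget.comp measurable_snd)

end Config


/-! ### Exponential Markov bounds for a Poisson number of i.i.d. marks -/

section IID

open scoped NNReal ENNReal

variable {Y : Type} [MeasurableSpace Y] (ρ : Measure Y) [IsProbabilityMeasure ρ]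

theorem lintegral_prod_infinitePi (s : Finset ℕ) {φ : ℕ → Y → ℝ≥0∞} (hφ : ∀ i, Measurable (φ i)) :
    ∫⁻ ζ, ∏ i ∈ s, φ i (ζ i) ∂Measure.infinitePi (fun _ : ℕ => ρ) =
      ∏ i ∈ s, ∫⁻ y, φ i y ∂ρ := by
  have h : iIndepFun (fun i (ζ : ℕ → Y) => φ i (ζ i)) (Measure.infinitePi fun _ : ℕ => ρ) :=
    iIndepFun_infinitePi hφ
  rw [lintegral_prod_eq_prod_lintegral_of_indepFun s _ h fun i => (hφ i).comp (measurable_pi_apply i)]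
  refine Finset.prod_congr rfl fun i _ => ?_
  exact (measurePreserving_eval_infinitePi (fun _ : ℕ => ρ) i).lintegral_comp (hφ i)

theorem measurable_prod_comp (s : Finset ℕ) {φ : ℕ → Y → ℝ≥0∞} (hφ : ∀ i, Measurable (φ i)) :
    Measurable fun ζ : ℕ → Y => ∏ i ∈ s, φ i (ζ i) :=
  Finset.measurable_fun_prod _ fun i _ => (hφ i).comp (measurable_pi_apply i)

/-- If at most `K` indices satisfy `p`, the product is at least `θ ^ K`. Passing to a subset `s`
only enlarges the product, which allows one index to be left out. -/
theorem ite_countBelow_le {θ : ℝ≥0∞} (hθ0 : θ ≠ 0) (hθ1 : θ ≤ 1) (K n : ℕ) (p : ℕ → Prop)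
    [DecidablePred p] (s : Finset ℕ) (hs : s ⊆ Finset.range n) :
    (if countBelow n p ≤ K then (1 : ℝ≥0∞) else 0) ≤
      θ⁻¹ ^ K * ∏ i ∈ s, if p i then θ else 1 := by
  split_ifs with h
  · have h1 : ∏ i ∈ s, (if p i then θ else 1) = θ ^ (s.filter p).card := by
      rw [Finset.prod_ite, Finset.prod_const, Finset.prod_const_one, mul_one]
    have h2 : (s.filter p).card ≤ K := by
      refine le_trans ?_ h
      rw [countBelow_eq_sum, ← Finset.card_filter]
      exact Finset.card_le_card (Finset.filter_subset_filter _ hs)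
    have hθt : θ ≠ ∞ := (hθ1.trans_lt ENNReal.one_lt_top).ne
    rw [h1]
    calc (1 : ℝ≥0∞) = θ⁻¹ ^ K * θ ^ K := by
          rw [← mul_pow, ENNReal.inv_mul_cancel hθ0 hθt, one_pow]
      _ ≤ _ := by
        refine mul_le_mul' le_rfl ?_
        exact pow_le_pow_of_le_one zero_le hθ1 h2
  · exact zero_le

open Classical in
theorem lintegral_ite_mem {B : Set Y} (hB : MeasurableSet B) {θ : ℝ} (h0 : 0 ≤ θ) :
    ∫⁻ y, (if y ∈ B then ENNReal.ofReal θ else 1) ∂ρ =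
      ENNReal.ofReal (1 - (1 - θ) * ρ.real B) := by
  have e : ∀ y, (if y ∈ B then ENNReal.ofReal θ else 1) =
      B.indicator (fun _ => ENNReal.ofReal θ) y + Bᶜ.indicator (fun _ => 1) y := by
    intro y
    by_cases hy : y ∈ B <;> simp [hy]
  simp_rw [e]
  rw [lintegral_add_left (measurable_const.indicator hB), lintegral_indicator_const hB,
    lintegral_indicator_const hB.compl, one_mul, ← ofReal_measureReal (μ := ρ) (s := B),
    ← ofReal_measureReal (μ := ρ) (s := Bᶜ), probReal_compl_eq_one_sub hB,
    ← ENNReal.ofReal_mul h0, ← ENNReal.ofReal_add (by positivity)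
      (by linarith [measureReal_le_one (μ := ρ) (s := B)])]
  ring_nf

/-- The law of a Poisson number of independent marks. -/
def poissonConfig (r : ℝ≥0) {Ω : Type} [MeasurableSpace Ω] (P : Measure Ω) : Measure (ℕ × Ω) :=
  (poissonMeasure r).prod P

instance (r : ℝ≥0) {Ω : Type} [MeasurableSpace Ω] (P : Measure Ω) [IsProbabilityMeasure P] :
    IsProbabilityMeasure (poissonConfig r P) := by
  unfold poissonConfig
  infer_instance

theorem lintegral_poissonConfig (r : ℝ≥0) {Ω : Type} [MeasurableSpace Ω] (P : Measure Ω)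
    [IsProbabilityMeasure P] {F : ℕ → Ω → ℝ≥0∞} (hF : ∀ n, Measurable (F n)) :
    ∫⁻ p, F p.1 p.2 ∂poissonConfig r P = ∫⁻ n, ∫⁻ ω, F n ω ∂P ∂poissonMeasure r :=
  lintegral_prod _ (measurable_from_prod_countable_right (f := fun p : ℕ × Ω => F p.1 p.2)
    hF).aemeasurable

theorem measurable_uncurry_nat {Ω E : Type*} [MeasurableSpace Ω] [MeasurableSpace E]
    {F : ℕ → Ω → E} (hF : ∀ n, Measurable (F n)) : Measurable fun p : ℕ × Ω => F p.1 p.2 :=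
  measurable_from_prod_countable_right (f := fun p : ℕ × Ω => F p.1 p.2) hF

section Bounds

variable {B C : Set Y} (hB : MeasurableSet B) (hC : MeasurableSet C) (r : ℝ≥0) (K : ℕ) {θ : ℝ}
  (h0 : 0 < θ) (h1 : θ ≤ 1)
include hB h0 h1

open Classical in
-- For fixed `n` the product bound integrates to `Q ^ n` with `Q = 1 - (1 - θ) ρ(B)`, and `E[Q ^ N]
-- = exp (-r (1 - Q))`.
theorem lintegral_countBelow_le :
    ∫⁻ n, ∫⁻ ζ, (if countBelow n (fun i => ζ i ∈ B) ≤ K then 1 else 0)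
        ∂Measure.infinitePi (fun _ : ℕ => ρ) ∂poissonMeasure r ≤
      ENNReal.ofReal (θ⁻¹ ^ K * Real.exp (-((1 - θ) * (r * ρ.real B)))) := by
  have hθ : ENNReal.ofReal θ ≠ 0 := by simpa using h0
  have hθ1 : ENNReal.ofReal θ ≤ 1 := by simpa using h1
  have hQ : 0 ≤ 1 - (1 - θ) * ρ.real B := by
    have : ρ.real B ≤ 1 := measureReal_le_one
    have : 0 ≤ ρ.real B := measureReal_nonneg
    nlinarith
  calc _ ≤ ∫⁻ n, (ENNReal.ofReal θ)⁻¹ ^ K * ENNReal.ofReal (1 - (1 - θ) * ρ.real B) ^ n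
          ∂poissonMeasure r := by
        refine lintegral_mono fun n => ?_
        refine (lintegral_mono fun ζ => ite_countBelow_le hθ hθ1 K n _ (Finset.range n)
          subset_rfl).trans ?_
        have hm : Measurable fun y : Y => if y ∈ B then ENNReal.ofReal θ else 1 :=
          Measurable.ite hB measurable_const measurable_const
        rw [lintegral_const_mul _ (measurable_prod_comp _ fun _ => hm),
          lintegral_prod_infinitePi ρ _ fun _ => hm, lintegral_ite_mem ρ hB h0.le]
        simp
    _ = _ := by
        rw [lintegral_const_mul _ (by fun_prop), lintegral_pow_poissonMeasure r hQ,
          ENNReal.ofReal_mul (by positivity), ← ENNReal.ofReal_inv_of_pos h0,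
          ENNReal.ofReal_pow (by positivity)]
        congr 3
        ring

include hC
open Classical in
-- One index is required to lie in `C` and the Markov bound is applied to the others; size biasing
-- turns `n Q ^ (n - 1)` into `r Q ^ n`.
theorem lintegral_count_mul_countBelow_le :
    ∫⁻ n, ∫⁻ ζ, (countBelow n (fun i => ζ i ∈ C) : ℝ≥0∞) *
        (if countBelow n (fun i => ζ i ∈ B) ≤ K then 1 else 0)
        ∂Measure.infinitePi (fun _ : ℕ => ρ) ∂poissonMeasure r ≤
      ENNReal.ofReal (r * ρ.real C * (θ⁻¹ ^ K * Real.exp (-((1 - θ) * (r * ρ.real B))))) := by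
  have hθ : ENNReal.ofReal θ ≠ 0 := by simpa using h0
  have hθ1 : ENNReal.ofReal θ ≤ 1 := by simpa using h1
  have hQ : 0 ≤ 1 - (1 - θ) * ρ.real B := by
    have : ρ.real B ≤ 1 := measureReal_le_one
    have : 0 ≤ ρ.real B := measureReal_nonneg
    nlinarith
  have hm : Measurable fun y : Y => if y ∈ B then ENNReal.ofReal θ else 1 :=
    Measurable.ite hB measurable_const measurable_const
  have hmC : Measurable fun y : Y => if y ∈ C then (1 : ℝ≥0∞) else 0 :=
    Measurable.ite hC measurable_const measurable_const
  -- The index tested for `C` is erased from the product, so `B` and `C` may overlap.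
  have hone : ∀ n i, i ∈ Finset.range n →
      ∫⁻ ζ : ℕ → Y, (if ζ i ∈ C then (1 : ℝ≥0∞) else 0) * ((ENNReal.ofReal θ)⁻¹ ^ K *
        ∏ j ∈ (Finset.range n).erase i, if ζ j ∈ B then ENNReal.ofReal θ else 1)
          ∂Measure.infinitePi (fun _ : ℕ => ρ) =
      (ENNReal.ofReal θ)⁻¹ ^ K * (ρ C * ENNReal.ofReal (1 - (1 - θ) * ρ.real B) ^ (n - 1)) := by
    intro n i hi
    have e : ∀ ζ : ℕ → Y, (if ζ i ∈ C then (1 : ℝ≥0∞) else 0) * ((ENNReal.ofReal θ)⁻¹ ^ K *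
        ∏ j ∈ (Finset.range n).erase i, if ζ j ∈ B then ENNReal.ofReal θ else 1) =
        (ENNReal.ofReal θ)⁻¹ ^ K * ∏ j ∈ Finset.range n,
          (if j = i then fun y : Y => if y ∈ C then (1 : ℝ≥0∞) else 0
            else fun y : Y => if y ∈ B then ENNReal.ofReal θ else 1) (ζ j) := by
      intro ζ
      rw [← Finset.mul_prod_erase _ _ hi, if_pos rfl, mul_left_comm]
      congr 2
      refine Finset.prod_congr rfl fun j hj => ?_
      rw [if_neg (Finset.ne_of_mem_erase hj)]
    have hm' : ∀ j, Measurable (if j = i then fun y : Y => if y ∈ C then (1 : ℝ≥0∞) else 0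
            else fun y : Y => if y ∈ B then ENNReal.ofReal θ else 1) := by
      intro j
      split_ifs
      · exact hmC
      · exact hm
    simp_rw [e]
    rw [lintegral_const_mul _ (measurable_prod_comp _ hm'), lintegral_prod_infinitePi ρ _ hm',
      ← Finset.mul_prod_erase _ _ hi, if_pos rfl]
    congr 2
    · rw [show (fun y : Y => if y ∈ C then (1 : ℝ≥0∞) else 0) = C.indicator 1 from by
        ext y; simp [Set.indicator_apply]]
      exact lintegral_indicator_one hC
    · rw [Finset.prod_congr rfl fun j hj => by rw [if_neg (Finset.ne_of_mem_erase hj)],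
        lintegral_ite_mem ρ hB h0.le, Finset.prod_const, Finset.card_erase_of_mem hi,
        Finset.card_range]
  calc _ ≤ ∫⁻ n : ℕ, (n : ℝ≥0∞) * ((ENNReal.ofReal θ)⁻¹ ^ K *
        (ρ C * ENNReal.ofReal (1 - (1 - θ) * ρ.real B) ^ (n - 1))) ∂poissonMeasure r := by
        refine lintegral_mono fun n => ?_
        calc _ ≤ ∫⁻ ζ : ℕ → Y, ∑ i ∈ Finset.range n, (if ζ i ∈ C then (1 : ℝ≥0∞) else 0) *
              ((ENNReal.ofReal θ)⁻¹ ^ K *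
                ∏ j ∈ (Finset.range n).erase i, if ζ j ∈ B then ENNReal.ofReal θ else 1)
                ∂Measure.infinitePi (fun _ : ℕ => ρ) := by
              refine lintegral_mono fun ζ => ?_
              rw [countBelow_eq_sum]
              push_cast
              rw [Finset.sum_mul]
              refine Finset.sum_le_sum fun i _ => ?_
              refine mul_le_mul' le_rfl ?_
              exact ite_countBelow_le hθ hθ1 K n _ _ (Finset.erase_subset _ _)
          _ = _ := by
              rw [lintegral_finsetSum]
              · rw [Finset.sum_congr rfl (hone n)]
                simp
              · intro i _
                exact (hmC.comp (measurable_pi_apply i)).mul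
                  ((measurable_prod_comp _ fun _ => hm).const_mul _)
    _ = r * ∫⁻ n : ℕ, ((ENNReal.ofReal θ)⁻¹ ^ K *
        (ρ C * ENNReal.ofReal (1 - (1 - θ) * ρ.real B) ^ n)) ∂poissonMeasure r := by
        rw [lintegral_nat_mul_poissonMeasure]
        simp
    _ = _ := by
        rw [lintegral_const_mul _ (by fun_prop), lintegral_const_mul _ (by fun_prop),
          lintegral_pow_poissonMeasure r hQ, ENNReal.ofReal_mul (by positivity),
          ENNReal.ofReal_mul (by positivity), ENNReal.ofReal_mul (by positivity),
          ← ENNReal.ofReal_inv_of_pos h0, ofReal_measureReal, ENNReal.ofReal_coe_nnreal,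
          ENNReal.ofReal_pow (by positivity)]
        rw [show (r : ℝ) * (1 - (1 - (1 - θ) * ρ.real B)) = (1 - θ) * (r * ρ.real B) by ring]
        ring

end Bounds

end IID


/-! ### Exchangeability of the vertices -/

section Exchangeability

open scoped NNReal ENNReal

variable {Z : Type} [MeasurableSpace Z] (ν : Measure Z) [IsProbabilityMeasure ν]

open Classical in
-- Transposing 0 and `i` preserves the law and fixes `h`, so every vertex contributes as much as
-- vertex 0.
theorem lintegral_countBelow_mul {p : Config Z → ℕ → Prop} (hp : ∀ i, Measurable fun ω => p ω i)
    {h : Config Z → ℝ≥0∞} (hh : Measurable h) (n : ℕ)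
    (hpσ : ∀ i < n, ∀ ω : Config Z, p (ω.relabel (Equiv.swap 0 i)) 0 ↔ p ω i)
    (hhσ : ∀ i < n, ∀ ω : Config Z, h (ω.relabel (Equiv.swap 0 i)) = h ω) :
    ∫⁻ ω, (countBelow n (p ω) : ℝ≥0∞) * h ω ∂configLaw ν =
      n * ∫⁻ ω, (if p ω 0 then 1 else 0) * h ω ∂configLaw ν := by
  have hm : ∀ i, Measurable fun ω : Config Z => (if p ω i then (1 : ℝ≥0∞) else 0) * h ω :=
    fun i => (Measurable.ite (measurableSet_setOfPred.2 (hp i)) measurable_const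
      measurable_const).mul hh
  have e : ∀ ω : Config Z, (countBelow n (p ω) : ℝ≥0∞) * h ω =
      ∑ i ∈ Finset.range n, (if p ω i then (1 : ℝ≥0∞) else 0) * h ω := by
    intro ω
    rw [countBelow_eq_sum]
    push_cast
    rw [Finset.sum_mul]
  simp_rw [e]
  rw [lintegral_finsetSum _ fun i _ => hm i]
  rw [Finset.sum_congr rfl (g := fun _ => ∫⁻ ω, (if p ω 0 then (1 : ℝ≥0∞) else 0) * h ω
    ∂configLaw ν)]
  · simp
  · intro i hi
    rw [← (measurePreserving_relabel ν (Equiv.swap 0 i).injective).lintegral_comp (hm 0)]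
    refine lintegral_congr fun ω => ?_
    rw [hhσ i (Finset.mem_range.1 hi), if_congr (hpσ i (Finset.mem_range.1 hi) ω) rfl rfl]

open Classical in
theorem integral_countBelow_mul {p : Config Z → ℕ → Prop} (hp : ∀ i, Measurable fun ω => p ω i)
    {h : Config Z → ℝ} (hh : Measurable h) {C : ℝ} (hC : ∀ ω, |h ω| ≤ C) (n : ℕ)
    (hpσ : ∀ i < n, ∀ ω : Config Z, p (ω.relabel (Equiv.swap 0 i)) 0 ↔ p ω i)
    (hhσ : ∀ i < n, ∀ ω : Config Z, h (ω.relabel (Equiv.swap 0 i)) = h ω) :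
    ∫ ω, (countBelow n (p ω) : ℝ) * h ω ∂configLaw ν =
      n * ∫ ω, (if p ω 0 then 1 else 0) * h ω ∂configLaw ν := by
  have hm : ∀ i, Measurable fun ω : Config Z => (if p ω i then (1 : ℝ) else 0) * h ω :=
    fun i => (Measurable.ite (measurableSet_setOfPred.2 (hp i)) measurable_const
      measurable_const).mul hh
  have e : ∀ ω : Config Z, (countBelow n (p ω) : ℝ) * h ω =
      ∑ i ∈ Finset.range n, (if p ω i then (1 : ℝ) else 0) * h ω := by
    intro ω
    rw [countBelow_eq_sum]
    push_cast
    rw [Finset.sum_mul]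
  simp_rw [e]
  rw [integral_finsetSum _ fun i _ => Integrable.of_bound (hm i).aestronglyMeasurable C
    (ae_of_all _ fun ω => ?_)]
  · rw [Finset.sum_congr rfl (g := fun _ => ∫ ω, (if p ω 0 then (1 : ℝ) else 0) * h ω
      ∂configLaw ν)]
    · simp
    · intro i hi
      have hmp := measurePreserving_relabel ν (Equiv.swap 0 i).injective
      rw [← hmp.map_eq, integral_map hmp.measurable.aemeasurable (hm 0).aestronglyMeasurable]
      rw [hmp.map_eq]
      refine integral_congr_ae (ae_of_all _ fun ω => ?_)
      simp only
      rw [hhσ i (Finset.mem_range.1 hi), if_congr (hpσ i (Finset.mem_range.1 hi) ω) rfl rfl]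
  · have := hC ω
    have h0 := abs_nonneg (h ω)
    rw [Real.norm_eq_abs, abs_mul]
    split_ifs
    · simpa using this
    · simp; linarith

end Exchangeability

/-! ### Probabilities of edges from one point to two given points -/

section Pair

open scoped NNReal ENNReal

theorem uniformUnit_Iio {c : ℝ} (h1 : c ≤ 1) :
    uniformUnit {u | u < c} = ENNReal.ofReal c := by
  rw [uniformUnit, Measure.restrict_apply (show MeasurableSet {u | u < c} from measurableSet_Iio)]
  have : {u | u < c} ∩ Set.Icc 0 1 = Set.Ico 0 c := by
    ext u
    simp only [Set.mem_inter_iff, Set.mem_ofPred_eq, Set.mem_Icc, Set.mem_Ico]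
    constructor
    · rintro ⟨h, h', _⟩
      exact ⟨h', h⟩
    · rintro ⟨h, h'⟩
      exact ⟨h', h, by linarith⟩
  rw [this, Real.volume_Ico, sub_zero]

variable {Z : Type} [MeasurableSpace Z] (ν : Measure Z) [IsProbabilityMeasure ν]
  {g : Z → Z → ℝ}

/-- Marks for which there is an edge to `x` in the first coordinate. -/
def hitFst (g : Z → Z → ℝ) (x : Z) : Set ((Z × ℝ) × ℝ) := {ζ | ζ.1.2 < g x ζ.1.1}

/-- Marks for which there is an edge to `y` in the second coordinate. -/
def hitSnd (g : Z → Z → ℝ) (y : Z) : Set ((Z × ℝ) × ℝ) := {ζ | ζ.2 < g y ζ.1.1}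

/-- The law of a point together with two independent uniform marks. -/
def pairLaw (ν : Measure Z) [IsProbabilityMeasure ν] : Measure ((Z × ℝ) × ℝ) :=
  (ν.prod uniformUnit).prod uniformUnit

instance : IsProbabilityMeasure (pairLaw ν) := by
  unfold pairLaw
  infer_instance

/-- The probability that a random point is joined to `x`. -/
def joinProb (ν : Measure Z) (g : Z → Z → ℝ) (x : Z) : ℝ := ∫ z, g x z ∂ν

/-- The probability that a random point is joined to both `x` and `y`. -/
def jointProb (ν : Measure Z) (g : Z → Z → ℝ) (x y : Z) : ℝ := ∫ z, g x z * g y z ∂ν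

theorem jointProb_nonneg {ν : Measure Z} (hg0 : ∀ x y, 0 ≤ g x y) (x y : Z) :
    0 ≤ jointProb ν g x y :=
  integral_nonneg fun z => mul_nonneg (hg0 x z) (hg0 y z)

theorem joinProb_nonneg {ν : Measure Z} (hg0 : ∀ x y, 0 ≤ g x y) (x : Z) : 0 ≤ joinProb ν g x :=
  integral_nonneg fun z => hg0 x z

variable (hgm : Measurable fun p : Z × Z => g p.1 p.2) (hg0 : ∀ x y, 0 ≤ g x y)
  (hg1 : ∀ x y, g x y ≤ 1)

include hgm

theorem measurable_mem_hitFst : Measurable fun p : Z × ((Z × ℝ) × ℝ) => p.2 ∈ hitFst g p.1 := by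
  refine measurableSet_setOfPred.1 (measurableSet_lt
    (f := fun p : Z × ((Z × ℝ) × ℝ) => p.2.1.2) (g := fun p => g p.1 p.2.1.1) (by fun_prop) ?_)
  exact hgm.comp (by fun_prop : Measurable fun p : Z × ((Z × ℝ) × ℝ) => (p.1, p.2.1.1))

theorem measurable_mem_hitSnd : Measurable fun p : Z × ((Z × ℝ) × ℝ) => p.2 ∈ hitSnd g p.1 := by
  refine measurableSet_setOfPred.1 (measurableSet_lt
    (f := fun p : Z × ((Z × ℝ) × ℝ) => p.2.2) (g := fun p => g p.1 p.2.1.1) (by fun_prop) ?_)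
  exact hgm.comp (by fun_prop : Measurable fun p : Z × ((Z × ℝ) × ℝ) => (p.1, p.2.1.1))

theorem measurableSet_hitFst (x : Z) : MeasurableSet (hitFst g x) :=
  measurableSet_setOfPred.2 ((measurable_mem_hitFst hgm).comp measurable_prodMk_left)

theorem measurableSet_hitSnd (x : Z) : MeasurableSet (hitSnd g x) :=
  measurableSet_setOfPred.2 ((measurable_mem_hitSnd hgm).comp measurable_prodMk_left)

include hg0 hg1

theorem integrable_g (x : Z) : Integrable (fun z => g x z) ν :=
  .of_bound (hgm.comp measurable_prodMk_left).aestronglyMeasurable 1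
    (ae_of_all _ fun z => by rw [Real.norm_eq_abs, abs_of_nonneg (hg0 x z)]; exact hg1 x z)

theorem integrable_g_mul_g (x y : Z) : Integrable (fun z => g x z * g y z) ν :=
  .of_bound ((hgm.comp measurable_prodMk_left).mul
    (hgm.comp measurable_prodMk_left)).aestronglyMeasurable 1
    (ae_of_all _ fun z => by
      rw [Real.norm_eq_abs, abs_of_nonneg (mul_nonneg (hg0 x z) (hg0 y z))]
      exact mul_le_one₀ (hg1 x z) (hg0 y z) (hg1 y z))

theorem pairLaw_real_hitFst (x : Z) : (pairLaw ν).real (hitFst g x) = joinProb ν g x := by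
  have h : pairLaw ν (hitFst g x) = ∫⁻ z, ENNReal.ofReal (g x z) ∂ν := by
    have e : hitFst g x = {p : Z × ℝ | p.2 < g x p.1} ×ˢ (Set.univ : Set ℝ) := by
      ext ζ; simp [hitFst]
    rw [pairLaw, e, Measure.prod_prod, measure_univ, mul_one, Measure.prod_apply]
    · refine lintegral_congr fun z => ?_
      exact uniformUnit_Iio (hg1 x z)
    · refine measurableSet_lt (by fun_prop) ?_
      exact hgm.comp (by fun_prop : Measurable fun p : Z × ℝ => (x, p.1))
  rw [measureReal_def, h, joinProb, integral_eq_lintegral_of_nonneg_ae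
    (ae_of_all _ (hg0 x)) (integrable_g ν hgm hg0 hg1 x).1]

omit hg0 in
theorem pairLaw_hitSnd_inter (y : Z) {A : Set (Z × ℝ)} (hA : MeasurableSet A) :
    pairLaw ν (hitSnd g y ∩ Prod.fst ⁻¹' A) =
      ∫⁻ p, A.indicator (fun p => ENNReal.ofReal (g y p.1)) p ∂(ν.prod uniformUnit) := by
  rw [pairLaw, Measure.prod_apply ((measurableSet_hitSnd hgm y).inter (measurable_fst hA))]
  refine lintegral_congr fun p => ?_
  by_cases hp : p ∈ A
  · rw [Set.indicator_of_mem hp, ← uniformUnit_Iio (hg1 y p.1)]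
    congr 1
    ext u
    simp [hitSnd, hp]
  · rw [Set.indicator_of_notMem hp]
    convert measure_empty (μ := uniformUnit)
    ext u
    simp [hp]

theorem pairLaw_real_hitSnd (y : Z) : (pairLaw ν).real (hitSnd g y) = joinProb ν g y := by
  have h := pairLaw_hitSnd_inter ν hgm hg1 y MeasurableSet.univ
  simp only [Set.preimage_univ, Set.inter_univ, Set.indicator_univ] at h
  have hm : Measurable fun z => ENNReal.ofReal (g y z) :=
    (hgm.comp measurable_prodMk_left).ennreal_ofReal
  rw [measureReal_def, h, joinProb, integral_eq_lintegral_of_nonneg_ae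
    (ae_of_all _ (hg0 y)) (integrable_g ν hgm hg0 hg1 y).1]
  congr 1
  exact (measurePreserving_fst (μ := ν) (ν := uniformUnit)).lintegral_comp hm

/-- Given the random point, its two edge marks are independent, so the conditional probability is a
product. -/
theorem pairLaw_real_hitFst_inter_hitSnd (x y : Z) :
    (pairLaw ν).real (hitFst g x ∩ hitSnd g y) = jointProb ν g x y := by
  have hA : MeasurableSet {p : Z × ℝ | p.2 < g x p.1} := by
    refine measurableSet_lt (by fun_prop) ?_
    exact hgm.comp (by fun_prop : Measurable fun p : Z × ℝ => (x, p.1))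
  have h := pairLaw_hitSnd_inter ν hgm hg1 y hA
  have hm : Measurable fun z => ENNReal.ofReal (g y z) :=
    (hgm.comp measurable_prodMk_left).ennreal_ofReal
  have h' : ∫⁻ p, {p : Z × ℝ | p.2 < g x p.1}.indicator (fun p => ENNReal.ofReal (g y p.1)) p
      ∂(ν.prod uniformUnit) = ∫⁻ z, ENNReal.ofReal (g x z * g y z) ∂ν := by
    rw [lintegral_prod _ ((Measurable.indicator (f := fun p : Z × ℝ => ENNReal.ofReal (g y p.1))
      (hm.comp measurable_fst) hA).aemeasurable)]
    refine lintegral_congr fun z => ?_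
    have e : ∀ u : ℝ, {p : Z × ℝ | p.2 < g x p.1}.indicator
        (fun p => ENNReal.ofReal (g y p.1)) (z, u) =
        {u | u < g x z}.indicator (fun _ => ENNReal.ofReal (g y z)) u := by
      intro u
      simp [Set.indicator_apply]
    simp_rw [e]
    rw [lintegral_indicator_const (show MeasurableSet {u | u < g x z} from measurableSet_Iio), uniformUnit_Iio (hg1 x z),
      ENNReal.ofReal_mul (hg0 x z), mul_comm]
  rw [measureReal_def, Set.inter_comm, show hitFst g x = Prod.fst ⁻¹' {p : Z × ℝ | p.2 < g x p.1}
    from rfl, h, h', jointProb, integral_eq_lintegral_of_nonneg_ae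
    (ae_of_all _ fun z => mul_nonneg (hg0 x z) (hg0 y z))
    (integrable_g_mul_g ν hgm hg0 hg1 x y).1]

theorem pairLaw_real_union (x y : Z) :
    (pairLaw ν).real (hitFst g x ∪ hitSnd g y) =
      joinProb ν g x + joinProb ν g y - jointProb ν g x y := by
  have h := measureReal_union_add_inter (μ := pairLaw ν) (s := hitFst g x)
    (measurableSet_hitSnd hgm y)
  rw [pairLaw_real_hitFst ν hgm hg0 hg1, pairLaw_real_hitSnd ν hgm hg0 hg1,
    pairLaw_real_hitFst_inter_hitSnd ν hgm hg0 hg1] at h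
  linarith

theorem pairLaw_real_diff (x y : Z) :
    (pairLaw ν).real (hitSnd g y \ hitFst g x) = joinProb ν g y - jointProb ν g x y := by
  have h := measureReal_inter_add_sdiff (μ := pairLaw ν) (s := hitSnd g y)
    (measurableSet_hitFst hgm x)
  rw [Set.inter_comm, pairLaw_real_hitSnd ν hgm hg0 hg1,
    pairLaw_real_hitFst_inter_hitSnd ν hgm hg0 hg1] at h
  linarith

end Pair


/-! ### Exploring a potentially exceptional vertex -/

section Pair

open scoped NNReal ENNReal

variable {Z : Type} [MeasurableSpace Z] (ν : Measure Z) [IsProbabilityMeasure ν]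
  {g : Z → Z → ℝ}

open Classical in
-- The entry 1 of the minimum comes from dropping the first event. The other is a union bound in
-- which the existence of a point in `C` is replaced by the number of such points.
theorem lintegral_edge_or_le {Y : Type} [MeasurableSpace Y] (ρ : Measure Y)
    [IsProbabilityMeasure ρ] {B C : Set Y} (hB : MeasurableSet B) (hC : MeasurableSet C)
    (r : ℝ≥0) (K : ℕ) {θ : ℝ} (h0 : 0 < θ) (h1 : θ ≤ 1) {c : ℝ} (hc0 : 0 ≤ c) (hc1 : c ≤ 1) :
    ∫⁻ t, ∫⁻ n, ∫⁻ ζ, (if (t < c ∨ 0 < countBelow n (fun i => ζ i ∈ C)) ∧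
        countBelow n (fun i => ζ i ∈ B) ≤ K then 1 else 0)
        ∂Measure.infinitePi (fun _ : ℕ => ρ) ∂poissonMeasure r ∂uniformUnit ≤
      ENNReal.ofReal (min 1 (c + r * ρ.real C) *
        (θ⁻¹ ^ K * Real.exp (-((1 - θ) * (r * ρ.real B))))) := by
  set X := θ⁻¹ ^ K * Real.exp (-((1 - θ) * (r * ρ.real B))) with hX
  have hX0 : 0 ≤ X := by positivity
  have hmB : ∀ n, Measurable fun ζ : ℕ → Y => if countBelow n (fun i => ζ i ∈ B) ≤ K
      then (1 : ℝ≥0∞) else 0 := fun n =>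
    Measurable.ite ((measurable_countBelow (fun i => measurableSet_setOfPred.1
      (measurable_pi_apply i hB))) measurableSet_Iic) measurable_const measurable_const
  have b1 := lintegral_countBelow_le ρ hB r K h0 h1
  have b2 := lintegral_count_mul_countBelow_le ρ hB hC r K h0 h1
  rw [← hX] at b1 b2
  rw [min_mul_of_nonneg _ _ hX0, ENNReal.ofReal_min, le_min_iff]
  constructor
  · calc _ ≤ ∫⁻ _t, ENNReal.ofReal X ∂uniformUnit := by
          refine lintegral_mono fun t => le_trans ?_ b1
          refine lintegral_mono fun n => lintegral_mono fun ζ => ?_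
          simp only
          split_ifs with h h' <;> simp_all
      _ = _ := by simp
  · calc _ ≤ ∫⁻ t, ({t | t < c}.indicator (fun _ => ENNReal.ofReal X) t +
            ENNReal.ofReal (r * ρ.real C * X)) ∂uniformUnit := by
          refine lintegral_mono fun t => ?_
          calc _ ≤ ∫⁻ n, ((if t < c then 1 else 0) * ∫⁻ ζ : ℕ → Y, (if countBelow n
                  (fun i => ζ i ∈ B) ≤ K then 1 else 0) ∂Measure.infinitePi (fun _ : ℕ => ρ) +
                ∫⁻ ζ : ℕ → Y, (countBelow n (fun i => ζ i ∈ C) : ℝ≥0∞) *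
                  (if countBelow n (fun i => ζ i ∈ B) ≤ K then 1 else 0)
                  ∂Measure.infinitePi (fun _ : ℕ => ρ)) ∂poissonMeasure r := by
                refine lintegral_mono fun n => ?_
                simp only
                rw [← lintegral_const_mul _ (hmB n), ← lintegral_add_left ((hmB n).const_mul _)]
                refine lintegral_mono fun ζ => ?_
                simp only
                split_ifs with h h2 h3 h3 <;> try simp_all
                exact h
            _ ≤ (if t < c then 1 else 0) * ENNReal.ofReal X + ENNReal.ofReal (r * ρ.real C * X) := by
                rw [lintegral_add_left .of_discrete, lintegral_const_mul _ .of_discrete]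
                gcongr
            _ = _ := by simp [Set.indicator_apply]
      _ = _ := by
          rw [lintegral_add_right _ measurable_const, lintegral_indicator_const
            (show MeasurableSet {t | t < c} from measurableSet_Iio), uniformUnit_Iio hc1,
            lintegral_const, measure_univ, mul_one, ← ENNReal.ofReal_mul hX0,
            ← ENNReal.ofReal_add (by positivity) (by positivity)]
          congr 1
          ring

omit [MeasurableSpace Z] in
-- After `pop`, the explored vertex carries its position and its edge mark towards `x`; every other
-- vertex carries two edge marks, the first towards `x` and the second towards the explored vertex.
-- A neighbour of the latter that is joined to `x` is a common neighbour.
theorem exceptional_pop {k n : ℕ} {x : Z} {ω : Config (Z × ℝ)}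
    (h : Exceptional (ω.forget.adj g) (ω.joined g x) k (n + 1) 0) :
    (ω.pop.1.2 < g x ω.pop.1.1 ∨
        0 < countBelow n (fun i => ω.pop.2.1 i ∈ hitFst g x ∩ hitSnd g ω.pop.1.1)) ∧
      countBelow n (fun i => ω.pop.2.1 i ∈ hitSnd g ω.pop.1.1 \ hitFst g x) ≤ k := by
  classical
  have hadj : ∀ j, ω.forget.adj g 0 (j + 1) ↔ ω.pop.2.1 j ∈ hitSnd g ω.pop.1.1 := by
    intro j
    simp [Config.adj, Config.forget, Config.pop, hitSnd]
  have hjoin : ∀ j, ω.joined g x (j + 1) ↔ ω.pop.2.1 j ∈ hitFst g x := by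
    intro j
    simp [Config.joined, Config.pop, hitFst]
  obtain ⟨h1, h2⟩ := h
  constructor
  · rcases h1 with h1 | ⟨j, hj, h1, h3⟩
    · exact .inl h1
    · cases j with
      | zero => exact absurd h3 (Config.adj_zero_zero g _)
      | succ j =>
        exact .inr (countBelow_pos_iff.2 ⟨j, by omega, (hjoin j).1 h1, (hadj j).1 h3⟩)
  · refine le_trans ?_ h2
    unfold degreeOn
    rw [countBelow_succ']
    refine le_trans (le_of_eq (countBelow_congr fun j _ => ?_)) (Nat.le_add_left _ _)
    change _ ↔ ¬ ω.joined g x (j + 1) ∧ _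
    rw [hjoin, hadj]
    exact and_comm

variable (hgm : Measurable fun p : Z × Z => g p.1 p.2) (hg0 : ∀ x y, 0 ≤ g x y)
  (hg1 : ∀ x y, g x y ≤ 1)

include hgm hg0 hg1

open Classical in
-- The set `B` and the bound `K` stay free because two cases are needed: neighbours of either point
-- with `2 k`, and neighbours of `y` alone with `k`.
theorem lintegral_pop_le (r : ℝ≥0) (K : ℕ) {θ : ℝ} (h0 : 0 < θ) (h1 : θ ≤ 1) (x : Z)
    {B : Z → Set ((Z × ℝ) × ℝ)} (hB : Measurable fun p : Z × ((Z × ℝ) × ℝ) => p.2 ∈ B p.1)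
    {H : ℕ → Config (Z × ℝ) → Prop}
    (hH : ∀ n ω, H n ω → (ω.pop.1.2 < g x ω.pop.1.1 ∨
        0 < countBelow n (fun i => ω.pop.2.1 i ∈ hitFst g x ∩ hitSnd g ω.pop.1.1)) ∧
      countBelow n (fun i => ω.pop.2.1 i ∈ B ω.pop.1.1) ≤ K) :
    ∫⁻ n, ∫⁻ ω, (if H n ω then 1 else 0) ∂configLaw (ν.prod uniformUnit) ∂poissonMeasure r ≤
      ∫⁻ y, ENNReal.ofReal (min 1 (g x y + r * jointProb ν g x y) *
        (θ⁻¹ ^ K * Real.exp (-((1 - θ) * (r * (pairLaw ν).real (B y)))))) ∂ν := by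
  let G : ℕ → (Z × ℝ) × (ℕ → (Z × ℝ) × ℝ) → ℝ≥0∞ := fun n p =>
    if (p.1.2 < g x p.1.1 ∨ 0 < countBelow n (fun i => p.2 i ∈ hitFst g x ∩ hitSnd g p.1.1)) ∧
      countBelow n (fun i => p.2 i ∈ B p.1.1) ≤ K then 1 else 0
  have hG : ∀ n, Measurable (G n) := by
    intro n
    refine Measurable.ite (measurableSet_setOfPred.2 (Measurable.and (Measurable.or ?_ ?_) ?_))
      measurable_const measurable_const
    · refine measurableSet_setOfPred.1 (measurableSet_lt
        (f := fun p : (Z × ℝ) × (ℕ → (Z × ℝ) × ℝ) => p.1.2) (g := fun p => g x p.1.1)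
        (by fun_prop) ?_)
      exact hgm.comp (by fun_prop :
        Measurable fun p : (Z × ℝ) × (ℕ → (Z × ℝ) × ℝ) => (x, p.1.1))
    · refine measurableSet_setOfPred.1 ((measurable_countBelow fun i => ?_) measurableSet_Ioi)
      refine Measurable.and ?_ ?_
      · exact (measurable_mem_hitFst hgm).comp (by fun_prop :
          Measurable fun p : (Z × ℝ) × (ℕ → (Z × ℝ) × ℝ) => (x, p.2 i))
      · exact (measurable_mem_hitSnd hgm).comp (by fun_prop :
          Measurable fun p : (Z × ℝ) × (ℕ → (Z × ℝ) × ℝ) => (p.1.1, p.2 i))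
    · refine measurableSet_setOfPred.1 ((measurable_countBelow fun i => ?_) measurableSet_Iic)
      exact hB.comp (by fun_prop :
          Measurable fun p : (Z × ℝ) × (ℕ → (Z × ℝ) × ℝ) => (p.1.1, p.2 i))
  have hmp : MeasurePreserving (fun ω : Config (Z × ℝ) => (ω.pop.1, ω.pop.2.1))
      (configLaw (ν.prod uniformUnit))
      ((ν.prod uniformUnit).prod (Measure.infinitePi fun _ => pairLaw ν)) :=
    ((MeasurePreserving.id _).prod measurePreserving_fst).comp
      (measurePreserving_pop (ν.prod uniformUnit))
  have hG' : Measurable fun p : ((Z × ℝ) × (ℕ → (Z × ℝ) × ℝ)) × ℕ => G p.2 p.1 :=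
    measurable_from_prod_countable_left (f := fun p : ((Z × ℝ) × (ℕ → (Z × ℝ) × ℝ)) × ℕ =>
      G p.2 p.1) hG
  calc _ ≤ ∫⁻ n, ∫⁻ ω, G n (ω.pop.1, ω.pop.2.1) ∂configLaw (ν.prod uniformUnit)
          ∂poissonMeasure r := by
        refine lintegral_mono fun n => lintegral_mono fun ω => ?_
        simp only [G]
        by_cases h : H n ω
        · rw [if_pos h, if_pos (hH n ω h)]
        · rw [if_neg h]
          exact zero_le
    _ = ∫⁻ n, ∫⁻ p, ∫⁻ ζ, G n (p, ζ) ∂Measure.infinitePi (fun _ => pairLaw ν)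
          ∂(ν.prod uniformUnit) ∂poissonMeasure r := by
        refine lintegral_congr fun n => ?_
        rw [hmp.lintegral_comp (hG n), lintegral_prod _ (hG n).aemeasurable]
    -- Fubini moves the explored vertex outside the Poisson number, so that its position can be
    -- frozen.
    _ = ∫⁻ p, ∫⁻ n, ∫⁻ ζ, G n (p, ζ) ∂Measure.infinitePi (fun _ => pairLaw ν)
          ∂poissonMeasure r ∂(ν.prod uniformUnit) := by
        refine lintegral_lintegral_swap ?_
        refine Measurable.aemeasurable ?_
        refine measurable_from_prod_countable_right fun n => ?_
        exact (hG n).lintegral_prod_right'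
    _ = ∫⁻ y, ∫⁻ t, ∫⁻ n, ∫⁻ ζ, G n ((y, t), ζ) ∂Measure.infinitePi (fun _ => pairLaw ν)
          ∂poissonMeasure r ∂uniformUnit ∂ν := by
        refine lintegral_prod _ (Measurable.aemeasurable ?_)
        refine Measurable.lintegral_prod_right' (f := fun q : (Z × ℝ) × ℕ =>
          ∫⁻ ζ, G q.2 (q.1, ζ) ∂Measure.infinitePi (fun _ => pairLaw ν)) ?_
        refine measurable_from_prod_countable_left fun n => ?_
        exact (hG n).lintegral_prod_right'
    _ ≤ _ := by
        refine lintegral_mono fun y => ?_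
        have hBy : MeasurableSet (B y) :=
          measurableSet_setOfPred.2 (hB.comp measurable_prodMk_left)
        have := lintegral_edge_or_le (pairLaw ν) hBy
          ((measurableSet_hitFst hgm x).inter (measurableSet_hitSnd hgm y)) r K h0 h1
          (hg0 x y) (hg1 x y)
        rw [pairLaw_real_hitFst_inter_hitSnd ν hgm hg0 hg1] at this
        exact this

/-- Bound for pairs of vertices of bounded degree that are adjacent or have a common neighbour. -/
def pairBound (ν : Measure Z) (g : Z → Z → ℝ) (r : ℝ) (k : ℕ) (θ : ℝ) (x y : Z) : ℝ :=
  min 1 (g x y + r * jointProb ν g x y) * (θ⁻¹ ^ (2 * k) *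
    Real.exp (-((1 - θ) * (r * (joinProb ν g x + joinProb ν g y - jointProb ν g x y)))))

end Pair


/-! ### The four vertex counts and their symmetry -/

section Counts

open scoped NNReal ENNReal

variable {Z : Type} (g : Z → Z → ℝ) (k : ℕ) (x : Z) (n : ℕ)

/-- The number of vertices of degree `k`. -/
def degreeCount (ω : Config Z) : ℕ := countDegree (ω.adj g) (fun _ => True) k n

/-- The number of neighbours of the additional vertex `x`. -/
def joinedCount (ω : Config (Z × ℝ)) : ℕ := countBelow n (ω.joined g x)

/-- The number of vertices of degree `k` after removal of the neighbours of `x`. -/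
def remainingCount (ω : Config (Z × ℝ)) : ℕ :=
  countDegree (ω.forget.adj g) (fun j => ¬ ω.joined g x j) k n

/-- The number of vertices other than `x` of degree `k` in the graph with vertex `x`. -/
def augmentedCount (ω : Config (Z × ℝ)) : ℕ :=
  countDegreeJoined (ω.forget.adj g) (ω.joined g x) k n

/-- The number of exceptional vertices. -/
def exceptionalCount (ω : Config (Z × ℝ)) : ℕ :=
  countBelow n (Exceptional (ω.forget.adj g) (ω.joined g x) k n)

section Swap

variable {g k x n} {i : ℕ} (hi : i < n)
include hi

omit hi in
theorem adj_relabel_swap (ω : Config Z) : (ω.relabel (Equiv.swap 0 i)).adj g =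
    fun a b => ω.adj g (Equiv.swap 0 i a) (Equiv.swap 0 i b) := by
  ext a b
  exact Config.adj_relabel g (Equiv.swap 0 i).injective ω a b

theorem degreeCount_relabel_swap (ω : Config Z) :
    degreeCount g k n (ω.relabel (Equiv.swap 0 i)) = degreeCount g k n ω := by
  unfold degreeCount
  rw [adj_relabel_swap]
  exact countDegree_perm _ (swap_lt_iff hi) (ω.adj g) (fun _ => True) k

theorem joinedCount_relabel_swap (ω : Config (Z × ℝ)) :
    joinedCount g x n (ω.relabel (Equiv.swap 0 i)) = joinedCount g x n ω :=
  countBelow_perm _ (swap_lt_iff hi) (ω.joined g x)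

theorem remainingCount_relabel_swap (ω : Config (Z × ℝ)) :
    remainingCount g k x n (ω.relabel (Equiv.swap 0 i)) = remainingCount g k x n ω := by
  unfold remainingCount
  change countDegree ((ω.forget.relabel (Equiv.swap 0 i)).adj g) _ k n = _
  rw [adj_relabel_swap]
  exact countDegree_perm _ (swap_lt_iff hi) (ω.forget.adj g) (fun j => ¬ ω.joined g x j) k

theorem exceptional_relabel_swap (ω : Config (Z × ℝ)) :
    Exceptional ((ω.relabel (Equiv.swap 0 i)).forget.adj g)
      ((ω.relabel (Equiv.swap 0 i)).joined g x) k n 0 ↔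
    Exceptional (ω.forget.adj g) (ω.joined g x) k n i := by
  change Exceptional ((ω.forget.relabel (Equiv.swap 0 i)).adj g) _ k n 0 ↔ _
  rw [adj_relabel_swap]
  have := exceptional_perm _ (swap_lt_iff hi) (ω.forget.adj g) (ω.joined g x) k 0
  rw [Equiv.swap_apply_left] at this
  exact this

end Swap

variable [MeasurableSpace Z] {g} (hgm : Measurable fun p : Z × Z => g p.1 p.2)
include hgm

theorem measurable_degreeCount : Measurable (degreeCount g k n) :=
  measurable_countDegree (Config.measurable_adj hgm) (fun _ => measurable_const) k n

theorem measurable_joinedCount :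
    Measurable fun p : Z × Config (Z × ℝ) => joinedCount g p.1 n p.2 :=
  measurable_countBelow (Config.measurable_joined hgm)

theorem measurable_remainingCount :
    Measurable fun p : Z × Config (Z × ℝ) => remainingCount g k p.1 n p.2 :=
  measurable_countDegree (Config.measurable_adj_forget hgm)
    (fun i => (Config.measurable_joined hgm i).not) k n

theorem measurable_augmentedCount :
    Measurable fun p : Z × Config (Z × ℝ) => augmentedCount g k p.1 n p.2 :=
  measurable_countDegreeJoined (Config.measurable_adj_forget hgm)
    (Config.measurable_joined hgm) k n

theorem measurable_exceptional_joined (i : ℕ) : Measurable fun p : Z × Config (Z × ℝ) =>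
    Exceptional (p.2.forget.adj g) (p.2.joined g p.1) k n i :=
  measurable_exceptional (Config.measurable_adj_forget hgm)
    (Config.measurable_joined hgm) k n i

theorem measurable_exceptionalCount :
    Measurable fun p : Z × Config (Z × ℝ) => exceptionalCount g k p.1 n p.2 :=
  measurable_countBelow (measurable_exceptional_joined k n hgm)

end Counts

/-! ### Expected number of exceptional vertices -/

section ExceptionalBound

open scoped NNReal ENNReal

variable {Z : Type} [MeasurableSpace Z] (ν : Measure Z) [IsProbabilityMeasure ν]
  {g : Z → Z → ℝ} (hgm : Measurable fun p : Z × Z => g p.1 p.2) (hg0 : ∀ x y, 0 ≤ g x y)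
  (hg1 : ∀ x y, g x y ≤ 1) (k : ℕ) (r : ℝ≥0) {θ : ℝ} (h0 : 0 < θ) (h1 : θ ≤ 1) (x : Z)
include hgm hg0 hg1 h0 h1

/-- If `x` has `k` neighbours and `y` has at most `k` neighbours not joined to `x`, then at most `2
k` further vertices are joined to `x` or `y`. -/
theorem lintegral_exceptionalCount_mul_le :
    ∫⁻ n, ∫⁻ ω, (exceptionalCount g k x n ω : ℝ≥0∞) * (if joinedCount g x n ω = k then 1 else 0)
        ∂configLaw (ν.prod uniformUnit) ∂poissonMeasure r ≤
      r * ∫⁻ y, ENNReal.ofReal (pairBound ν g r k θ x y) ∂ν := by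
  classical
  have hm : ∀ n, Measurable fun ω : Config (Z × ℝ) =>
      if joinedCount g x n ω = k then (1 : ℝ≥0∞) else 0 := fun n =>
    Measurable.ite (((measurable_joinedCount n hgm).comp measurable_prodMk_left)
      (measurableSet_singleton k)) measurable_const measurable_const
  have hn : ∀ n, ∫⁻ ω, (exceptionalCount g k x n ω : ℝ≥0∞) *
        (if joinedCount g x n ω = k then 1 else 0) ∂configLaw (ν.prod uniformUnit) =
      n * ∫⁻ ω, (if Exceptional (ω.forget.adj g) (ω.joined g x) k n 0 then 1 else 0) *
        (if joinedCount g x n ω = k then 1 else 0) ∂configLaw (ν.prod uniformUnit) := by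
    intro n
    refine lintegral_countBelow_mul _ (fun i => (measurable_exceptional_joined k n hgm i).comp
      measurable_prodMk_left) (hm n) n (fun i hi ω => exceptional_relabel_swap hi ω) ?_
    intro i hi ω
    rw [joinedCount_relabel_swap hi]
  simp_rw [hn]
  rw [lintegral_nat_mul_poissonMeasure]
  gcongr
  have := lintegral_pop_le ν hgm hg0 hg1 r (2 * k) h0 h1 x
    (B := fun y => hitFst g x ∪ hitSnd g y)
    (H := fun n ω => Exceptional (ω.forget.adj g) (ω.joined g x) k (n + 1) 0 ∧
      joinedCount g x (n + 1) ω = k)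
    (((measurable_mem_hitFst hgm).comp (by fun_prop :
      Measurable fun p : Z × ((Z × ℝ) × ℝ) => (x, p.2))).or (measurable_mem_hitSnd hgm)) ?_
  · simp_rw [pairLaw_real_union ν hgm hg0 hg1] at this
    refine le_trans (le_of_eq ?_) this
    refine lintegral_congr fun n => lintegral_congr fun ω => ?_
    split_ifs <;> simp_all
  · rintro n ω ⟨hE, hk⟩
    obtain ⟨hE1, hE2⟩ := exceptional_pop hE
    refine ⟨hE1, ?_⟩
    have c1 : countBelow n (fun i => ω.pop.2.1 i ∈ hitFst g x) ≤ k := by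
      rw [← hk, joinedCount, countBelow_succ']
      exact Nat.le_add_left _ _
    have c2 := countBelow_le_add (n := n)
      (p := fun i => ω.pop.2.1 i ∈ hitFst g x ∪ hitSnd g ω.pop.1.1)
      (q := fun i => ω.pop.2.1 i ∈ hitFst g x)
      (t := fun i => ω.pop.2.1 i ∈ hitSnd g ω.pop.1.1 \ hitFst g x) (by
        intro i _ h
        by_cases h' : ω.pop.2.1 i ∈ hitFst g x
        · exact .inl h'
        · exact .inr ⟨h.resolve_left h', h'⟩)
    omega

/-- Here the degree of `x` is not constrained. The decay in `joinProb x` comes from the prefactor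
through `poissonMass_le`, and the same `pairBound` results. -/
theorem poissonMass_mul_lintegral_exceptionalCount_le :
    ENNReal.ofReal (poissonMass k (r * joinProb ν g x)) *
      ∫⁻ n, ∫⁻ ω, (exceptionalCount g k x n ω : ℝ≥0∞)
        ∂configLaw (ν.prod uniformUnit) ∂poissonMeasure r ≤
      r * ∫⁻ y, ENNReal.ofReal (pairBound ν g r k θ x y) ∂ν := by
  classical
  have hn : ∀ n, ∫⁻ ω, (exceptionalCount g k x n ω : ℝ≥0∞) ∂configLaw (ν.prod uniformUnit) =
      n * ∫⁻ ω, (if Exceptional (ω.forget.adj g) (ω.joined g x) k n 0 then 1 else 0)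
        ∂configLaw (ν.prod uniformUnit) := by
    intro n
    have := lintegral_countBelow_mul (ν.prod uniformUnit)
      (p := fun ω => Exceptional (ω.forget.adj g) (ω.joined g x) k n)
      (h := fun _ => 1) (fun i => (measurable_exceptional_joined k n hgm i).comp
      measurable_prodMk_left) measurable_const n (fun i hi ω => exceptional_relabel_swap hi ω)
      (fun _ _ _ => rfl)
    simpa [exceptionalCount] using this
  simp_rw [hn]
  rw [lintegral_nat_mul_poissonMeasure, mul_left_comm]
  gcongr
  have hm0 : 0 ≤ (r : ℝ) * joinProb ν g x := mul_nonneg r.2 (joinProb_nonneg hg0 x)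
  have := lintegral_pop_le ν hgm hg0 hg1 r k h0 h1 x
    (B := fun y => hitSnd g y \ hitFst g x)
    (H := fun n ω => Exceptional (ω.forget.adj g) (ω.joined g x) k (n + 1) 0)
    ((measurable_mem_hitSnd hgm).and ((measurable_mem_hitFst hgm).comp (by fun_prop :
      Measurable fun p : Z × ((Z × ℝ) × ℝ) => (x, p.2))).not) (fun n ω hE => exceptional_pop hE)
  simp_rw [pairLaw_real_diff ν hgm hg0 hg1] at this
  refine (mul_le_mul' le_rfl this).trans ?_
  rw [← lintegral_const_mul' _ _ ENNReal.ofReal_ne_top]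
  refine lintegral_mono fun y => ?_
  simp only
  rw [← ENNReal.ofReal_mul (poissonMass_nonneg k hm0)]
  refine ENNReal.ofReal_le_ofReal ?_
  have hmin : 0 ≤ min 1 (g x y + r * jointProb ν g x y) :=
    le_min zero_le_one (add_nonneg (hg0 x y) (mul_nonneg r.2 (jointProb_nonneg hg0 x y)))
  calc _ ≤ (θ⁻¹ ^ k * Real.exp (-((1 - θ) * (r * joinProb ν g x)))) *
        (min 1 (g x y + r * jointProb ν g x y) * (θ⁻¹ ^ k *
          Real.exp (-((1 - θ) * (r * (joinProb ν g y - jointProb ν g x y)))))) := by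
        gcongr
        exact poissonMass_le k hm0 h0
    _ = min 1 (g x y + r * jointProb ν g x y) * (θ⁻¹ ^ k * θ⁻¹ ^ k *
          (Real.exp (-((1 - θ) * (r * joinProb ν g x))) *
            Real.exp (-((1 - θ) * (r * (joinProb ν g y - jointProb ν g x y)))))) := by ring
    _ = pairBound ν g r k θ x y := by
        rw [pairBound, ← Real.exp_add, ← pow_add, two_mul]
        congr 3
        ring_nf

end ExceptionalBound


/-! ### Independence of the neighbours and the non-neighbours of a point -/

section Thinning

theorem _root_.MeasureTheory.MeasurePreserving.integral_comp_of_measurable {α β : Type*}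
    [MeasurableSpace α] [MeasurableSpace β] {μ : Measure α} {ν : Measure β} {φ : α → β}
    (h : MeasurePreserving φ μ ν) {F : β → ℝ} (hF : Measurable F) :
    ∫ a, F (φ a) ∂μ = ∫ b, F b ∂ν := by
  rw [← h.map_eq, integral_map h.measurable.aemeasurable hF.aestronglyMeasurable]

open scoped NNReal ENNReal Nat

variable {Z : Type}

theorem joinedCount_pop {g : Z → Z → ℝ} {x : Z} {n : ℕ} {ω : Config (Z × ℝ)}
    (h : ω.pop.1.2 < g x ω.pop.1.1) :
    joinedCount g x (n + 1) ω = joinedCount g x n ω.pop.2.forget + 1 := by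
  classical
  unfold joinedCount
  rw [countBelow_succ', if_pos (show ω.joined g x 0 from h), add_comm]
  rfl

/-- A vertex joined to `x` is deleted anyway, so removing it from the configuration does not affect
the remaining graph. -/
theorem remainingCount_pop {g : Z → Z → ℝ} {k : ℕ} {x : Z} {n : ℕ} {ω : Config (Z × ℝ)}
    (h : ω.pop.1.2 < g x ω.pop.1.1) :
    remainingCount g k x (n + 1) ω = remainingCount g k x n ω.pop.2.forget := by
  classical
  have h0 : ω.joined g x 0 := h
  have hdeg : ∀ i, degreeOn (ω.forget.adj g) (fun j => ¬ ω.joined g x j) (n + 1) (i + 1) =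
      degreeOn (ω.pop.2.forget.forget.adj g) (fun j => ¬ ω.pop.2.forget.joined g x j) n i := by
    intro i
    unfold degreeOn
    rw [countBelow_succ', if_neg (by simp [h0]), zero_add]
    refine countBelow_congr fun j _ => ?_
    rw [Config.adj_succ_succ]
    rfl
  unfold remainingCount countDegree
  rw [countBelow_succ', if_neg (by simp [h0]), zero_add]
  refine countBelow_congr fun i _ => ?_
  rw [hdeg]
  rfl

variable [MeasurableSpace Z] (ν : Measure Z) [IsProbabilityMeasure ν]
  {g : Z → Z → ℝ} (hgm : Measurable fun p : Z × Z => g p.1 p.2) (hg0 : ∀ x y, 0 ≤ g x y)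
  (hg1 : ∀ x y, g x y ≤ 1) (k : ℕ) (r : ℝ≥0) (x : Z) {h : ℕ → ℝ} {C : ℝ} (hC : ∀ i, |h i| ≤ C)
include hgm

theorem measurable_ite_joinedCount (j n : ℕ) : Measurable fun p : Z × Config (Z × ℝ) =>
    if joinedCount g p.1 n p.2 = j then (1 : ℝ) else 0 :=
  Measurable.ite ((measurable_joinedCount n hgm) (measurableSet_singleton j))
    measurable_const measurable_const

include hC

omit [MeasurableSpace Z] hgm in
theorem abs_ite_mul_le (p : Prop) [Decidable p] (i : ℕ) : |(if p then (1 : ℝ) else 0) * h i| ≤ C := by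
  have h1 := hC i
  have h2 := abs_nonneg (h i)
  split_ifs
  · simpa using h1
  · simp; linarith

include hg0 hg1

/-- On the event, `j + 1` is the number of joined vertices. Exchangeability selects vertex 0 among
them; removing it lowers the joined count by one, keeps the remaining count, and costs the factor
`joinProb`. -/
theorem thinning_recursion (j n : ℕ) :
    (j + 1 : ℝ) * ∫ ω, (if joinedCount g x (n + 1) ω = j + 1 then (1 : ℝ) else 0) *
        h (remainingCount g k x (n + 1) ω) ∂configLaw (ν.prod uniformUnit) =
      (n + 1 : ℕ) * (joinProb ν g x * ∫ ω, (if joinedCount g x n ω = j then (1 : ℝ) else 0) *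
        h (remainingCount g k x n ω) ∂configLaw (ν.prod uniformUnit)) := by
  classical
  have hF : ∀ j n, Measurable fun ω : Config (Z × ℝ) =>
      (if joinedCount g x n ω = j then (1 : ℝ) else 0) * h (remainingCount g k x n ω) :=
    fun j n => ((measurable_ite_joinedCount hgm j n).comp measurable_prodMk_left).mul
      ((measurable_of_countable h).comp
        ((measurable_remainingCount k n hgm).comp measurable_prodMk_left))
  have h1 := integral_countBelow_mul (ν.prod uniformUnit)
    (p := fun ω => ω.joined g x)
    (h := fun ω => (if joinedCount g x (n + 1) ω = j + 1 then (1 : ℝ) else 0) *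
      h (remainingCount g k x (n + 1) ω))
    (fun i => (Config.measurable_joined hgm i).comp measurable_prodMk_left) (hF _ _)
    (fun ω => abs_ite_mul_le hC _ _) (n + 1)
    (fun i _ ω => by simp [Config.joined_relabel])
    (fun i hi ω => by
      rw [joinedCount_relabel_swap hi, remainingCount_relabel_swap hi])
  rw [← integral_const_mul]
  have h2 : ∀ ω : Config (Z × ℝ),
      (j + 1 : ℝ) * ((if joinedCount g x (n + 1) ω = j + 1 then (1 : ℝ) else 0) *
        h (remainingCount g k x (n + 1) ω)) =
      (countBelow (n + 1) (ω.joined g x) : ℝ) *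
        ((if joinedCount g x (n + 1) ω = j + 1 then (1 : ℝ) else 0) *
        h (remainingCount g k x (n + 1) ω)) := by
    intro ω
    split_ifs with hj
    · rw [joinedCount] at hj
      rw [hj]
      push_cast
      ring
    · simp
  simp_rw [h2]
  rw [h1]
  congr 1
  have hmp : MeasurePreserving (fun ω : Config (Z × ℝ) => (ω.pop.1, ω.pop.2.forget))
      (configLaw (ν.prod uniformUnit))
      ((ν.prod uniformUnit).prod (configLaw (ν.prod uniformUnit))) :=
    ((MeasurePreserving.id _).prod (measurePreserving_forget _ _)).comp
      (measurePreserving_pop (ν.prod uniformUnit))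
  have hA : MeasurableSet {p : Z × ℝ | p.2 < g x p.1} := by
    refine measurableSet_lt (by fun_prop) ?_
    exact hgm.comp (by fun_prop : Measurable fun p : Z × ℝ => (x, p.1))
  have hprob : ∫ p : Z × ℝ, (if p.2 < g x p.1 then (1 : ℝ) else 0) ∂ν.prod uniformUnit =
      joinProb ν g x := by
    rw [← pairLaw_real_hitFst ν hgm hg0 hg1 x]
    have e : hitFst g x = {p : Z × ℝ | p.2 < g x p.1} ×ˢ (Set.univ : Set ℝ) := by
      ext ζ; simp [hitFst]
    rw [pairLaw, e, measureReal_prod_prod, probReal_univ, mul_one, ← integral_indicator_one hA]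
    refine integral_congr_ae (ae_of_all _ fun p => ?_)
    simp [Set.indicator_apply]
  have hm1 : Measurable fun p : Z × ℝ => if p.2 < g x p.1 then (1 : ℝ) else 0 :=
    Measurable.ite hA measurable_const measurable_const
  rw [← hprob, ← integral_prod_mul, ← hmp.integral_comp_of_measurable
    (F := fun p => (if p.1.2 < g x p.1.1 then (1 : ℝ) else 0) *
      ((if joinedCount g x n p.2 = j then (1 : ℝ) else 0) * h (remainingCount g k x n p.2)))
    ((hm1.comp measurable_fst).mul ((hF j n).comp measurable_snd))]
  refine integral_congr_ae (ae_of_all _ fun ω => ?_)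
  simp only
  by_cases h3 : ω.pop.1.2 < g x ω.pop.1.1
  · rw [if_pos h3, if_pos (show ω.joined g x 0 from h3), joinedCount_pop h3,
      remainingCount_pop h3]
    simp
  · rw [if_neg h3, if_neg (show ¬ ω.joined g x 0 from h3)]
    simp

/-- With `S j = E[1{J = j} h(R)]`, where `J` is the joined count and `R` the remaining count, the
recursion reads `(j + 1) S (j + 1) = m S j`, whence `S j = m ^ j / j! * S 0`. Summing over `j`
identifies `S 0 = exp (-m) E[h(R)]`, so no splitting of Poisson processes has to be constructed. -/
theorem integral_joinedCount_mul :
    ∫ p, (if joinedCount g x p.1 p.2 = k then (1 : ℝ) else 0) * h (remainingCount g k x p.1 p.2)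
        ∂poissonConfig r (configLaw (ν.prod uniformUnit)) =
      poissonMass k (r * joinProb ν g x) *
        ∫ p, h (remainingCount g k x p.1 p.2)
          ∂poissonConfig r (configLaw (ν.prod uniformUnit)) := by
  set P := configLaw (ν.prod uniformUnit) with hP
  set m := r * joinProb ν g x with hm
  have hcm : Measurable fun p : ℕ × Config (Z × ℝ) => joinedCount g x p.1 p.2 :=
    measurable_uncurry_nat fun n => (measurable_joinedCount n hgm).comp measurable_prodMk_left
  have hhm : Measurable fun p : ℕ × Config (Z × ℝ) => h (remainingCount g k x p.1 p.2) :=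
    (measurable_of_countable h).comp (measurable_uncurry_nat fun n =>
      (measurable_remainingCount k n hgm).comp measurable_prodMk_left)
  have hFm : ∀ j, Measurable fun p : ℕ × Config (Z × ℝ) =>
      (if joinedCount g x p.1 p.2 = j then (1 : ℝ) else 0) * h (remainingCount g k x p.1 p.2) :=
    fun j => (Measurable.ite (hcm (measurableSet_singleton j)) measurable_const
      measurable_const).mul hhm
  have hFi : ∀ j, Integrable (fun p : ℕ × Config (Z × ℝ) =>
      (if joinedCount g x p.1 p.2 = j then (1 : ℝ) else 0) * h (remainingCount g k x p.1 p.2))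
      (poissonConfig r P) := fun j =>
    .of_bound (hFm j).aestronglyMeasurable C (ae_of_all _ fun p => abs_ite_mul_le hC _ _)
  have hhi : Integrable (fun p : ℕ × Config (Z × ℝ) => h (remainingCount g k x p.1 p.2))
      (poissonConfig r P) :=
    .of_bound hhm.aestronglyMeasurable C (ae_of_all _ fun p => hC _)
  set S : ℕ → ℝ := fun j => ∫ p, (if joinedCount g x p.1 p.2 = j then (1 : ℝ) else 0) *
    h (remainingCount g k x p.1 p.2) ∂poissonConfig r P with hS
  have hSn : ∀ j, S j = ∫ n, ∫ ω, (if joinedCount g x n ω = j then (1 : ℝ) else 0) *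
      h (remainingCount g k x n ω) ∂P ∂poissonMeasure r := fun j => integral_prod _ (hFi j)
  have hrec : ∀ j : ℕ, (j + 1 : ℝ) * S (j + 1) = m * S j := by
    intro j
    rw [hSn, hSn, ← integral_const_mul]
    -- The truncated `n - 1` is harmless at `n = 0`: no vertex is joined on the left and the factor
    -- `n` vanishes on the right.
    have : ∀ n : ℕ, (j + 1 : ℝ) * ∫ ω, (if joinedCount g x n ω = j + 1 then (1 : ℝ) else 0) *
        h (remainingCount g k x n ω) ∂P = n * (joinProb ν g x *
          ∫ ω, (if joinedCount g x (n - 1) ω = j then (1 : ℝ) else 0) *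
            h (remainingCount g k x (n - 1) ω) ∂P) := by
      intro n
      cases n with
      | zero => simp [joinedCount, countBelow_zero]
      | succ n => exact thinning_recursion ν hgm hg0 hg1 k x hC j n
    simp_rw [this]
    rw [integral_nat_mul_poissonMeasure]
    simp only [Nat.add_sub_cancel]
    rw [integral_const_mul, hm, mul_assoc]
  have hclosed : ∀ j : ℕ, S j = m ^ j / j ! * S 0 := by
    intro j
    induction j with
    | zero => simp
    | succ j ih =>
      have h1 : (j + 1 : ℝ) ≠ 0 := by positivity
      have h2 : (j ! : ℝ) ≠ 0 := by positivity
      have h3 := hrec j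
      rw [ih] at h3
      have : S (j + 1) = m * (m ^ j / j ! * S 0) / (j + 1) := by
        rw [← h3]; field_simp
      rw [this, Nat.factorial_succ]
      push_cast
      field_simp
      try ring
  have hsum1 : HasSum S (Real.exp m * S 0) := by
    have := (NormedSpace.expSeries_div_hasSum_exp m).mul_right (S 0)
    rw [← Real.exp_eq_exp_ℝ] at this
    exact this.congr_fun hclosed
  have hsum2 : HasSum S (∫ p, h (remainingCount g k x p.1 p.2) ∂poissonConfig r P) := by
    have := hasSum_integral_iUnion (μ := poissonConfig r P)
      (f := fun p : ℕ × Config (Z × ℝ) => h (remainingCount g k x p.1 p.2))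
      (s := fun j => {p : ℕ × Config (Z × ℝ) | joinedCount g x p.1 p.2 = j})
      (fun j => hcm (measurableSet_singleton j))
      (fun i j hij => Set.disjoint_left.2 fun p hp hp' => hij (hp.symm.trans hp')) hhi.integrableOn
    have hU : ⋃ j, {p : ℕ × Config (Z × ℝ) | joinedCount g x p.1 p.2 = j} = Set.univ :=
      Set.iUnion_eq_univ_iff.2 fun p => ⟨joinedCount g x p.1 p.2, rfl⟩
    rw [hU, Measure.restrict_univ] at this
    refine this.congr_fun fun j => ?_
    rw [← integral_indicator (show MeasurableSet {p : ℕ × Config (Z × ℝ) |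
      joinedCount g x p.1 p.2 = j} from hcm (measurableSet_singleton j))]
    refine integral_congr_ae (ae_of_all _ fun p => ?_)
    simp [Set.indicator_apply]
  have hval := hsum1.unique hsum2
  change S k = _
  rw [hclosed, ← hval, poissonMass]
  have : Real.exp (-m) * Real.exp m = 1 := by rw [← Real.exp_add]; simp
  linear_combination (-(m ^ k / k ! * S 0)) * this

end Thinning

/-! ### The Mecke formula for the number of vertices of degree `k` -/

section Mecke

open scoped NNReal ENNReal

variable {Z : Type} [MeasurableSpace Z] (ν : Measure Z) [IsProbabilityMeasure ν]
  {g : Z → Z → ℝ} (hgm : Measurable fun p : Z × Z => g p.1 p.2)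
  (hgs : ∀ x y, g x y = g y x) (k : ℕ) (r : ℝ≥0) {f : ℕ → ℝ} {C : ℝ} (hC : ∀ i, |f i| ≤ C)
include hgm hgs hC

/-- Exchangeability singles out vertex 0, and `pop` presents it as a point added to the other `n`
vertices. -/
theorem integral_degreeCount_mul_succ (n : ℕ) :
    ∫ ω, (degreeCount g k (n + 1) ω : ℝ) * f (degreeCount g k (n + 1) ω) ∂configLaw ν =
      (n + 1 : ℕ) * ∫ p, (if joinedCount g p.1 n p.2 = k then (1 : ℝ) else 0) *
        f (augmentedCount g k p.1 n p.2 + 1) ∂ν.prod (configLaw (ν.prod uniformUnit)) := by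
  classical
  have hdeg : ∀ i, Measurable fun ω : Config Z => degreeOn (ω.adj g) (fun _ => True) (n + 1) i :=
    measurable_degreeOn (Config.measurable_adj hgm) (fun _ => measurable_const) (n + 1)
  have h1 := integral_countBelow_mul ν
    (p := fun ω i => True ∧ degreeOn (ω.adj g) (fun _ => True) (n + 1) i = k)
    (h := fun ω => f (degreeCount g k (n + 1) ω))
    (fun i => measurable_const.and
      (measurableSet_setOfPred.1 (hdeg i (measurableSet_singleton k))))
    ((measurable_of_countable f).comp (measurable_degreeCount k (n + 1) hgm))
    (fun ω => hC _) (n + 1)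
    (fun i hi ω => by
      rw [adj_relabel_swap]
      have := degreeOn_perm _ (swap_lt_iff hi) (ω.adj g) (fun _ => True) 0
      rw [Equiv.swap_apply_left] at this
      simp only [this])
    (fun i hi ω => by
      rw [degreeCount_relabel_swap hi])
  refine h1.trans ?_
  congr 1
  have hmp := measurePreserving_pop ν
  rw [← hmp.map_eq, integral_map hmp.measurable.aemeasurable]
  · refine integral_congr_ae (ae_of_all _ fun ω => ?_)
    simp only [true_and]
    have h2 := degreeOn_zero_pop g ω n
    by_cases h3 : degreeOn (ω.adj g) (fun _ => True) (n + 1) 0 = k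
    · rw [if_pos h3, if_pos (by rw [joinedCount, ← h2, h3]), degreeCount,
        countDegree_pop hgs ω k n h3]
      rfl
    · rw [if_neg h3, if_neg (by rw [joinedCount, ← h2]; exact h3)]
      simp
  · exact ((measurable_ite_joinedCount hgm k n).mul ((measurable_of_countable fun i => f (i + 1)).comp
      (measurable_augmentedCount k n hgm))).aestronglyMeasurable

theorem integral_degreeCount_mul :
    ∫ p, (degreeCount g k p.1 p.2 : ℝ) * f (degreeCount g k p.1 p.2)
        ∂poissonConfig r (configLaw ν) =
      r * ∫ x, ∫ p, (if joinedCount g x p.1 p.2 = k then (1 : ℝ) else 0) *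
        f (augmentedCount g k x p.1 p.2 + 1)
          ∂poissonConfig r (configLaw (ν.prod uniformUnit)) ∂ν := by
  set P := configLaw (ν.prod uniformUnit) with hP
  have hDm : Measurable fun p : ℕ × Config Z => degreeCount g k p.1 p.2 :=
    measurable_uncurry_nat fun n => measurable_degreeCount k n hgm
  have hi : Integrable (fun p : ℕ × Config Z =>
      (degreeCount g k p.1 p.2 : ℝ) * f (degreeCount g k p.1 p.2))
      (poissonConfig r (configLaw ν)) := by
    have hN : Integrable (fun p : ℕ × Config Z => (p.1 : ℝ) * C) (poissonConfig r (configLaw ν)) :=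
      ((integrable_natCast_poissonMeasure r).comp_fst _).mul_const C
    refine hN.mono' ((measurable_of_countable fun i : ℕ => (i : ℝ) * f i).comp
      hDm).aestronglyMeasurable (ae_of_all _ fun p => ?_)
    rw [Real.norm_eq_abs, abs_mul, Nat.abs_cast]
    have : (degreeCount g k p.1 p.2 : ℝ) ≤ p.1 := by exact_mod_cast countBelow_le _ _
    gcongr
    exact hC _
  have hGm : ∀ n, Measurable fun p : Z × Config (Z × ℝ) =>
      (if joinedCount g p.1 n p.2 = k then (1 : ℝ) else 0) * f (augmentedCount g k p.1 n p.2 + 1) :=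
    fun n => (measurable_ite_joinedCount hgm k n).mul
      ((measurable_of_countable fun i => f (i + 1)).comp (measurable_augmentedCount k n hgm))
  have hC' : ∀ i, |f (i + 1)| ≤ C := fun i => hC _
  have hGi : ∀ n, Integrable (fun p : Z × Config (Z × ℝ) =>
      (if joinedCount g p.1 n p.2 = k then (1 : ℝ) else 0) * f (augmentedCount g k p.1 n p.2 + 1))
      (ν.prod P) := fun n =>
    .of_bound (hGm n).aestronglyMeasurable C
      (ae_of_all _ fun p => abs_ite_mul_le (h := fun i => f (i + 1)) hC' _ _)
  have hGxm : ∀ x, Measurable fun p : ℕ × Config (Z × ℝ) =>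
      (if joinedCount g x p.1 p.2 = k then (1 : ℝ) else 0) * f (augmentedCount g k x p.1 p.2 + 1) :=
    fun x => measurable_uncurry_nat (F := fun n ω => (if joinedCount g x n ω = k then (1 : ℝ) else 0)
      * f (augmentedCount g k x n ω + 1)) fun n => (hGm n).comp measurable_prodMk_left
  have hGxi : ∀ x, Integrable (fun p : ℕ × Config (Z × ℝ) =>
      (if joinedCount g x p.1 p.2 = k then (1 : ℝ) else 0) * f (augmentedCount g k x p.1 p.2 + 1))
      ((poissonMeasure r).prod P) := fun x =>
    .of_bound (hGxm x).aestronglyMeasurable C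
      (ae_of_all _ fun p => abs_ite_mul_le (h := fun i => f (i + 1)) hC' _ _)
  have e1 : ∫ p, (degreeCount g k p.1 p.2 : ℝ) * f (degreeCount g k p.1 p.2)
      ∂poissonConfig r (configLaw ν) = ∫ n, ∫ ω, (degreeCount g k n ω : ℝ) *
        f (degreeCount g k n ω) ∂configLaw ν ∂poissonMeasure r := integral_prod _ hi
  have e2 : ∀ n : ℕ, ∫ ω, (degreeCount g k n ω : ℝ) * f (degreeCount g k n ω) ∂configLaw ν =
      n * ∫ p, (if joinedCount g p.1 (n - 1) p.2 = k then (1 : ℝ) else 0) *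
        f (augmentedCount g k p.1 (n - 1) p.2 + 1) ∂ν.prod P := by
    intro n
    cases n with
    | zero => simp [degreeCount, countDegree, countBelow_zero]
    | succ n => exact integral_degreeCount_mul_succ ν hgm hgs k hC n
  have e3 : ∀ n, ∫ p, (if joinedCount g p.1 n p.2 = k then (1 : ℝ) else 0) *
        f (augmentedCount g k p.1 n p.2 + 1) ∂ν.prod P =
      ∫ x, ∫ ω, (if joinedCount g x n ω = k then (1 : ℝ) else 0) *
        f (augmentedCount g k x n ω + 1) ∂P ∂ν := fun n => integral_prod _ (hGi n)
  rw [e1]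
  simp_rw [e2]
  rw [integral_nat_mul_poissonMeasure]
  congr 1
  simp only [Nat.add_sub_cancel]
  simp_rw [e3]
  have e4 : ∀ x, ∫ p, (if joinedCount g x p.1 p.2 = k then (1 : ℝ) else 0) *
        f (augmentedCount g k x p.1 p.2 + 1) ∂poissonConfig r P =
      ∫ n, ∫ ω, (if joinedCount g x n ω = k then (1 : ℝ) else 0) *
        f (augmentedCount g k x n ω + 1) ∂P ∂poissonMeasure r := fun x => integral_prod _ (hGxi x)
  simp_rw [e4]
  refine integral_integral_swap ?_
  refine Integrable.of_bound (C := C) (Measurable.aestronglyMeasurable ?_) (ae_of_all _ fun q => ?_)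
  · refine measurable_from_prod_countable_right fun n => ?_
    exact (hGm n).stronglyMeasurable.integral_prod_right'.measurable
  · refine (norm_integral_le_of_norm_le_const (μ := P) (ae_of_all _ fun ω =>
      abs_ite_mul_le (h := fun i => f (i + 1)) hC' _ _)).trans ?_
    simp

end Mecke


/-! ### Stein's bound by coupling through the remaining graph -/

section SteinBound

open scoped NNReal ENNReal

theorem enorm_integral_sub_le_of_count {Ω : Type} [MeasurableSpace Ω] (P : Measure Ω)
    [IsProbabilityMeasure P] {F G : Ω → ℝ} {E : Ω → ℝ≥0∞} (hF : Integrable F P)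
    (hG : Integrable G P) {c : ℝ≥0∞} (hc : c ≠ ∞) (h : ∀ ω, ‖F ω - G ω‖ₑ ≤ c * E ω) :
    ‖∫ ω, F ω ∂P - ∫ ω, G ω ∂P‖ₑ ≤ c * ∫⁻ ω, E ω ∂P := by
  rw [← integral_sub hF hG, ← lintegral_const_mul' _ _ hc]
  exact (enorm_integral_le_lintegral_enorm _).trans (lintegral_mono h)

variable {Z : Type} [MeasurableSpace Z] (ν : Measure Z) [IsProbabilityMeasure ν]
  {g : Z → Z → ℝ} (hgm : Measurable fun p : Z × Z => g p.1 p.2)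
  (hgs : ∀ x y, g x y = g y x) (hg0 : ∀ x y, 0 ≤ g x y) (hg1 : ∀ x y, g x y ≤ 1)
  (k : ℕ) (r : ℝ≥0) {f : ℕ → ℝ} {C : ℝ} (hC0 : 0 ≤ C) (hC : ∀ i, |f i| ≤ C)
  {θ : ℝ} (h0 : 0 < θ) (h1 : θ ≤ 1)
include hgm hg0 hg1 hC0 hC h0 h1

/-- The remaining graph is the intermediary: `Φ - m D = (Φ - m R) - m (D - R)`, where thinning
identifies `m R` with the expectation in which the augmented count is replaced by the remaining
count. Each difference costs `2 C` per exceptional vertex. -/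
theorem enorm_augmented_sub_le (x : Z) :
    ‖∫ p, (if joinedCount g x p.1 p.2 = k then (1 : ℝ) else 0) *
        f (augmentedCount g k x p.1 p.2 + 1) ∂poissonConfig r (configLaw (ν.prod uniformUnit)) -
      poissonMass k (r * joinProb ν g x) *
        ∫ p, f (degreeCount g k p.1 p.2 + 1) ∂poissonConfig r (configLaw ν)‖ₑ ≤
      ENNReal.ofReal (4 * C) * (r * ∫⁻ y, ENNReal.ofReal (pairBound ν g r k θ x y) ∂ν) := by
  set P := configLaw (ν.prod uniformUnit) with hP
  set h : ℕ → ℝ := fun i => f (i + 1) with hh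
  have hCh : ∀ i, |h i| ≤ C := fun i => hC _
  have hm0 : 0 ≤ (r : ℝ) * joinProb ν g x := mul_nonneg r.2 (joinProb_nonneg hg0 x)
  have meas : ∀ {c : Z → ℕ → Config (Z × ℝ) → ℕ},
      (∀ n, Measurable fun p : Z × Config (Z × ℝ) => c p.1 n p.2) →
      Measurable fun p : ℕ × Config (Z × ℝ) => c x p.1 p.2 := fun hc =>
    measurable_uncurry_nat fun n => (hc n).comp measurable_prodMk_left
  have mJ := meas fun n => measurable_joinedCount n hgm
  have mR := meas fun n => measurable_remainingCount k n hgm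
  have mA := meas fun n => measurable_augmentedCount k n hgm
  have mE := meas fun n => measurable_exceptionalCount k n hgm
  have mD : Measurable fun p : ℕ × Config (Z × ℝ) => degreeCount g k p.1 p.2.forget :=
    measurable_uncurry_nat (F := fun n (ω : Config (Z × ℝ)) => degreeCount g k n ω.forget)
      fun n => (measurable_degreeCount k n hgm).comp Config.measurable_forget
  have mI : Measurable fun p : ℕ × Config (Z × ℝ) =>
      if joinedCount g x p.1 p.2 = k then (1 : ℝ) else 0 :=
    Measurable.ite (mJ (measurableSet_singleton k)) measurable_const measurable_const
  have ih : ∀ {c : ℕ × Config (Z × ℝ) → ℕ}, Measurable c →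
      Integrable (fun p => h (c p)) (poissonConfig r P) := fun hc =>
    .of_bound ((measurable_of_countable h).comp hc).aestronglyMeasurable C
      (ae_of_all _ fun p => hCh _)
  have iI : ∀ {c : ℕ × Config (Z × ℝ) → ℕ}, Measurable c →
      Integrable (fun p => (if joinedCount g x p.1 p.2 = k then (1 : ℝ) else 0) * h (c p))
        (poissonConfig r P) := fun hc =>
    .of_bound (mI.mul ((measurable_of_countable h).comp hc)).aestronglyMeasurable C
      (ae_of_all _ fun p => abs_ite_mul_le hCh _ _)
  have cast : ∀ {a : ℝ} {m : ℕ}, |a| ≤ 2 * C * m → ‖a‖ₑ ≤ ENNReal.ofReal (2 * C) * (m : ℝ≥0∞) := by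
    intro a m ham
    rw [← ofReal_norm, ← ENNReal.ofReal_natCast, ← ENNReal.ofReal_mul (by positivity)]
    exact ENNReal.ofReal_le_ofReal ham
  have b1 : ‖∫ p, (if joinedCount g x p.1 p.2 = k then (1 : ℝ) else 0) *
        h (augmentedCount g k x p.1 p.2) ∂poissonConfig r P -
      ∫ p, (if joinedCount g x p.1 p.2 = k then (1 : ℝ) else 0) *
        h (remainingCount g k x p.1 p.2) ∂poissonConfig r P‖ₑ ≤
      ENNReal.ofReal (2 * C) * (r * ∫⁻ y, ENNReal.ofReal (pairBound ν g r k θ x y) ∂ν) := by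
    refine (enorm_integral_sub_le_of_count _ (iI mA) (iI mR) (c := ENNReal.ofReal (2 * C))
      (E := fun p => (exceptionalCount g k x p.1 p.2 : ℝ≥0∞) *
        (if joinedCount g x p.1 p.2 = k then 1 else 0)) ENNReal.ofReal_ne_top ?_).trans ?_
    · intro p
      rw [← mul_sub]
      split_ifs
      · rw [one_mul, mul_one]
        exact cast (abs_sub_countDegreeJoined_le hC0 hCh _ _ k p.1)
      · simp
    · refine mul_le_mul' le_rfl ?_
      refine le_trans (le_of_eq ?_) (lintegral_exceptionalCount_mul_le ν hgm hg0 hg1 k r h0 h1 x)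
      refine lintegral_poissonConfig r P (F := fun n ω => (exceptionalCount g k x n ω : ℝ≥0∞) *
        (if joinedCount g x n ω = k then 1 else 0)) fun n => ?_
      exact ((measurable_of_countable _).comp ((measurable_exceptionalCount k n hgm).comp
        measurable_prodMk_left)).mul (Measurable.ite (((measurable_joinedCount n hgm).comp
          measurable_prodMk_left) (measurableSet_singleton k)) measurable_const measurable_const)
  have b2 : ‖∫ p, h (degreeCount g k p.1 p.2.forget) ∂poissonConfig r P -
      ∫ p, h (remainingCount g k x p.1 p.2) ∂poissonConfig r P‖ₑ ≤
      ENNReal.ofReal (2 * C) * ∫⁻ n, ∫⁻ ω, (exceptionalCount g k x n ω : ℝ≥0∞) ∂P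
        ∂poissonMeasure r := by
    refine (enorm_integral_sub_le_of_count _ (ih mD) (ih mR) (c := ENNReal.ofReal (2 * C))
      (E := fun p => (exceptionalCount g k x p.1 p.2 : ℝ≥0∞)) ENNReal.ofReal_ne_top
      fun p => cast (abs_sub_countDegree_le hC0 hCh _ _ k p.1)).trans ?_
    refine mul_le_mul' le_rfl (le_of_eq ?_)
    exact lintegral_poissonConfig r P (F := fun n ω => (exceptionalCount g k x n ω : ℝ≥0∞))
      fun n => (measurable_of_countable _).comp ((measurable_exceptionalCount k n hgm).comp
        measurable_prodMk_left)
  have b3 := poissonMass_mul_lintegral_exceptionalCount_le ν hgm hg0 hg1 k r h0 h1 x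
  have hforget : ∫ p, h (degreeCount g k p.1 p.2) ∂poissonConfig r (configLaw ν) =
      ∫ p, h (degreeCount g k p.1 p.2.forget) ∂poissonConfig r P := by
    have hmp : MeasurePreserving (fun p : ℕ × Config (Z × ℝ) => (p.1, p.2.forget))
        (poissonConfig r P) (poissonConfig r (configLaw ν)) :=
      (MeasurePreserving.id _).prod (measurePreserving_forget ν uniformUnit)
    exact (hmp.integral_comp_of_measurable (F := fun p => h (degreeCount g k p.1 p.2))
      ((measurable_of_countable h).comp
        (measurable_uncurry_nat fun n => measurable_degreeCount k n hgm))).symm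
  have hthin := integral_joinedCount_mul ν hgm hg0 hg1 k r x hCh
  set Φ := ∫ p, (if joinedCount g x p.1 p.2 = k then (1 : ℝ) else 0) *
    h (augmentedCount g k x p.1 p.2) ∂poissonConfig r P
  rw [hthin] at b1
  change ‖Φ - _ * ∫ p, h (degreeCount g k p.1 p.2) ∂poissonConfig r (configLaw ν)‖ₑ ≤ _
  rw [hforget]
  set R := ∫ p, h (remainingCount g k x p.1 p.2) ∂poissonConfig r P
  set D := ∫ p, h (degreeCount g k p.1 p.2.forget) ∂poissonConfig r P
  set m := poissonMass k (r * joinProb ν g x)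
  set Q := (r : ℝ≥0∞) * ∫⁻ y, ENNReal.ofReal (pairBound ν g r k θ x y) ∂ν
  have b4 : ‖m * (D - R)‖ₑ ≤ ENNReal.ofReal (2 * C) * Q := by
    rw [enorm_mul, Real.enorm_of_nonneg (poissonMass_nonneg k hm0)]
    refine (mul_le_mul' le_rfl b2).trans ?_
    rw [mul_left_comm]
    exact mul_le_mul' le_rfl b3
  calc ‖Φ - m * D‖ₑ = ‖(Φ - m * R) - m * (D - R)‖ₑ := by congr 1; ring
    _ ≤ ‖Φ - m * R‖ₑ + ‖m * (D - R)‖ₑ := enorm_sub_le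
    _ ≤ ENNReal.ofReal (2 * C) * Q + ENNReal.ofReal (2 * C) * Q := add_le_add b1 b4
    _ = ENNReal.ofReal (4 * C) * Q := by
        rw [← add_mul, ← ENNReal.ofReal_add (by positivity) (by positivity)]
        ring_nf

include hgs

/-- Stein's bound for the number of vertices of degree `k`. -/
theorem abs_stein_degreeCount_le (l : ℝ) {ε : ℝ} (hε : 0 ≤ ε)
    (hQ : ∫⁻ x, ∫⁻ y, ENNReal.ofReal (r ^ 2 * pairBound ν g r k θ x y) ∂ν ∂ν ≤ ENNReal.ofReal ε) :
    |l * ∫ p, f (degreeCount g k p.1 p.2 + 1) ∂poissonConfig r (configLaw ν) -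
      ∫ p, (degreeCount g k p.1 p.2 : ℝ) * f (degreeCount g k p.1 p.2)
        ∂poissonConfig r (configLaw ν)| ≤
      4 * C * ε + C * |r * ∫ x, poissonMass k (r * joinProb ν g x) ∂ν - l| := by
  set P := configLaw (ν.prod uniformUnit) with hP
  set D := ∫ p, f (degreeCount g k p.1 p.2 + 1) ∂poissonConfig r (configLaw ν) with hD
  rw [integral_degreeCount_mul ν hgm hgs k r hC]
  set Φ : Z → ℝ := fun x => ∫ p, (if joinedCount g x p.1 p.2 = k then (1 : ℝ) else 0) *
        f (augmentedCount g k x p.1 p.2 + 1) ∂poissonConfig r P with hΦ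
  set m : Z → ℝ := fun x => poissonMass k (r * joinProb ν g x) with hm
  have hm0 : ∀ x, 0 ≤ (r : ℝ) * joinProb ν g x :=
    fun x => mul_nonneg r.2 (joinProb_nonneg hg0 x)
  have hDC : |D| ≤ C := by
    refine (norm_integral_le_of_norm_le_const (f := fun p : ℕ × Config Z =>
      f (degreeCount g k p.1 p.2 + 1)) (ae_of_all _ fun p => hC _)).trans ?_
    simp
  have hCh : ∀ i, |f (i + 1)| ≤ C := fun i => hC _
  have hΦi : Integrable Φ ν := by
    refine .of_bound (C := C) (Measurable.aestronglyMeasurable ?_) (ae_of_all _ fun x => ?_)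
    · have hmeas : Measurable fun q : Z × (ℕ × Config (Z × ℝ)) =>
          (if joinedCount g q.1 q.2.1 q.2.2 = k then (1 : ℝ) else 0) *
            f (augmentedCount g k q.1 q.2.1 q.2.2 + 1) := by
        have h3 : Measurable fun q : ℕ × (Z × Config (Z × ℝ)) =>
            (if joinedCount g q.2.1 q.1 q.2.2 = k then (1 : ℝ) else 0) *
              f (augmentedCount g k q.2.1 q.1 q.2.2 + 1) :=
          measurable_from_prod_countable_right fun n => (measurable_ite_joinedCount hgm k n).mul
            ((measurable_of_countable fun i => f (i + 1)).comp (measurable_augmentedCount k n hgm))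
        exact h3.comp (by fun_prop :
          Measurable fun q : Z × (ℕ × Config (Z × ℝ)) => (q.2.1, (q.1, q.2.2)))
      exact hmeas.stronglyMeasurable.integral_prod_right'.measurable
    · refine (norm_integral_le_of_norm_le_const (ae_of_all _ fun p =>
        abs_ite_mul_le (h := fun i => f (i + 1)) hCh _ _)).trans ?_
      simp
  have hpm : Measurable (joinProb ν g) :=
    hgm.stronglyMeasurable.integral_prod_right'.measurable
  have hmi : Integrable m ν := by
    refine .of_bound (C := 1) (Measurable.aestronglyMeasurable ?_) (ae_of_all _ fun x => ?_)
    · simp only [hm, poissonMass]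
      fun_prop
    · rw [Real.norm_eq_abs, abs_of_nonneg (poissonMass_nonneg k (hm0 x))]
      exact poissonMass_le_one k (hm0 x)
  have hb : |r * ∫ x, Φ x ∂ν - r * ∫ x, m x * D ∂ν| ≤ 4 * C * ε := by
    rw [← mul_sub, ← ENNReal.ofReal_le_ofReal_iff (by positivity), ← Real.norm_eq_abs,
      ofReal_norm, enorm_mul, Real.enorm_of_nonneg r.coe_nonneg, ENNReal.ofReal_mul (by positivity)]
    calc _ ≤ ENNReal.ofReal r * (ENNReal.ofReal (4 * C) *
          ∫⁻ x, r * ∫⁻ y, ENNReal.ofReal (pairBound ν g r k θ x y) ∂ν ∂ν) := by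
          refine mul_le_mul' le_rfl ?_
          exact enorm_integral_sub_le_of_count ν hΦi (hmi.mul_const D) ENNReal.ofReal_ne_top
            (enorm_augmented_sub_le ν hgm hg0 hg1 k r hC0 hC h0 h1)
      _ = ENNReal.ofReal (4 * C) *
          ∫⁻ x, ∫⁻ y, ENNReal.ofReal (r ^ 2 * pairBound ν g r k θ x y) ∂ν ∂ν := by
          rw [mul_left_comm]
          congr 1
          rw [← lintegral_const_mul' _ _ ENNReal.ofReal_ne_top]
          refine lintegral_congr fun x => ?_
          rw [← lintegral_const_mul' _ _ ENNReal.coe_ne_top,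
            ← lintegral_const_mul' _ _ ENNReal.ofReal_ne_top]
          refine lintegral_congr fun y => ?_
          rw [ENNReal.ofReal_mul (by positivity), ENNReal.ofReal_pow r.coe_nonneg,
            ENNReal.ofReal_coe_nnreal]
          ring
      _ ≤ _ := mul_le_mul' le_rfl hQ
  rw [integral_mul_const] at hb
  -- The first term is the coupling error integrated over `x`; the second compares the first moment
  -- with `l`, using `|D| ≤ C`.
  calc |l * D - r * ∫ x, Φ x ∂ν|
      = |-(r * ∫ x, Φ x ∂ν - r * ((∫ x, m x ∂ν) * D)) - D * (r * ∫ x, m x ∂ν - l)| := by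
        congr 1; ring
    _ ≤ |-(r * ∫ x, Φ x ∂ν - r * ((∫ x, m x ∂ν) * D))| + |D * (r * ∫ x, m x ∂ν - l)| :=
        abs_sub _ _
    _ ≤ _ := by
        rw [abs_neg, abs_mul]
        gcongr

end SteinBound

/-! ### Total variation bound for a general connection function -/

section TotalVariation

open scoped NNReal ENNReal

variable {Z : Type} [MeasurableSpace Z] (ν : Measure Z) [IsProbabilityMeasure ν]
  {g : Z → Z → ℝ} (hgm : Measurable fun p : Z × Z => g p.1 p.2)
  (hgs : ∀ x y, g x y = g y x) (hg0 : ∀ x y, 0 ≤ g x y) (hg1 : ∀ x y, g x y ≤ 1)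
  (k : ℕ) (r : ℝ≥0) {θ : ℝ} (h0 : 0 < θ) (h1 : θ ≤ 1)
include hgm hgs hg0 hg1 h0 h1

/-- Total variation bound for the number of vertices of degree `k`. -/
theorem tvDist_map_degreeCount_le {l : ℝ≥0} (hl : 0 < l) {ε : ℝ} (hε : 0 ≤ ε)
    (hQ : ∫⁻ x, ∫⁻ y, ENNReal.ofReal (r ^ 2 * pairBound ν g r k θ x y) ∂ν ∂ν ≤ ENNReal.ofReal ε) :
    tvDist ((poissonConfig r (configLaw ν)).map fun p => degreeCount g k p.1 p.2)
      (poissonMeasure l) ≤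
      Real.exp l * (4 * ε + |r * ∫ x, poissonMass k (r * joinProb ν g x) ∂ν - l|) := by
  have hDm : Measurable fun p : ℕ × Config Z => degreeCount g k p.1 p.2 :=
    measurable_uncurry_nat fun n => measurable_degreeCount k n hgm
  have hprob : IsProbabilityMeasure
      ((poissonConfig r (configLaw ν)).map fun p => degreeCount g k p.1 p.2) :=
    Measure.isProbabilityMeasure_map hDm.aemeasurable
  have hint : Integrable (fun n : ℕ => (n : ℝ))
      ((poissonConfig r (configLaw ν)).map fun p => degreeCount g k p.1 p.2) := by
    rw [integrable_map_measure (by fun_prop) hDm.aemeasurable]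
    have hN : Integrable (fun p : ℕ × Config Z => (p.1 : ℝ)) (poissonConfig r (configLaw ν)) :=
      (integrable_natCast_poissonMeasure r).comp_fst _
    refine hN.mono' ((measurable_of_countable fun i : ℕ => (i : ℝ)).comp
      hDm).aestronglyMeasurable (ae_of_all _ fun p => ?_)
    simp only [Function.comp_apply, Real.norm_natCast]
    exact_mod_cast countBelow_le _ _
  refine ciSup_le fun A => ?_
  rw [measureReal_sub_poissonMeasure_eq hl A hint,
    integral_map hDm.aemeasurable (measurable_of_countable _).aestronglyMeasurable,
    integral_map hDm.aemeasurable (measurable_of_countable _).aestronglyMeasurable]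
  refine (abs_stein_degreeCount_le ν hgm hgs hg0 hg1 k r (Real.exp_nonneg l)
    (abs_steinSolution_le hl A) h0 h1 l hε hQ).trans (le_of_eq ?_)
  ring

end TotalVariation


/-! ### Total variation convergence implies convergence in distribution -/

section TvConvergence

theorem abs_sub_le_tvDist (μ ν : Measure ℕ) [IsProbabilityMeasure μ] [IsProbabilityMeasure ν]
    (A : Set ℕ) : |μ.real A - ν.real A| ≤ tvDist μ ν := by
  -- A real supremum dominates its terms only if the family is bounded above; 1 is a bound here.
  refine le_ciSup (f := fun A : Set ℕ => |μ.real A - ν.real A|) ⟨1, ?_⟩ A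
  rintro _ ⟨B, rfl⟩
  have h1 : 0 ≤ μ.real B := measureReal_nonneg
  have h2 : μ.real B ≤ 1 := measureReal_le_one
  have h3 : 0 ≤ ν.real B := measureReal_nonneg
  have h4 : ν.real B ≤ 1 := measureReal_le_one
  rw [abs_le]
  constructor <;> linarith

theorem tvDist_nonneg (μ ν : Measure ℕ) [IsProbabilityMeasure μ] [IsProbabilityMeasure ν] :
    0 ≤ tvDist μ ν := (abs_nonneg _).trans (abs_sub_le_tvDist μ ν ∅)

theorem tendsto_probabilityMeasure_of_tvDist {ι : Type*} {l : Filter ι} [l.IsCountablyGenerated]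
    {μ : ι → ProbabilityMeasure ℕ} {ν : ProbabilityMeasure ℕ}
    (h : Tendsto (fun i => tvDist (μ i) ν) l (𝓝 0)) : Tendsto μ l (𝓝 ν) := by
  rcases l.eq_or_neBot with rfl | _
  · exact tendsto_bot
  refine tendsto_of_forall_isOpen_le_liminf' fun G _ => ?_
  have h1 : Tendsto (fun i => (μ i : Measure ℕ).real G) l (𝓝 ((ν : Measure ℕ).real G)) := by
    rw [tendsto_iff_norm_sub_tendsto_zero]
    exact squeeze_zero (fun _ => norm_nonneg _) (fun i => abs_sub_le_tvDist _ _ G) h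
  have h2 : Tendsto (fun i => (μ i : Measure ℕ) G) l (𝓝 ((ν : Measure ℕ) G)) := by
    have h3 := ENNReal.tendsto_ofReal h1
    simp only [measureReal_def, ENNReal.ofReal_toReal (measure_ne_top _ _)] at h3
    exact h3
  rw [h2.liminf_eq]

theorem tendstoInDistribution_of_tvDist {ι : Type*} {l : Filter ι} [l.IsCountablyGenerated]
    {Ω : ι → Type*} [∀ i, MeasurableSpace (Ω i)] {X : ∀ i, Ω i → ℕ} {P : ∀ i, Measure (Ω i)}
    [∀ i, IsProbabilityMeasure (P i)] (hX : ∀ i, Measurable (X i)) {ν : Measure ℕ}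
    [IsProbabilityMeasure ν] (h : Tendsto (fun i => tvDist ((P i).map (X i)) ν) l (𝓝 0)) :
    TendstoInDistribution X l (id : ℕ → ℕ) P ν where
  forall_aemeasurable i := (hX i).aemeasurable
  aemeasurable_limit := aemeasurable_id
  tendsto := by
    refine tendsto_probabilityMeasure_of_tvDist ?_
    simpa using h

end TvConvergence

/-! ### Translating the weighted graph into a configuration model -/

section Model

open scoped NNReal ENNReal

theorem measurable_torusDist (d : ℕ) :
    Measurable fun p : EuclideanSpace ℝ (Fin d) × EuclideanSpace ℝ (Fin d) =>
      torusDist p.1 p.2 := by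
  unfold torusDist
  refine Measurable.iInf fun z => ?_
  fun_prop

theorem _root_.Measurable.torusDist {d : ℕ} {X : Type*} [MeasurableSpace X]
    {f g : X → EuclideanSpace ℝ (Fin d)} (hf : Measurable f) (hg : Measurable g) :
    Measurable fun a => torusDist (f a) (g a) := by
  have := (measurable_torusDist d).comp (hf.prodMk hg)
  exact this

theorem measurable_connectionProb (d : ℕ) (α η r : ℝ) :
    Measurable fun p : (EuclideanSpace ℝ (Fin d) × ℝ) × (EuclideanSpace ℝ (Fin d) × ℝ) =>
      connectionProb α η r p.1.1 p.1.2 p.2.1 p.2.2 := by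
  have h : Measurable fun p : (EuclideanSpace ℝ (Fin d) × ℝ) × (EuclideanSpace ℝ (Fin d) × ℝ) =>
      torusDist p.1.1 p.2.1 :=
    Measurable.torusDist (measurable_fst.comp measurable_fst) (measurable_fst.comp measurable_snd)
  unfold connectionProb
  have h1 : Measurable fun p : (EuclideanSpace ℝ (Fin d) × ℝ) × (EuclideanSpace ℝ (Fin d) × ℝ) =>
      η * p.1.2 * p.2.2 := by fun_prop
  have h2 : Measurable fun p : (EuclideanSpace ℝ (Fin d) × ℝ) × (EuclideanSpace ℝ (Fin d) × ℝ) =>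
      (torusDist p.1.1 p.2.1 / r) ^ α := (h.div_const r).pow_const α
  exact (h1.div h2).neg.exp.const_sub 1

/-- A weighted point. -/
abbrev WPoint (d : ℕ) : Type := EuclideanSpace ℝ (Fin d) × ℝ

/-- The connection function for weighted points. -/
def connect {d : ℕ} (α η r : ℝ) (x y : WPoint d) : ℝ := connectionProb α η r x.1 x.2 y.1 y.2

/-- The connection function with weights replaced by their maximum with `1`. -/
def connectPos {d : ℕ} (α η r : ℝ) (x y : WPoint d) : ℝ :=
  connectionProb α η r x.1 (max x.2 1) y.1 (max y.2 1)

theorem measurable_connect (d : ℕ) (α η r : ℝ) :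
    Measurable fun p : WPoint d × WPoint d => connect α η r p.1 p.2 :=
  measurable_connectionProb d α η r

theorem measurable_connectPos (d : ℕ) (α η r : ℝ) :
    Measurable fun p : WPoint d × WPoint d => connectPos α η r p.1 p.2 :=
  (measurable_connectionProb d α η r).comp (by fun_prop :
    Measurable fun p : WPoint d × WPoint d =>
      ((p.1.1, max p.1.2 1), (p.2.1, max p.2.2 1)))

theorem connectPos_comm {d : ℕ} (α η r : ℝ) (x y : WPoint d) :
    connectPos α η r x y = connectPos α η r y x := connectionProb_comm _ _ _ _ _ _ _

theorem torusDist_nonneg {d : ℕ} (x y : EuclideanSpace ℝ (Fin d)) : 0 ≤ torusDist x y :=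
  Real.iInf_nonneg fun _ => norm_nonneg _

theorem connectPos_nonneg {d : ℕ} (α : ℝ) {η r : ℝ} (hη : 0 ≤ η) (hr : 0 ≤ r) (x y : WPoint d) :
    0 ≤ connectPos α η r x y := by
  have h1 : 0 ≤ (torusDist x.1 y.1 / r) ^ α :=
    Real.rpow_nonneg (div_nonneg (torusDist_nonneg _ _) hr) _
  have h2 : 0 ≤ max x.2 1 := zero_le_one.trans (le_max_right _ _)
  have h3 : 0 ≤ max y.2 1 := zero_le_one.trans (le_max_right _ _)
  unfold connectPos connectionProb
  have : 0 ≤ η * max x.2 1 * max y.2 1 / (torusDist x.1 y.1 / r) ^ α := by positivity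
  rw [sub_nonneg, Real.exp_le_one_iff]
  linarith

theorem connectPos_le_one {d : ℕ} (α η r : ℝ) (x y : WPoint d) : connectPos α η r x y ≤ 1 := by
  unfold connectPos connectionProb
  linarith [Real.exp_pos (-(η * max x.2 1 * max y.2 1 / (torusDist x.1 y.1 / r) ^ α))]

/-- The configuration of a sample. -/
def Sample.config {d : ℕ} (ω : Sample d) : ℕ × Config (WPoint d) :=
  (ω.1, fun i => (ω.2.1 i, ω.2.2.1 i), ω.2.2.2)

theorem Sample.measurable_config {d : ℕ} : Measurable (Sample.config (d := d)) := by
  unfold Sample.config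
  fun_prop

theorem numDegree_eq_degreeCount {d : ℕ} (α η r : ℝ) (k : ℕ) (ω : Sample d) :
    numDegree α η r k ω = degreeCount (connect α η r) k ω.config.1 ω.config.2 := by
  classical
  have key : ∀ p : ℕ → Prop, (Finset.univ.filter fun i : Fin ω.1 => p i).card =
      countBelow ω.1 p := by
    intro p
    refine Finset.card_bij (fun i _ => (i : ℕ)) ?_ ?_ ?_
    · intro i hi
      simpa using hi
    · intro i _ j _ h
      exact Fin.ext h
    · intro i hi
      simp only [Finset.mem_filter, Finset.mem_range] at hi
      exact ⟨⟨i, hi.1⟩, by simpa using hi.2, rfl⟩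
  have hdeg : ∀ i : Fin ω.1, (randomGraph α η r ω).degree i =
      degreeOn (ω.config.2.adj (connect α η r)) (fun _ => True) ω.1 i := by
    intro i
    rw [degreeOn, ← key, ← SimpleGraph.card_neighborFinset_eq_degree]
    congr 1
    ext j
    simp only [SimpleGraph.mem_neighborFinset, Finset.mem_filter, Finset.mem_univ, true_and]
    simp only [randomGraph, Config.adj, Sample.config, connect, ne_eq, Fin.ext_iff]
  unfold numDegree degreeCount countDegree
  rw [show ω.config.1 = ω.1 from rfl, ← key]
  congr 1
  ext i
  simp only [Finset.mem_filter, Finset.mem_univ, true_and, hdeg]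

theorem measurable_numDegree {d : ℕ} (α η r : ℝ) (k : ℕ) :
    Measurable (numDegree (d := d) α η r k) := by
  have h : Measurable fun p : ℕ × Config (WPoint d) => degreeCount (connect α η r) k p.1 p.2 :=
    measurable_uncurry_nat fun n => measurable_degreeCount k n (measurable_connect d α η r)
  have e : numDegree (d := d) α η r k =
      fun ω => degreeCount (connect α η r) k ω.config.1 ω.config.2 :=
    funext fun ω => numDegree_eq_degreeCount α η r k ω
  rw [e]
  exact h.comp Sample.measurable_config

/-- The law of a weighted point. -/
def pointLaw (d : ℕ) (β : ℝ) : Measure (WPoint d) := (uniformCube d).prod (paretoMeasure 1 β)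

theorem isProbabilityMeasure_pointLaw (d : ℕ) {β : ℝ} (hβ : 0 < β) :
    IsProbabilityMeasure (pointLaw d β) := by
  have : IsProbabilityMeasure (paretoMeasure 1 β) :=
    isProbabilityMeasure_paretoMeasure one_pos hβ
  unfold pointLaw
  infer_instance

theorem measurePreserving_config (d : ℕ) {β : ℝ} (hβ : 0 < β) (s : ℝ)
    [IsProbabilityMeasure (pointLaw d β)] :
    MeasurePreserving Sample.config (sampleLaw d β hβ s)
      (poissonConfig s.toNNReal (configLaw (pointLaw d β))) := by
  have : IsProbabilityMeasure (paretoMeasure 1 β) :=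
    isProbabilityMeasure_paretoMeasure one_pos hβ
  have h1 := (measurePreserving_prodAssoc (Measure.infinitePi fun _ : ℕ => uniformCube d)
    (Measure.infinitePi fun _ : ℕ => paretoMeasure 1 β)
    (Measure.infinitePi fun _ : Sym2 ℕ => uniformUnit)).symm
  have h2 := (measurePreserving_zip (ι := ℕ) (uniformCube d) (paretoMeasure 1 β)).prod
    (.id (Measure.infinitePi fun _ : Sym2 ℕ => uniformUnit))
  exact (MeasurePreserving.id (poissonMeasure s.toNNReal)).prod (h2.comp h1)

theorem ae_paretoMeasure_one_le (β : ℝ) : ∀ᵐ w ∂paretoMeasure 1 β, 1 ≤ w := by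
  have : paretoMeasure 1 β {w | ¬ 1 ≤ w} = 0 := by
    have hs : {w : ℝ | ¬ 1 ≤ w} = Set.Iio 1 := by ext; simp
    rw [hs, paretoMeasure, withDensity_apply _ measurableSet_Iio,
      lintegral_paretoPDF_of_le le_rfl]
  exact this

/-- Pareto weights are almost surely at least 1, so `connectPos` almost surely yields the same
graph. It is nonnegative everywhere for `η, r ≥ 0`, as the general bound demands. -/
theorem map_numDegree {d : ℕ} (α η r : ℝ) (k : ℕ) {β : ℝ} (hβ : 0 < β) (s : ℝ)
    [IsProbabilityMeasure (pointLaw d β)] :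
    (sampleLaw d β hβ s).map (numDegree α η r k) =
      (poissonConfig s.toNNReal (configLaw (pointLaw d β))).map
        fun p => degreeCount (connectPos α η r) k p.1 p.2 := by
  have : IsProbabilityMeasure (paretoMeasure 1 β) :=
    isProbabilityMeasure_paretoMeasure one_pos hβ
  have hm : ∀ {g : WPoint d → WPoint d → ℝ}, (Measurable fun p : WPoint d × WPoint d => g p.1 p.2) →
      Measurable fun p : ℕ × Config (WPoint d) => degreeCount g k p.1 p.2 := fun hg =>
    measurable_uncurry_nat fun n => measurable_degreeCount k n hg
  have h1 : (sampleLaw d β hβ s).map (numDegree α η r k) =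
      (poissonConfig s.toNNReal (configLaw (pointLaw d β))).map
        fun p => degreeCount (connect α η r) k p.1 p.2 := by
    rw [← (measurePreserving_config d hβ s).map_eq,
      Measure.map_map (hm (measurable_connect d α η r)) Sample.measurable_config]
    congr 1
    exact funext fun ω => numDegree_eq_degreeCount α η r k ω
  rw [h1]
  refine Measure.map_congr ?_
  have hw : ∀ i : ℕ, ∀ᵐ p ∂poissonConfig s.toNNReal (configLaw (pointLaw d β)),
      1 ≤ (p.2.1 i).2 := by
    intro i
    have hmp : MeasurePreserving (fun p : ℕ × Config (WPoint d) => (p.2.1 i).2)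
        (poissonConfig s.toNNReal (configLaw (pointLaw d β))) (paretoMeasure 1 β) :=
      measurePreserving_snd.comp ((measurePreserving_eval_infinitePi
        (fun _ : ℕ => pointLaw d β) i).comp (measurePreserving_fst.comp measurePreserving_snd))
    exact hmp.quasiMeasurePreserving.ae (ae_paretoMeasure_one_le β)
  filter_upwards [ae_all_iff.2 hw] with p hp
  have : ∀ i j, p.2.adj (connect α η r) i j ↔ p.2.adj (connectPos α η r) i j := by
    intro i j
    simp only [Config.adj, connect, connectPos, max_eq_left (hp i), max_eq_left (hp j)]
  unfold degreeCount
  congr 1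
  ext i j
  exact this i j

end Model


/-! ### Translation invariance of the toroidal distance -/

section Torus

variable {d : ℕ}

/-- The integer vectors in Euclidean space. -/
def intVec (d : ℕ) : (Fin d → ℤ) →+ EuclideanSpace ℝ (Fin d) where
  toFun z := WithLp.toLp 2 fun i => (z i : ℝ)
  map_zero' := by ext i; simp
  map_add' a b := by ext i; simp

@[simp]
theorem intVec_apply (z : Fin d → ℤ) (i : Fin d) : intVec d z i = z i := rfl

theorem torusDist_le (x y : EuclideanSpace ℝ (Fin d)) (z : Fin d → ℤ) :
    torusDist x y ≤ ‖x - y - intVec d z‖ :=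
  ciInf_le ⟨0, by rintro _ ⟨z, rfl⟩; exact norm_nonneg _⟩ z

theorem torusDist_triangle (x y z : EuclideanSpace ℝ (Fin d)) :
    torusDist x z ≤ torusDist x y + torusDist y z := by
  refine le_ciInf_add_ciInf fun a b => (torusDist_le x z (a + b)).trans ?_
  refine le_trans (le_of_eq ?_) (norm_add_le _ _)
  congr 1
  change x - z - intVec d (a + b) = (x - y - intVec d a) + (y - z - intVec d b)
  rw [map_add]
  abel

theorem torusDist_sub_zero (x y : EuclideanSpace ℝ (Fin d)) :
    torusDist (x - y) 0 = torusDist x y := by simp [torusDist]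

theorem torusDist_add_intVec (x : EuclideanSpace ℝ (Fin d)) (z : Fin d → ℤ) :
    torusDist (intVec d z + x) 0 = torusDist x 0 := by
  unfold torusDist
  refine (Equiv.subRight z).iInf_congr fun a => ?_
  congr 1
  change x - 0 - intVec d (a - z) = intVec d z + x - 0 - intVec d a
  rw [map_sub]
  abel

/-- Coordinatewise, a nonzero integer is at distance at least `1 / 2` from `x i`, while `|x i| ≤ 1 /
2`. -/
theorem torusDist_zero_of_mem {x : EuclideanSpace ℝ (Fin d)} (hx : x ∈ unitCube d) :
    torusDist x 0 = ‖x‖ := by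
  refine le_antisymm (by simpa using torusDist_le x 0 0) (le_ciInf fun z => ?_)
  rw [EuclideanSpace.norm_eq, EuclideanSpace.norm_eq]
  refine Real.sqrt_le_sqrt (Finset.sum_le_sum fun i _ => ?_)
  rw [sq_le_sq, abs_norm, abs_norm]
  simp only [sub_zero, PiLp.sub_apply, Real.norm_eq_abs]
  obtain ⟨h1, h2⟩ := hx i
  rcases lt_trichotomy (z i) 0 with h | h | h
  · have : (z i : ℝ) ≤ -1 := by exact_mod_cast Int.le_sub_one_of_lt h
    rw [abs_of_nonneg (by linarith : (0 : ℝ) ≤ x i - z i), abs_le]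
    constructor <;> linarith
  · simp [h]
  · have : (1 : ℝ) ≤ z i := by exact_mod_cast h
    rw [abs_of_nonpos (by linarith : x i - z i ≤ (0 : ℝ)), abs_le]
    constructor <;> linarith

theorem measurableSet_unitCube (d : ℕ) : MeasurableSet (unitCube d) := by
  have : unitCube d = ⋂ i, (fun x : EuclideanSpace ℝ (Fin d) => x i) ⁻¹'
      Set.Ioc (-(1 / 2) : ℝ) (1 / 2) := by
    ext x
    simp [unitCube]
  rw [this]
  refine MeasurableSet.iInter fun i => measurableSet_Ioc.preimage ?_
  fun_prop

theorem existsUnique_intVec_add_mem (x : EuclideanSpace ℝ (Fin d)) :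
    ∃! z : Fin d → ℤ, intVec d z + x ∈ unitCube d := by
  have h : ∀ i, ∃! m : ℤ, x i + m • (1 : ℝ) ∈ Set.Ioc (-(1 / 2) : ℝ) (-(1 / 2) + 1) := fun i =>
    existsUnique_add_zsmul_mem_Ioc one_pos _ _
  have e : (-(1 / 2) + 1 : ℝ) = 1 / 2 := by norm_num
  simp only [e] at h
  choose m hm hu using h
  refine ⟨m, fun i => ?_, fun z hz => funext fun i => hu i (z i) ?_⟩
  · simpa [add_comm] using hm i
  · simpa [add_comm] using hz i

theorem isAddFundamentalDomain_unitCube (d : ℕ) (a : EuclideanSpace ℝ (Fin d)) :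
    IsAddFundamentalDomain (intVec d).range ((fun y => y + a) ⁻¹' unitCube d) := by
  refine .mk' ((measurableSet_unitCube d).preimage (measurable_add_const a)).nullMeasurableSet
    fun x => ?_
  obtain ⟨z, hz, hu⟩ := existsUnique_intVec_add_mem (x + a)
  refine ⟨⟨intVec d z, z, rfl⟩, ?_, ?_⟩
  · simpa [AddSubgroup.vadd_def, add_assoc] using hz
  · rintro ⟨_, z', rfl⟩ h
    have := hu z' (by simpa [AddSubgroup.vadd_def, add_assoc] using h)
    simp [this]

/-- Seen from `x`, the cube becomes a translated cube, another fundamental domain of the integer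
lattice; a periodic set has the same volume in both. Hence `joinProb` depends only on the weight. -/
theorem map_torusDist (x : EuclideanSpace ℝ (Fin d)) :
    (uniformCube d).map (fun y => torusDist x y) = (uniformCube d).map norm := by
  have hm : Measurable fun y : EuclideanSpace ℝ (Fin d) => torusDist y 0 :=
    measurable_id.torusDist measurable_const
  have hm' : Measurable fun y : EuclideanSpace ℝ (Fin d) => torusDist x y :=
    measurable_const.torusDist measurable_id
  have : Countable (intVec d).range := (Set.countable_range (intVec d)).to_subtype
  ext s hs
  have hA : MeasurableSet {y : EuclideanSpace ℝ (Fin d) | torusDist y 0 ∈ s} := hm hs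
  have key := (isAddFundamentalDomain_unitCube d x).measure_set_eq
    (isAddFundamentalDomain_unitCube d 0) hA (by
      rintro ⟨_, z, rfl⟩
      ext y
      simp [AddSubgroup.vadd_def, torusDist_add_intVec])
  rw [Measure.map_apply hm' hs, Measure.map_apply measurable_norm hs, uniformCube,
    Measure.restrict_apply (hm' hs), Measure.restrict_apply (measurable_norm hs)]
  have e1 : volume ((fun y => torusDist x y) ⁻¹' s ∩ unitCube d) =
      volume ({y | torusDist y 0 ∈ s} ∩ (fun y => y + x) ⁻¹' unitCube d) := by
    rw [← measure_preimage_add_right volume x]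
    congr 1
    ext y
    have : torusDist x (y + x) = torusDist y 0 := by
      rw [torusDist_comm, ← torusDist_sub_zero, add_sub_cancel_right]
    simp [this]
  rw [e1, key]
  congr 1
  ext y
  simp only [Set.mem_inter_iff, Set.mem_ofPred_eq, Set.mem_preimage, add_zero]
  exact and_congr_left fun hy => by rw [torusDist_zero_of_mem hy]

end Torus


/-! ### The radial integral of the connection function -/

section Radial

open Set

/-- The volume of the unit ball. -/
def unitBallVolume (d : ℕ) : ℝ := volume.real (Metric.ball (0 : EuclideanSpace ℝ (Fin d)) 1)

theorem ofReal_unitBallVolume (d : ℕ) : ENNReal.ofReal (unitBallVolume d) =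
    volume (Metric.ball (0 : EuclideanSpace ℝ (Fin d)) 1) :=
  ofReal_measureReal Metric.isBounded_ball.measure_lt_top.ne

theorem unitBallVolume_pos (d : ℕ) : 0 < unitBallVolume d :=
  ENNReal.toReal_pos (Metric.measure_ball_pos _ _ one_pos).ne'
    Metric.isBounded_ball.measure_lt_top.ne

theorem unitBallVolume_eq {d : ℕ} (hd : 0 < d) :
    unitBallVolume d = 2 * Real.pi ^ ((d : ℝ) / 2) / Real.Gamma ((d : ℝ) / 2) / d := by
  have : Nonempty (Fin d) := ⟨⟨0, hd⟩⟩
  have hd' : (0 : ℝ) < d := by exact_mod_cast hd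
  have hG : 0 < Real.Gamma ((d : ℝ) / 2) := Real.Gamma_pos_of_pos (by positivity)
  have hG' : Real.Gamma ((d : ℝ) / 2 + 1) = d / 2 * Real.Gamma ((d : ℝ) / 2) :=
    Real.Gamma_add_one (by positivity)
  rw [unitBallVolume, measureReal_def, EuclideanSpace.volume_ball]
  simp only [ENNReal.ofReal_one, one_pow, one_mul, Fintype.card_fin]
  rw [ENNReal.toReal_ofReal (by rw [hG']; positivity), hG', Real.sqrt_eq_rpow, ← Real.rpow_natCast,
    ← Real.rpow_mul Real.pi_pos.le, one_div_mul_eq_div]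
  field_simp

theorem volume_ball_eq {d : ℕ} {ρ : ℝ} (hρ : 0 < ρ) :
    volume (Metric.ball (0 : EuclideanSpace ℝ (Fin d)) ρ) =
      ENNReal.ofReal (unitBallVolume d * ρ ^ (d : ℝ)) := by
  rw [Measure.addHaar_ball_of_pos _ _ hρ, finrank_euclideanSpace_fin, ← ofReal_unitBallVolume,
    ← ENNReal.ofReal_mul (by positivity), mul_comm, Real.rpow_natCast]

theorem one_sub_exp_neg_eq_integral (t : ℝ) : 1 - Real.exp (-t) = ∫ u in (0)..t, Real.exp (-u) := by
  rw [intervalIntegral.integral_comp_neg (fun x => Real.exp x), integral_exp]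
  simp

theorem ae_norm_pos {d : ℕ} (hd : 0 < d) : ∀ᵐ y : EuclideanSpace ℝ (Fin d), 0 < ‖y‖ := by
  have : Nontrivial (EuclideanSpace ℝ (Fin d)) := by
    have : Nonempty (Fin d) := ⟨⟨0, hd⟩⟩
    infer_instance
  filter_upwards [Measure.ae_ne volume (0 : EuclideanSpace ℝ (Fin d))] with y hy
  exact norm_pos_iff.2 hy

/-- Layer cake with density `exp (-t)`: the set `t < a / ‖y‖ ^ α` is, up to the origin, a ball of
radius `(a / t) ^ (1 / α)`, and integrating `t ^ (-d / α) exp (-t)` gives the Gamma value. -/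
theorem lintegral_one_sub_exp_norm {d : ℕ} (hd : 0 < d) {α : ℝ} (hα : d < α) {a : ℝ} (ha : 0 ≤ a) :
    ∫⁻ y : EuclideanSpace ℝ (Fin d), ENNReal.ofReal (1 - Real.exp (-(a / ‖y‖ ^ α))) =
      ENNReal.ofReal (unitBallVolume d * Real.Gamma (1 - d / α) * a ^ (d / α)) := by
  have hd' : (0 : ℝ) < d := by exact_mod_cast hd
  have hα0 : 0 < α := hd'.trans hα
  have hp : 0 < d / α := by positivity
  have hp1 : d / α < 1 := (div_lt_one hα0).2 hα
  rcases ha.eq_or_lt with rfl | ha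
  · simp [Real.zero_rpow hp.ne']
  simp_rw [one_sub_exp_neg_eq_integral]
  rw [lintegral_comp_eq_lintegral_meas_lt_mul volume
    (Eventually.of_forall fun y => by positivity) (by fun_prop)
    (fun t _ => (by fun_prop : Continuous fun u : ℝ => Real.exp (-u)).intervalIntegrable _ _)
    (Eventually.of_forall fun t => (Real.exp_pos _).le)]
  have hset : ∀ t ∈ Ioi (0 : ℝ), volume {y : EuclideanSpace ℝ (Fin d) | t < a / ‖y‖ ^ α} *
      ENNReal.ofReal (Real.exp (-t)) = ENNReal.ofReal (unitBallVolume d * a ^ (d / α)) *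
        ENNReal.ofReal (Real.exp (-t) * t ^ ((1 - d / α) - 1)) := by
    intro t ht
    have ht : 0 < t := ht
    have hρ : 0 < (a / t) ^ (1 / α) := by positivity
    have e : {y : EuclideanSpace ℝ (Fin d) | t < a / ‖y‖ ^ α} =ᵐ[volume]
        Metric.ball (0 : EuclideanSpace ℝ (Fin d)) ((a / t) ^ (1 / α)) := by
      refine eventuallyEq_set.2 ?_
      filter_upwards [ae_norm_pos hd] with y hy
      rw [mem_ball_zero_iff, lt_div_iff₀ (by positivity), ← lt_div_iff₀' ht,
        ← Real.rpow_lt_rpow_iff hy.le hρ.le hα0, ← Real.rpow_mul (by positivity),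
        one_div_mul_cancel hα0.ne', Real.rpow_one]
    rw [measure_congr e, volume_ball_eq hρ, ← ENNReal.ofReal_mul (by
      have := unitBallVolume_pos d; positivity), ← ENNReal.ofReal_mul (by
      have := unitBallVolume_pos d; positivity), ← Real.rpow_mul (by positivity), one_div_mul_eq_div,
      Real.div_rpow ha.le ht.le, show 1 - d / α - 1 = -(d / α) by ring, Real.rpow_neg ht.le]
    congr 1
    ring
  rw [setLIntegral_congr_fun measurableSet_Ioi hset, lintegral_const_mul _ (by fun_prop),
    ← ofReal_integral_eq_lintegral_ofReal (Real.GammaIntegral_convergent (by linarith))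
      ((ae_restrict_iff' measurableSet_Ioi).2 (Eventually.of_forall fun t ht => by
        have : (0 : ℝ) < t := ht
        positivity)), ← Real.Gamma_eq_integral (by linarith), ← ENNReal.ofReal_mul (by
      have := unitBallVolume_pos d; positivity)]
  congr 1
  ring

/-- The probability that a point at the origin is joined to a uniform point of the cube, with
parameter `a`. -/
def cubeIntegral (d : ℕ) (α a : ℝ) : ℝ :=
  ∫ y, (1 - Real.exp (-(a / ‖y‖ ^ α))) ∂uniformCube d

theorem one_sub_exp_neg_nonneg {t : ℝ} (ht : 0 ≤ t) : 0 ≤ 1 - Real.exp (-t) := by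
  rw [sub_nonneg, Real.exp_le_one_iff]
  linarith

theorem one_sub_exp_neg_le (t : ℝ) : 1 - Real.exp (-t) ≤ t := by
  linarith [Real.add_one_le_exp (-t)]

theorem one_sub_exp_neg_le_rpow {t p : ℝ} (ht : 0 ≤ t) (hp : 0 < p) (hp1 : p ≤ 1) :
    1 - Real.exp (-t) ≤ t ^ p := by
  rcases le_total t 1 with h | h
  · refine (one_sub_exp_neg_le t).trans ?_
    rcases ht.eq_or_lt with rfl | ht
    · simp [Real.zero_rpow hp.ne']
    · simpa using Real.rpow_le_rpow_of_exponent_ge ht h hp1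
  · linarith [Real.exp_pos (-t), Real.one_le_rpow h hp.le]

theorem integrable_one_sub_exp_norm (d : ℕ) (α : ℝ) {a : ℝ} (ha : 0 ≤ a) :
    Integrable (fun y => 1 - Real.exp (-(a / ‖y‖ ^ α))) (uniformCube d) := by
  refine Integrable.of_bound (C := 1)
    (by fun_prop : Measurable fun y : EuclideanSpace ℝ (Fin d) =>
      1 - Real.exp (-(a / ‖y‖ ^ α))).aestronglyMeasurable (Eventually.of_forall fun y => ?_)
  have h : 0 ≤ a / ‖y‖ ^ α := by positivity
  rw [Real.norm_of_nonneg (one_sub_exp_neg_nonneg h)]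
  linarith [Real.exp_pos (-(a / ‖y‖ ^ α))]

theorem ofReal_cubeIntegral (d : ℕ) (α : ℝ) {a : ℝ} (ha : 0 ≤ a) :
    ENNReal.ofReal (cubeIntegral d α a) =
      ∫⁻ y in unitCube d, ENNReal.ofReal (1 - Real.exp (-(a / ‖y‖ ^ α))) :=
  ofReal_integral_eq_lintegral_ofReal (integrable_one_sub_exp_norm d α ha)
    (Eventually.of_forall fun y => one_sub_exp_neg_nonneg (by positivity))

theorem cubeIntegral_nonneg (d : ℕ) (α : ℝ) {a : ℝ} (ha : 0 ≤ a) : 0 ≤ cubeIntegral d α a :=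
  integral_nonneg fun y => one_sub_exp_neg_nonneg (by positivity)

theorem cubeIntegral_le {d : ℕ} (hd : 0 < d) {α : ℝ} (hα : d < α) {a : ℝ} (ha : 0 ≤ a) :
    cubeIntegral d α a ≤ unitBallVolume d * Real.Gamma (1 - d / α) * a ^ (d / α) := by
  have hα0 : 0 < α := (Nat.cast_nonneg d).trans_lt hα
  have hG : 0 < Real.Gamma (1 - d / α) :=
    Real.Gamma_pos_of_pos (by linarith [(div_lt_one hα0).2 hα])
  have hV := unitBallVolume_pos d
  rw [← ENNReal.ofReal_le_ofReal_iff (by positivity), ofReal_cubeIntegral d α ha,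
    ← lintegral_one_sub_exp_norm hd hα ha]
  exact setLIntegral_le_lintegral _ _

theorem half_le_norm_of_notMem {d : ℕ} {y : EuclideanSpace ℝ (Fin d)} (hy : y ∉ unitCube d) :
    1 / 2 ≤ ‖y‖ := by
  simp only [unitCube, mem_ofPred_eq, not_forall, mem_Ioc, not_and_or, not_lt, not_le] at hy
  obtain ⟨i, hi⟩ := hy
  refine le_trans ?_ (PiLp.norm_apply_le y i)
  rw [Real.norm_eq_abs, le_abs]
  rcases hi with h | h
  · right; linarith
  · left; linarith

/-- A constant bounding the contribution of the complement of the cube. -/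
def tailConst (d : ℕ) (α : ℝ) : ℝ :=
  3 ^ α * ∫ y : EuclideanSpace ℝ (Fin d), (1 + ‖y‖) ^ (-α)

theorem tailConst_nonneg (d : ℕ) (α : ℝ) : 0 ≤ tailConst d α := by
  unfold tailConst
  have : 0 ≤ ∫ y : EuclideanSpace ℝ (Fin d), (1 + ‖y‖) ^ (-α) :=
    integral_nonneg fun y => by positivity
  positivity

/-- Outside the cube `‖y‖ ≥ 1 / 2`, so `1 + ‖y‖ ≤ 3 ‖y‖`, and the integrand is at most `3 ^ α a (1 +
‖y‖) ^ (-α)`, integrable as `α > d`. -/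
theorem le_cubeIntegral {d : ℕ} (hd : 0 < d) {α : ℝ} (hα : d < α) {a : ℝ} (ha : 0 ≤ a) :
    unitBallVolume d * Real.Gamma (1 - d / α) * a ^ (d / α) - tailConst d α * a ≤
      cubeIntegral d α a := by
  have hα0 : 0 < α := (Nat.cast_nonneg d).trans_lt hα
  have hG : 0 < Real.Gamma (1 - d / α) :=
    Real.Gamma_pos_of_pos (by linarith [(div_lt_one hα0).2 hα])
  have hV := unitBallVolume_pos d
  have hC := tailConst_nonneg d α
  have hI := cubeIntegral_nonneg d α ha
  rw [sub_le_iff_le_add, ← ENNReal.ofReal_le_ofReal_iff (by positivity),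
    ENNReal.ofReal_add hI (by positivity),
    ofReal_cubeIntegral d α ha, ← lintegral_one_sub_exp_norm hd hα ha,
    ← lintegral_add_compl _ (measurableSet_unitCube d)]
  gcongr
  have hint : Integrable fun y : EuclideanSpace ℝ (Fin d) => (1 + ‖y‖) ^ (-α) :=
    integrable_one_add_norm (by simpa using hα)
  calc ∫⁻ y in (unitCube d)ᶜ, ENNReal.ofReal (1 - Real.exp (-(a / ‖y‖ ^ α)))
      ≤ ∫⁻ y in (unitCube d)ᶜ, ENNReal.ofReal (3 ^ α * a * (1 + ‖y‖) ^ (-α)) := by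
        refine setLIntegral_mono' (measurableSet_unitCube d).compl fun y hy => ?_
        refine ENNReal.ofReal_le_ofReal ((one_sub_exp_neg_le _).trans ?_)
        have h1 := half_le_norm_of_notMem hy
        have h2 : (1 + ‖y‖) ^ α ≤ (3 * ‖y‖) ^ α :=
          Real.rpow_le_rpow (by positivity) (by linarith) hα0.le
        have h3 : 0 < ‖y‖ := by linarith
        rw [Real.mul_rpow (by norm_num) h3.le] at h2
        rw [Real.rpow_neg (by positivity), div_le_iff₀ (by positivity)]
        have h4 : 0 < (1 + ‖y‖) ^ α := by positivity
        rw [show 3 ^ α * a * ((1 + ‖y‖) ^ α)⁻¹ * ‖y‖ ^ α =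
          a * ((3 ^ α * ‖y‖ ^ α) / (1 + ‖y‖) ^ α) by field_simp]
        exact le_mul_of_one_le_right ha ((one_le_div h4).2 h2)
    _ ≤ ∫⁻ y, ENNReal.ofReal (3 ^ α * a * (1 + ‖y‖) ^ (-α)) := setLIntegral_le_lintegral _ _
    _ = ENNReal.ofReal (tailConst d α * a) := by
        rw [← ofReal_integral_eq_lintegral_ofReal (hint.const_mul _)
          (Eventually.of_forall fun y => by positivity), integral_const_mul, tailConst]
        congr 1
        ring

end Radial

/-! ### Moments of the Pareto weights -/

section Pareto

open Set

variable {β : ℝ}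

theorem toReal_paretoPDF (hβ : 0 < β) (w : ℝ) :
    (paretoPDF 1 β w).toReal = (Ici (1 : ℝ)).indicator (fun w => β * w ^ (-(β + 1))) w := by
  rw [paretoPDF, ENNReal.toReal_ofReal (paretoPDFReal_nonneg zero_le_one hβ.le w), paretoPDFReal]
  by_cases h : 1 ≤ w <;> simp [h]

theorem integral_paretoMeasure (hβ : 0 < β) (f : ℝ → ℝ) :
    ∫ w, f w ∂paretoMeasure 1 β = ∫ w in Ioi 1, β * w ^ (-(β + 1)) * f w := by
  rw [paretoMeasure, integral_withDensity_eq_integral_toReal_smul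
    (f := paretoPDF 1 β) (measurable_paretoPDFReal 1 β).ennreal_ofReal
    (Eventually.of_forall fun w => ENNReal.ofReal_lt_top),
    ← integral_Ici_eq_integral_Ioi, ← integral_indicator measurableSet_Ici]
  congr 1
  ext w
  rw [toReal_paretoPDF hβ]
  by_cases h : 1 ≤ w <;> simp [h]

theorem integrable_paretoMeasure_iff (hβ : 0 < β) {f : ℝ → ℝ} :
    Integrable f (paretoMeasure 1 β) ↔ IntegrableOn (fun w => β * w ^ (-(β + 1)) * f w) (Ioi 1) := by
  rw [paretoMeasure, integrable_withDensity_iff_integrable_smul'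
    (f := paretoPDF 1 β) (measurable_paretoPDFReal 1 β).ennreal_ofReal
    (Eventually.of_forall fun w => ENNReal.ofReal_lt_top),
    ← integrableOn_Ici_iff_integrableOn_Ioi, ← integrable_indicator_iff measurableSet_Ici]
  refine integrable_congr (Eventually.of_forall fun w => ?_)
  simp only [smul_eq_mul]
  rw [toReal_paretoPDF hβ]
  by_cases h : 1 ≤ w <;> simp [h]

theorem pareto_density_mul_rpow {q : ℝ} : EqOn (fun w : ℝ => β * w ^ (-(β + 1)) * w ^ q)
    (fun w => β * w ^ (q - β - 1)) (Ioi 1) := by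
  intro w hw
  have : (0 : ℝ) < w := zero_lt_one.trans hw
  simp only
  rw [mul_assoc, ← Real.rpow_add this]
  congr 2
  ring

theorem integrable_rpow_paretoMeasure (hβ : 0 < β) {q : ℝ} (hq : q < β) :
    Integrable (fun w => w ^ q) (paretoMeasure 1 β) := by
  rw [integrable_paretoMeasure_iff hβ, integrableOn_congr_fun pareto_density_mul_rpow
    measurableSet_Ioi]
  exact (integrableOn_Ioi_rpow_of_lt (by linarith) one_pos).const_mul _

theorem integral_rpow_paretoMeasure (hβ : 0 < β) {q : ℝ} (hq : q < β) :
    ∫ w, w ^ q ∂paretoMeasure 1 β = β / (β - q) := by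
  rw [integral_paretoMeasure hβ, setIntegral_congr_fun measurableSet_Ioi pareto_density_mul_rpow,
    integral_const_mul, integral_Ioi_rpow_of_lt (by linarith) one_pos, Real.one_rpow,
    show q - β - 1 + 1 = -(β - q) by ring, neg_div_neg_eq, mul_one_div]

end Pareto


/-! ### Estimates for `joinProb` and `jointProb` in the model -/

section Connection

open Set

theorem one_le_max_one (w : ℝ) : 1 ≤ max w 1 := le_max_right _ _

theorem max_one_pos (w : ℝ) : 0 < max w 1 := zero_lt_one.trans_le (one_le_max_one w)

theorem cubeIntegral_mono (d : ℕ) (α : ℝ) {a b : ℝ} (ha : 0 ≤ a) (hab : a ≤ b) :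
    cubeIntegral d α a ≤ cubeIntegral d α b := by
  refine integral_mono (integrable_one_sub_exp_norm d α ha)
    (integrable_one_sub_exp_norm d α (ha.trans hab)) fun y => ?_
  dsimp only
  gcongr

theorem integral_connectPos {d : ℕ} (α η : ℝ) {r : ℝ} (hr : 0 < r) (x : WPoint d) (v : ℝ) :
    ∫ y, connectPos α η r x (y, v) ∂uniformCube d =
      cubeIntegral d α (η * max x.2 1 * max v 1 * r ^ α) := by
  have hm : Measurable fun D : ℝ => 1 - Real.exp (-(η * max x.2 1 * max v 1 / (D / r) ^ α)) := by
    fun_prop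
  have h1 := integral_map (μ := uniformCube d)
    (measurable_const.torusDist measurable_id : Measurable fun y => torusDist x.1 y).aemeasurable
    hm.aestronglyMeasurable
  rw [map_torusDist, integral_map measurable_norm.aemeasurable hm.aestronglyMeasurable] at h1
  unfold connectPos connectionProb cubeIntegral
  rw [← h1]
  congr 1
  ext y
  rw [Real.div_rpow (norm_nonneg _) hr.le, div_div_eq_mul_div]

variable {d : ℕ} {α β η r : ℝ}

theorem ae_max_one_eq (β : ℝ) : ∀ᵐ w ∂paretoMeasure 1 β, max w 1 = w := by
  filter_upwards [ae_paretoMeasure_one_le β] with w hw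
  exact max_eq_left hw

theorem integrable_max_rpow (hβ : 0 < β) {q : ℝ} (hq : q < β) :
    Integrable (fun w => max w 1 ^ q) (paretoMeasure 1 β) := by
  refine (integrable_rpow_paretoMeasure hβ hq).congr ?_
  filter_upwards [ae_max_one_eq β] with w hw
  rw [hw]

theorem integral_max_rpow (hβ : 0 < β) {q : ℝ} (hq : q < β) :
    ∫ w, max w 1 ^ q ∂paretoMeasure 1 β = β / (β - q) := by
  rw [← integral_rpow_paretoMeasure hβ hq]
  refine integral_congr_ae ?_
  filter_upwards [ae_max_one_eq β] with w hw
  rw [hw]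

theorem norm_connectPos_le_one (α : ℝ) (hη : 0 ≤ η) (hr : 0 ≤ r) (x y : WPoint d) :
    ‖connectPos α η r x y‖ ≤ 1 := by
  rw [Real.norm_of_nonneg (connectPos_nonneg α hη hr x y)]
  exact connectPos_le_one α η r x y

theorem measurable_connectPos_right (α η r : ℝ) (x : WPoint d) :
    Measurable fun z => connectPos α η r x z := by
  have := (measurable_connectPos d α η r).comp (measurable_prodMk_left (x := x))
  exact this

theorem integrable_mul_connectPos (α : ℝ) (hη : 0 ≤ η) (hβ : 0 < β) (hr : 0 ≤ r) (x : WPoint d)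
    {h : ℝ → ℝ} (hh : Integrable h (paretoMeasure 1 β)) :
    Integrable (fun z : WPoint d => h z.2 * connectPos α η r x z) (pointLaw d β) := by
  have : IsProbabilityMeasure (paretoMeasure 1 β) :=
    isProbabilityMeasure_paretoMeasure one_pos hβ
  have h1 : Integrable (fun z : WPoint d => h z.2) (pointLaw d β) := hh.comp_snd (uniformCube d)
  refine h1.mul_bdd (c := 1) (measurable_connectPos_right α η r x).aestronglyMeasurable
    (Eventually.of_forall fun z => norm_connectPos_le_one α hη hr x z)

theorem integral_mul_connectPos (α : ℝ) (hη : 0 ≤ η) (hβ : 0 < β) (hr : 0 < r) (x : WPoint d)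
    {h : ℝ → ℝ} (hh : Integrable h (paretoMeasure 1 β)) :
    ∫ z, h z.2 * connectPos α η r x z ∂pointLaw d β =
      ∫ v, h v * cubeIntegral d α (η * max x.2 1 * max v 1 * r ^ α) ∂paretoMeasure 1 β := by
  have : IsProbabilityMeasure (paretoMeasure 1 β) :=
    isProbabilityMeasure_paretoMeasure one_pos hβ
  have h1 := integrable_mul_connectPos α hη hβ hr.le x hh
  unfold pointLaw at h1 ⊢
  rw [integral_prod_symm _ h1]
  congr 1
  ext v
  simp only
  rw [integral_const_mul, integral_connectPos α η hr]

theorem integrable_mul_cubeIntegral (α : ℝ) (hη : 0 ≤ η) (hβ : 0 < β) (hr : 0 < r) (x : WPoint d)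
    {h : ℝ → ℝ} (hh : Integrable h (paretoMeasure 1 β)) :
    Integrable (fun v => h v * cubeIntegral d α (η * max x.2 1 * max v 1 * r ^ α))
      (paretoMeasure 1 β) := by
  have : IsProbabilityMeasure (paretoMeasure 1 β) :=
    isProbabilityMeasure_paretoMeasure one_pos hβ
  have h1 := integrable_mul_connectPos α hη hβ hr.le x hh
  unfold pointLaw at h1
  refine h1.integral_prod_right.congr (Eventually.of_forall fun v => ?_)
  simp only
  rw [integral_const_mul, integral_connectPos α η hr]

theorem joinProb_connectPos (α : ℝ) (hη : 0 ≤ η) (hβ : 0 < β) (hr : 0 < r) (x : WPoint d) :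
    joinProb (pointLaw d β) (connectPos α η r) x =
      ∫ v, cubeIntegral d α (η * max x.2 1 * max v 1 * r ^ α) ∂paretoMeasure 1 β := by
  have : IsProbabilityMeasure (paretoMeasure 1 β) :=
    isProbabilityMeasure_paretoMeasure one_pos hβ
  have h := integral_mul_connectPos α hη hβ hr x (h := fun _ => 1) (integrable_const _)
  simpa [joinProb] using h

theorem integrable_cubeIntegral (α : ℝ) (hη : 0 ≤ η) (hβ : 0 < β) (hr : 0 < r) (x : WPoint d) :
    Integrable (fun v => cubeIntegral d α (η * max x.2 1 * max v 1 * r ^ α))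
      (paretoMeasure 1 β) := by
  have : IsProbabilityMeasure (paretoMeasure 1 β) :=
    isProbabilityMeasure_paretoMeasure one_pos hβ
  simpa using integrable_mul_cubeIntegral α hη hβ hr x (h := fun _ => 1) (integrable_const _)

theorem joinProb_connectPos_mono (α : ℝ) (hη : 0 ≤ η) (hβ : 0 < β) (hr : 0 < r) {x y : WPoint d}
    (h : max x.2 1 ≤ max y.2 1) :
    joinProb (pointLaw d β) (connectPos α η r) x ≤ joinProb (pointLaw d β) (connectPos α η r) y := by
  rw [joinProb_connectPos α hη hβ hr, joinProb_connectPos α hη hβ hr]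
  refine integral_mono (integrable_cubeIntegral α hη hβ hr x) (integrable_cubeIntegral α hη hβ hr y)
    fun v => ?_
  have := max_one_pos v
  have := max_one_pos x.2
  exact cubeIntegral_mono d α (by positivity) (by gcongr)

theorem mul_max_rpow_rpow (hα : 0 < α) (hη : 0 ≤ η) (hr : 0 ≤ r) (w v : ℝ) :
    (η * max w 1 * max v 1 * r ^ α) ^ ((d : ℝ) / α) =
      (η * max w 1) ^ ((d : ℝ) / α) * r ^ (d : ℝ) * max v 1 ^ ((d : ℝ) / α) := by
  have := max_one_pos v
  have := max_one_pos w
  rw [Real.mul_rpow (by positivity) (by positivity), Real.mul_rpow (by positivity) (by positivity),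
    ← Real.rpow_mul hr, mul_div_cancel₀ _ hα.ne']
  ring

/-- The case `q = 0` bounds `joinProb`; the case `q = d / α` serves the bound on common neighbours.
-/
theorem integral_rpow_mul_connectPos_le (hd : 0 < d) (hα : d < α) (hη : 0 ≤ η) (hβ : 0 < β)
    (hr : 0 < r) {q : ℝ} (hq : q + d / α < β) (x : WPoint d) :
    ∫ z, max z.2 1 ^ q * connectPos α η r x z ∂pointLaw d β ≤
      unitBallVolume d * Real.Gamma (1 - d / α) * (η * max x.2 1) ^ ((d : ℝ) / α) * r ^ (d : ℝ) *
        (β / (β - (q + d / α))) := by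
  have hα0 : 0 < α := (Nat.cast_nonneg d).trans_lt hα
  have hp : 0 ≤ d / α := by positivity
  rw [integral_mul_connectPos α hη hβ hr x (integrable_max_rpow hβ (by linarith)),
    ← integral_max_rpow hβ hq, ← integral_const_mul]
  refine integral_mono (integrable_mul_cubeIntegral α hη hβ hr x
    (integrable_max_rpow hβ (by linarith))) ((integrable_max_rpow hβ hq).const_mul _) fun v => ?_
  have h1 := max_one_pos v
  have h2 := max_one_pos x.2
  have h3 := cubeIntegral_le hd hα (a := η * max x.2 1 * max v 1 * r ^ α) (by positivity)
  rw [mul_max_rpow_rpow hα0 hη hr.le] at h3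
  dsimp only
  rw [Real.rpow_add h1]
  calc max v 1 ^ q * cubeIntegral d α (η * max x.2 1 * max v 1 * r ^ α) ≤ _ :=
        mul_le_mul_of_nonneg_left h3 (by positivity)
    _ = _ := by ring

/-- The last factor is the moment of order `d / α` of the weight, so `c₀ s r ^ d w ^ (d / α)` is the
mean degree at weight `w` when the torus is replaced by the whole space. -/
theorem c₀_eq (hd : 0 < d) (hα : d < α) (hβ : 1 < β) :
    c₀ d α β η = unitBallVolume d * Real.Gamma (1 - d / α) * η ^ ((d : ℝ) / α) *
      (β / (β - d / α)) := by
  have hd' : (0 : ℝ) < d := by exact_mod_cast hd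
  have hα0 : 0 < α := hd'.trans hα
  have hp1 : d / α < 1 := (div_lt_one hα0).2 hα
  have e : α * β - d = α * (β - d / α) := by field_simp
  have e' : β - d / α ≠ 0 := by linarith
  rw [unitBallVolume_eq hd, c₀, e]
  field_simp

theorem c₀_pos (hd : 0 < d) (hα : d < α) (hβ : 1 < β) (hη : 0 < η) : 0 < c₀ d α β η := by
  have hα0 : 0 < α := (Nat.cast_nonneg d).trans_lt hα
  have hp1 : d / α < 1 := (div_lt_one hα0).2 hα
  have hG : 0 < Real.Gamma (1 - d / α) := Real.Gamma_pos_of_pos (by linarith)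
  have hV := unitBallVolume_pos d
  have : 0 < β - d / α := by linarith
  rw [c₀_eq hd hα hβ]
  positivity

theorem joinProb_connectPos_le (hd : 0 < d) (hα : d < α) (hη : 0 ≤ η) (hβ : 1 < β)
    (hr : 0 < r) (x : WPoint d) :
    joinProb (pointLaw d β) (connectPos α η r) x ≤
      c₀ d α β η * max x.2 1 ^ ((d : ℝ) / α) * r ^ (d : ℝ) := by
  have hα0 : 0 < α := (Nat.cast_nonneg d).trans_lt hα
  have hp1 : d / α < 1 := (div_lt_one hα0).2 hα
  have h := integral_rpow_mul_connectPos_le hd hα hη (by linarith : 0 < β) hr (q := 0) (by linarith) x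
  simp only [Real.rpow_zero, one_mul, zero_add] at h
  rw [Real.mul_rpow hη (max_one_pos _).le] at h
  rw [c₀_eq hd hα hβ]
  exact h.trans_eq (by ring)

theorem le_joinProb_connectPos (hd : 0 < d) (hα : d < α) (hη : 0 ≤ η) (hβ : 1 < β)
    (hr : 0 < r) (x : WPoint d) :
    c₀ d α β η * max x.2 1 ^ ((d : ℝ) / α) * r ^ (d : ℝ) -
        tailConst d α * η * (β / (β - 1)) * max x.2 1 * r ^ α ≤
      joinProb (pointLaw d β) (connectPos α η r) x := by
  have hα0 : 0 < α := (Nat.cast_nonneg d).trans_lt hα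
  have hp1 : d / α < 1 := (div_lt_one hα0).2 hα
  have hβ0 : 0 < β := by linarith
  have hx := max_one_pos x.2
  have i1 := (integrable_max_rpow hβ0 (q := d / α) (by linarith)).const_mul
    (unitBallVolume d * Real.Gamma (1 - d / α) * ((η * max x.2 1) ^ ((d : ℝ) / α) * r ^ (d : ℝ)))
  have i2 := (integrable_max_rpow hβ0 hβ).const_mul (tailConst d α * (η * max x.2 1 * r ^ α))
  have h := integral_mono (i1.sub i2) (integrable_cubeIntegral α hη hβ0 hr x) fun v => by
    have h1 := max_one_pos v
    have h3 := le_cubeIntegral hd hα (a := η * max x.2 1 * max v 1 * r ^ α) (by positivity)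
    rw [mul_max_rpow_rpow hα0 hη hr.le] at h3
    simp only [Pi.sub_apply, Real.rpow_one]
    refine le_trans (le_of_eq ?_) h3
    ring
  rw [integral_sub' i1 i2, integral_const_mul, integral_const_mul,
    integral_max_rpow hβ0 (by linarith), integral_max_rpow hβ0 hβ,
    Real.mul_rpow hη hx.le] at h
  rw [joinProb_connectPos α hη hβ0 hr, c₀_eq hd hα hβ]
  refine le_trans (le_of_eq ?_) h
  ring

/-- The exponent `d / α` instead of 1 in `1 - exp (-t) ≤ t ^ p` keeps the order of the weight
moments needed later at `2 d / α`. -/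
theorem connectPos_le_rpow (hd : 0 < d) (hα : d < α) (hη : 0 ≤ η) (hr : 0 ≤ r) (x y : WPoint d) :
    connectPos α η r x y ≤
      (η * max x.2 1 * max y.2 1) ^ ((d : ℝ) / α) * (r / torusDist x.1 y.1) ^ (d : ℝ) := by
  have hd' : (0 : ℝ) < d := by exact_mod_cast hd
  have hα0 : 0 < α := hd'.trans hα
  have hp1 : d / α < 1 := (div_lt_one hα0).2 hα
  have hx := max_one_pos x.2
  have hy := max_one_pos y.2
  have hD := torusDist_nonneg x.1 y.1
  have h0 : 0 ≤ torusDist x.1 y.1 / r := by positivity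
  refine (one_sub_exp_neg_le_rpow (by positivity) (by positivity : 0 < d / α) hp1.le).trans
    (le_of_eq ?_)
  rw [Real.div_rpow (by positivity) (by positivity), ← Real.rpow_mul h0, mul_div_cancel₀ _ hα0.ne',
    ← inv_div (torusDist x.1 y.1) r, Real.inv_rpow h0, div_eq_mul_inv]

theorem connectPos_le_of_le_torusDist (hd : 0 < d) (hα : d < α) (hη : 0 ≤ η) (hr : 0 ≤ r)
    {x y : WPoint d} {ρ : ℝ} (hρ : 0 < ρ) (h : ρ ≤ torusDist x.1 y.1) :
    connectPos α η r x y ≤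
      (η * max x.2 1 * max y.2 1) ^ ((d : ℝ) / α) * (r / ρ) ^ (d : ℝ) := by
  have hx := max_one_pos x.2
  have hy := max_one_pos y.2
  refine (connectPos_le_rpow hd hα hη hr x y).trans ?_
  have : 0 < torusDist x.1 y.1 := hρ.trans_le h
  gcongr

/-- By the triangle inequality a common neighbour is at distance at least `ρ / 2` from `x` or from
`y`. That connection is bounded by a power of `r / ρ`; the other is integrated against the weight it
leaves over. -/
theorem jointProb_connectPos_le (hd : 0 < d) (hα : d < α) (hη : 0 ≤ η) (hβ : 0 < β)
    (hr : 0 < r) (hp : 2 * (d / α) < β) {x y : WPoint d} {ρ K : ℝ} (hρ : 0 < ρ)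
    (h : ρ ≤ torusDist x.1 y.1) (hx : max x.2 1 ≤ K) (hy : max y.2 1 ≤ K) :
    jointProb (pointLaw d β) (connectPos α η r) x y ≤
      2 * 2 ^ (d : ℝ) * (η * K) ^ ((d : ℝ) / α) * (η * K) ^ ((d : ℝ) / α) *
        (unitBallVolume d * Real.Gamma (1 - d / α)) * (β / (β - 2 * (d / α))) * (r / ρ) ^ (d : ℝ) *
        r ^ (d : ℝ) := by
  have hα0 : 0 < α := (Nat.cast_nonneg d).trans_lt hα
  have hp0 : 0 ≤ d / α := by positivity
  have hp1 : d / α < 1 := (div_lt_one hα0).2 hα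
  have hx0 := max_one_pos x.2
  have hy0 := max_one_pos y.2
  have hK : 0 < K := hx0.trans_le hx
  have hV := unitBallVolume_pos d
  have hG : 0 < Real.Gamma (1 - d / α) := Real.Gamma_pos_of_pos (by linarith)
  have hB : 0 < β / (β - 2 * (d / α)) := div_pos hβ (by linarith)
  set A : ℝ := (η * K) ^ ((d : ℝ) / α) * (r / (ρ / 2)) ^ (d : ℝ) with hA
  have hA0 : 0 ≤ A := by positivity
  have hint : ∀ x : WPoint d, Integrable (fun z : WPoint d =>
      max z.2 1 ^ ((d : ℝ) / α) * connectPos α η r x z) (pointLaw d β) := fun x =>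
    integrable_mul_connectPos α hη hβ hr.le x (integrable_max_rpow hβ (by linarith))
  have hup : ∀ x : WPoint d, max x.2 1 ≤ K →
      ∫ z, max z.2 1 ^ ((d : ℝ) / α) * connectPos α η r x z ∂pointLaw d β ≤
      unitBallVolume d * Real.Gamma (1 - d / α) * (η * K) ^ ((d : ℝ) / α) * r ^ (d : ℝ) *
        (β / (β - 2 * (d / α))) := by
    intro x hx
    have := max_one_pos x.2
    refine (integral_rpow_mul_connectPos_le hd hα hη hβ hr (by linarith) x).trans ?_
    rw [← two_mul]
    gcongr
  have hpt : ∀ z : WPoint d, connectPos α η r x z * connectPos α η r y z ≤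
      A * (max z.2 1 ^ ((d : ℝ) / α) * connectPos α η r x z) +
      A * (max z.2 1 ^ ((d : ℝ) / α) * connectPos α η r y z) := by
    intro z
    have hz := max_one_pos z.2
    have gx := connectPos_nonneg α hη hr.le x z
    have gy := connectPos_nonneg α hη hr.le y z
    have hfar : ∀ x : WPoint d, max x.2 1 ≤ K → ρ / 2 ≤ torusDist x.1 z.1 →
        connectPos α η r x z ≤ A * max z.2 1 ^ ((d : ℝ) / α) := by
      intro x hx h
      have := max_one_pos x.2
      refine (connectPos_le_of_le_torusDist hd hα hη hr.le (by positivity) h).trans ?_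
      rw [Real.mul_rpow (by positivity) hz.le, hA, mul_right_comm]
      gcongr
    have htri := torusDist_triangle x.1 z.1 y.1
    rw [torusDist_comm z.1 y.1] at htri
    have t1 : 0 ≤ A * (max z.2 1 ^ ((d : ℝ) / α) * connectPos α η r x z) := by positivity
    have t2 : 0 ≤ A * (max z.2 1 ^ ((d : ℝ) / α) * connectPos α η r y z) := by positivity
    rcases le_total (ρ / 2) (torusDist x.1 z.1) with h1 | h1
    · have := mul_le_mul_of_nonneg_right (hfar x hx h1) gy
      rw [mul_assoc] at this
      linarith
    · have := mul_le_mul_of_nonneg_left (hfar y hy (by linarith)) gx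
      rw [mul_comm _ (A * _), mul_assoc] at this
      linarith
  have hP : IsProbabilityMeasure (pointLaw d β) := isProbabilityMeasure_pointLaw d hβ
  have hmain := integral_mono (integrable_g_mul_g (pointLaw d β) (measurable_connectPos d α η r)
    (connectPos_nonneg α hη hr.le) (connectPos_le_one α η r) x y)
    (((hint x).const_mul A).add ((hint y).const_mul A)) hpt
  rw [integral_add' ((hint x).const_mul A) ((hint y).const_mul A), integral_const_mul,
    integral_const_mul] at hmain
  refine hmain.trans ((add_le_add (mul_le_mul_of_nonneg_left (hup x hx) hA0)
    (mul_le_mul_of_nonneg_left (hup y hy) hA0)).trans (le_of_eq ?_))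
  rw [hA, show r / (ρ / 2) = 2 * (r / ρ) by field_simp,
    Real.mul_rpow (x := 2) (y := r / ρ) (by norm_num) (by positivity)]
  ring

theorem uniformCube_torusDist_lt_le (x : EuclideanSpace ℝ (Fin d)) {ρ : ℝ} (hρ : 0 < ρ) :
    uniformCube d {y | torusDist x y < ρ} ≤ ENNReal.ofReal (unitBallVolume d * ρ ^ (d : ℝ)) := by
  have h : uniformCube d {y | torusDist x y < ρ} = (uniformCube d).map (torusDist x ·) (Iio ρ) :=
    (Measure.map_apply (measurable_const.torusDist measurable_id) measurableSet_Iio).symm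
  rw [h, map_torusDist, Measure.map_apply measurable_norm measurableSet_Iio, uniformCube,
    Measure.restrict_apply (measurable_norm measurableSet_Iio), ← volume_ball_eq hρ]
  refine measure_mono fun y hy => ?_
  simpa using hy.1

theorem le_uniformCube_torusDist_mem_Ioo (hd : 0 < d) (x : EuclideanSpace ℝ (Fin d)) {ρ : ℝ}
    (hρ : 0 < ρ) (hρ' : ρ ≤ 1 / 2) :
    ENNReal.ofReal (unitBallVolume d * ρ ^ (d : ℝ)) ≤
      uniformCube d {y | torusDist x y ∈ Ioo 0 ρ} := by
  have h : uniformCube d {y | torusDist x y ∈ Ioo 0 ρ} =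
      (uniformCube d).map (torusDist x ·) (Ioo 0 ρ) :=
    (Measure.map_apply (measurable_const.torusDist measurable_id) measurableSet_Ioo).symm
  rw [h, map_torusDist, Measure.map_apply measurable_norm measurableSet_Ioo, uniformCube,
    Measure.restrict_apply (measurable_norm measurableSet_Ioo), ← volume_ball_eq hρ]
  refine measure_mono_ae ?_
  filter_upwards [ae_norm_pos hd] with y hy0 hy
  have hy : ‖y‖ < ρ := mem_ball_zero_iff.1 hy
  refine ⟨⟨hy0, hy⟩, ?_⟩
  by_contra hc
  linarith [half_le_norm_of_notMem hc]

/-- A ball of radius `2 r` has volume `2 ^ d ≥ 2` times that of a ball of radius `r`, wherever the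
centres are. -/
theorem rpow_le_measureReal_annulus (hd : 0 < d) (hr : 0 < r) (hr' : 2 * r ≤ 1 / 2)
    (x y : EuclideanSpace ℝ (Fin d)) :
    unitBallVolume d * r ^ (d : ℝ) ≤
      (uniformCube d).real ({z | torusDist y z ∈ Ioo 0 (2 * r)} \ {z | torusDist x z < r}) := by
  have hV := unitBallVolume_pos d
  have h1 := le_uniformCube_torusDist_mem_Ioo hd y (by positivity : 0 < 2 * r) hr'
  have h2 := uniformCube_torusDist_lt_le x hr
  have h1' := ENNReal.toReal_mono (measure_ne_top _ _) h1
  have h2' := ENNReal.toReal_mono ENNReal.ofReal_ne_top h2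
  rw [ENNReal.toReal_ofReal (by positivity)] at h1' h2'
  have hd1 : (1 : ℝ) ≤ d := by exact_mod_cast hd
  have h4 : (2 : ℝ) ≤ 2 ^ (d : ℝ) := by
    simpa using Real.rpow_le_rpow_of_exponent_le one_le_two hd1
  rw [Real.mul_rpow (by norm_num) hr.le] at h1'
  have h5 : 2 * (unitBallVolume d * r ^ (d : ℝ)) ≤ unitBallVolume d * (2 ^ (d : ℝ) * r ^ (d : ℝ)) := by
    have := mul_le_mul_of_nonneg_right h4 (by positivity : 0 ≤ unitBallVolume d * r ^ (d : ℝ))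
    linarith
  have h6 : (uniformCube d).real {z | torusDist y z ∈ Ioo 0 (2 * r)} -
      (uniformCube d).real {z | torusDist x z < r} ≤ (uniformCube d).real
        ({z | torusDist y z ∈ Ioo 0 (2 * r)} \ {z | torusDist x z < r}) := le_measureReal_sdiff
  simp only [measureReal_def] at h6 ⊢
  linarith

/-- A lower bound, per unit of volume, for the probability that a random point is joined to one but
not to the other of two nearby points of weight at most `K`. -/
def excessConst (d : ℕ) (α β η K : ℝ) : ℝ :=
  Real.exp (-(2 * η * K)) * (1 - Real.exp (-(η / 2 ^ α))) *
    (unitBallVolume d * (paretoMeasure 1 β).real (Iic 2))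

theorem excessConst_pos (d : ℕ) {α β η K : ℝ} (hη : 0 < η) (hβ : 0 < β) :
    0 < excessConst d α β η K := by
  have hV := unitBallVolume_pos d
  have : IsProbabilityMeasure (paretoMeasure 1 β) :=
    isProbabilityMeasure_paretoMeasure one_pos hβ
  have h1 : 0 < 1 - Real.exp (-(η / 2 ^ α)) := by
    rw [sub_pos, Real.exp_lt_one_iff]
    have : 0 < η / 2 ^ α := by positivity
    linarith
  have h2 : 0 < (paretoMeasure 1 β).real (Iic 2) := by
    rw [measureReal_def, ENNReal.toReal_pos_iff]
    refine ⟨?_, measure_lt_top _ _⟩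
    rw [pos_iff_ne_zero]
    intro h
    rw [paretoMeasure, withDensity_apply _ measurableSet_Iic,
      lintegral_eq_zero_iff (f := paretoPDF 1 β) (measurable_paretoPDFReal 1 β).ennreal_ofReal] at h
    -- The density is positive on `[1, 2]`, so zero mass would make this interval null.
    have h3 : ∀ᵐ w ∂volume.restrict (Icc (1 : ℝ) 2), False := by
      have h4 := ae_restrict_of_ae_restrict_of_subset (Icc_subset_Iic_self : Icc (1 : ℝ) 2 ⊆ _) h
      filter_upwards [h4, ae_restrict_mem measurableSet_Icc] with w hw hw'
      have := paretoPDFReal_pos one_pos hβ hw'.1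
      simp only [paretoPDF, Pi.zero_apply, ENNReal.ofReal_eq_zero] at hw
      linarith
    rw [eventually_false_iff_eq_bot, ae_eq_bot, Measure.restrict_eq_zero, Real.volume_Icc] at h3
    norm_num at h3
  unfold excessConst
  positivity

/-- Points of weight at most 2 within `2 r` of `y` but not within `r` of `x` are joined to `y` and
not to `x` with probability bounded below. This holds however close `x` and `y` are. -/
theorem excessConst_mul_le (hd : 0 < d) (hα : 0 < α) (hη : 0 ≤ η) (hβ : 0 < β) (hr : 0 < r)
    (hr' : 2 * r ≤ 1 / 2) {x y : WPoint d} {K : ℝ} (hx : max x.2 1 ≤ K) :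
    excessConst d α β η K * r ^ (d : ℝ) ≤
      joinProb (pointLaw d β) (connectPos α η r) y -
        jointProb (pointLaw d β) (connectPos α η r) x y := by
  have hP' : IsProbabilityMeasure (paretoMeasure 1 β) :=
    isProbabilityMeasure_paretoMeasure one_pos hβ
  have hP : IsProbabilityMeasure (pointLaw d β) := isProbabilityMeasure_pointLaw d hβ
  have hg0 := connectPos_nonneg (d := d) α hη hr.le
  have hg1 := connectPos_le_one (d := d) α η r
  have i1 := integrable_g (pointLaw d β) (measurable_connectPos d α η r) hg0 hg1 y
  have i2 := integrable_g_mul_g (pointLaw d β) (measurable_connectPos d α η r) hg0 hg1 x y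
  rw [joinProb, jointProb, ← integral_sub i1 i2]
  -- Distance 0 is excluded because division by zero makes the connection probability vanish there.
  set S : Set (EuclideanSpace ℝ (Fin d)) :=
    {z | torusDist y.1 z ∈ Ioo 0 (2 * r)} \ {z | torusDist x.1 z < r} with hS
  have hSm : MeasurableSet S :=
    (measurableSet_Ioo.preimage (measurable_const.torusDist measurable_id)).diff
      (measurableSet_Iio.preimage (measurable_const.torusDist measurable_id))
  have hT : MeasurableSet (S ×ˢ Iic (2 : ℝ)) := hSm.prod measurableSet_Iic
  have hx0 := max_one_pos x.2
  have hK : 0 < K := hx0.trans_le hx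
  have he : 0 ≤ 1 - Real.exp (-(η / 2 ^ α)) := one_sub_exp_neg_nonneg (by positivity)
  have hpt : ∀ z : WPoint d, (S ×ˢ Iic (2 : ℝ)).indicator (fun _ =>
      Real.exp (-(2 * η * K)) * (1 - Real.exp (-(η / 2 ^ α)))) z ≤
      connectPos α η r y z - connectPos α η r x z * connectPos α η r y z := by
    intro z
    by_cases hz : z ∈ S ×ˢ Iic (2 : ℝ)
    · rw [indicator_of_mem hz]
      obtain ⟨⟨⟨h1, h2⟩, h3⟩, h4⟩ := hz
      have h3 : r ≤ torusDist x.1 z.1 := not_lt.1 h3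
      have h4 : max z.2 1 ≤ 2 := max_le h4 one_le_two
      have hz0 := one_le_max_one z.2
      have hy0 := one_le_max_one y.2
      have e1 : Real.exp (-(2 * η * K)) ≤ 1 - connectPos α η r x z := by
        rw [connectPos, connectionProb, sub_sub_cancel, Real.exp_le_exp, neg_le_neg_iff]
        have : 1 ≤ (torusDist x.1 z.1 / r) ^ α :=
          Real.one_le_rpow ((one_le_div hr).2 h3) hα.le
        refine (div_le_self (by positivity) this).trans ?_
        calc η * max x.2 1 * max z.2 1 ≤ η * K * 2 := by gcongr
          _ = 2 * η * K := by ring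
      have e2 : 1 - Real.exp (-(η / 2 ^ α)) ≤ connectPos α η r y z := by
        rw [connectPos, connectionProb, sub_le_sub_iff_left, Real.exp_le_exp, neg_le_neg_iff]
        have h5 : (torusDist y.1 z.1 / r) ^ α ≤ 2 ^ α := by
          refine Real.rpow_le_rpow (by positivity) ?_ hα.le
          rw [div_le_iff₀ hr]
          exact h2.le
        have h6 : 0 < (torusDist y.1 z.1 / r) ^ α := by positivity
        have h7 : η ≤ η * max y.2 1 * max z.2 1 := by
          rw [mul_assoc]
          exact le_mul_of_one_le_right hη (one_le_mul_of_one_le_of_one_le hy0 hz0)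
        gcongr
      calc _ ≤ (1 - connectPos α η r x z) * connectPos α η r y z :=
            mul_le_mul e1 e2 he ((Real.exp_pos _).le.trans e1)
        _ = _ := by ring
    · rw [indicator_of_notMem hz]
      have := mul_le_mul_of_nonneg_right (hg1 x z) (hg0 y z)
      linarith
  have hmain := integral_mono ((integrable_const _).indicator hT) (i1.sub i2) hpt
  rw [integral_indicator_const _ hT, smul_eq_mul, measureReal_def, pointLaw, Measure.prod_prod,
    ENNReal.toReal_mul, ← measureReal_def, ← measureReal_def] at hmain
  refine le_trans ?_ hmain
  have hann := rpow_le_measureReal_annulus hd hr hr' x.1 y.1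
  rw [← hS] at hann
  have hq : 0 ≤ (paretoMeasure 1 β).real (Iic 2) := measureReal_nonneg
  calc excessConst d α β η K * r ^ (d : ℝ)
      = unitBallVolume d * r ^ (d : ℝ) * (paretoMeasure 1 β).real (Iic 2) *
        (Real.exp (-(2 * η * K)) * (1 - Real.exp (-(η / 2 ^ α)))) := by
          rw [excessConst]
          ring
    _ ≤ _ := by gcongr

end Connection


/-! ### Asymptotics of the mean level and of the scaling -/

section Scaling

/-- The mean degree of a vertex of weight one: `log s + (k - 1) log log s + ξ + log (αβ / (k! d))`. -/
def meanLevel (d : ℕ) (α β ξ : ℝ) (k : ℕ) (s : ℝ) : ℝ :=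
  Real.log s + ((k : ℝ) - 1) * Real.log (Real.log s) + ξ
    + Real.log (α * β / (Nat.factorial k * d))

variable (d : ℕ) (α β ξ : ℝ) (k : ℕ)

theorem tendsto_meanLevel_div_log :
    Tendsto (fun s => meanLevel d α β ξ k s / Real.log s) atTop (𝓝 1) := by
  have hl := Real.tendsto_log_atTop
  have h1 : Tendsto (fun x : ℝ => Real.log x / x) atTop (𝓝 0) :=
    Real.isLittleO_log_id_atTop.tendsto_div_nhds_zero
  have h2 : Tendsto (fun x : ℝ => (ξ + Real.log (α * β / (Nat.factorial k * d))) / x) atTop (𝓝 0) :=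
    tendsto_const_nhds.div_atTop tendsto_id
  have h3 : Tendsto (fun x : ℝ => 1 + ((k : ℝ) - 1) * (Real.log x / x) +
      (ξ + Real.log (α * β / (Nat.factorial k * d))) / x) atTop (𝓝 (1 + ((k : ℝ) - 1) * 0 + 0)) :=
    (tendsto_const_nhds.add (h1.const_mul _)).add h2
  rw [mul_zero, add_zero, add_zero] at h3
  refine (h3.comp hl).congr' ?_
  filter_upwards [hl.eventually_gt_atTop 0] with s hs
  simp only [Function.comp_apply, meanLevel]
  field_simp
  ring

theorem tendsto_meanLevel : Tendsto (meanLevel d α β ξ k) atTop atTop := by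
  have h := (tendsto_meanLevel_div_log d α β ξ k).pos_mul_atTop one_pos Real.tendsto_log_atTop
  refine h.congr' ?_
  filter_upwards [Real.tendsto_log_atTop.eventually_gt_atTop 0] with s hs
  field_simp

variable {d} {α β}

theorem mul_exp_neg_meanLevel (hd : 0 < d) (hα : 0 < α) (hβ : 0 < β) {s : ℝ} (hs : 1 < s) :
    s * Real.exp (-meanLevel d α β ξ k s) =
      Real.log s ^ (1 - (k : ℝ)) * Real.exp (-ξ) * (Nat.factorial k / (α * β / d)) := by
  have hd' : (0 : ℝ) < d := by exact_mod_cast hd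
  have hk : (0 : ℝ) < Nat.factorial k := by exact_mod_cast Nat.factorial_pos k
  have hl : 0 < Real.log s := Real.log_pos hs
  rw [meanLevel, show -(Real.log s + ((k : ℝ) - 1) * Real.log (Real.log s) + ξ
    + Real.log (α * β / (Nat.factorial k * d))) = -Real.log s + Real.log (Real.log s) * (1 - k) +
    -ξ + -Real.log (α * β / (Nat.factorial k * d)) by ring, Real.exp_add, Real.exp_add, Real.exp_add,
    ← Real.rpow_def_of_pos hl, Real.exp_neg (Real.log s), Real.exp_log (by linarith),
    Real.exp_neg (Real.log (α * β / _)), Real.exp_log (by positivity)]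
  field_simp

/-- The power `(log s) ^ (1 - k)` is largest for `k = 0`; the factor 2 comes from `L ≥ log s / 2`.
This is the only trade of `s` for `exp L` in the error estimates. -/
theorem exists_mul_exp_neg_meanLevel_le (hd : 0 < d) (hα : 0 < α) (hβ : 0 < β) :
    ∃ C, 0 ≤ C ∧ ∀ᶠ s in atTop, s * Real.exp (-meanLevel d α β ξ k s) ≤
      C * meanLevel d α β ξ k s := by
  have hd' : (0 : ℝ) < d := by exact_mod_cast hd
  refine ⟨2 * (Real.exp (-ξ) * (Nat.factorial k / (α * β / d))), by positivity, ?_⟩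
  filter_upwards [eventually_gt_atTop 1, Real.tendsto_log_atTop.eventually_ge_atTop 1,
    (tendsto_meanLevel_div_log d α β ξ k).eventually (lt_mem_nhds (by norm_num : (1 / 2 : ℝ) < 1))]
    with s hs hl h
  rw [lt_div_iff₀ (by linarith)] at h
  rw [mul_exp_neg_meanLevel ξ k hd hα hβ hs]
  have h1 : Real.log s ^ (1 - (k : ℝ)) ≤ Real.log s := by
    simpa using Real.rpow_le_rpow_of_exponent_le hl
      (by linarith [(Nat.cast_nonneg k : (0 : ℝ) ≤ k)] : 1 - (k : ℝ) ≤ 1)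
  have h2 : Real.log s ^ (1 - (k : ℝ)) ≤ 2 * meanLevel d α β ξ k s := by linarith
  have h3 : 0 ≤ Real.exp (-ξ) * (Nat.factorial k / (α * β / d)) := by positivity
  calc Real.log s ^ (1 - (k : ℝ)) * Real.exp (-ξ) * (Nat.factorial k / (α * β / d))
      = Real.log s ^ (1 - (k : ℝ)) * (Real.exp (-ξ) * (Nat.factorial k / (α * β / d))) := by ring
    _ ≤ 2 * meanLevel d α β ξ k s * (Real.exp (-ξ) * (Nat.factorial k / (α * β / d))) :=
        mul_le_mul_of_nonneg_right h2 h3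
    _ = _ := by ring

variable {η : ℝ}

theorem scaling_eq (s : ℝ) : scaling d α β η ξ k s =
    (meanLevel d α β ξ k s / (c₀ d α β η * s)) ^ (1 / (d : ℝ)) := by
  rw [scaling, meanLevel]
  congr 1
  ring

theorem scaling_pos (hc : 0 < c₀ d α β η) {s : ℝ} (hs : 0 < s) (hL : 0 < meanLevel d α β ξ k s) :
    0 < scaling d α β η ξ k s := by
  rw [scaling_eq]
  positivity

theorem scaling_rpow (hd : 0 < d) (hc : 0 < c₀ d α β η) {s : ℝ} (hs : 0 < s)
    (hL : 0 < meanLevel d α β ξ k s) :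
    c₀ d α β η * s * scaling d α β η ξ k s ^ (d : ℝ) = meanLevel d α β ξ k s := by
  have hd' : (d : ℝ) ≠ 0 := by exact_mod_cast hd.ne'
  rw [scaling_eq, ← Real.rpow_mul (by positivity), one_div_mul_cancel hd', Real.rpow_one]
  field_simp

/-- The product is a constant times `L ^ (α / d) s ^ (1 - α / d)`, and `α > d`. -/
theorem tendsto_mul_scaling_rpow (hd : 0 < d) (hα : d < α) (hc : 0 < c₀ d α β η) :
    Tendsto (fun s => s * scaling d α β η ξ k s ^ α) atTop (𝓝 0) := by
  have hd' : (0 : ℝ) < d := by exact_mod_cast hd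
  have hq : 1 < α / d := (one_lt_div hd').2 hα
  have h1 : Tendsto (fun s : ℝ => Real.log s ^ (α / d) / s ^ (α / d - 1)) atTop (𝓝 0) :=
    (isLittleO_log_rpow_rpow_atTop (α / d) (by linarith : 0 < α / d - 1)).tendsto_div_nhds_zero
  have h2 : Tendsto (fun s => (meanLevel d α β ξ k s / Real.log s) ^ (α / d)) atTop
      (𝓝 ((1 : ℝ) ^ (α / d))) :=
    (tendsto_meanLevel_div_log d α β ξ k).rpow_const (Or.inl one_ne_zero)
  have h3 := (h1.mul h2).mul_const ((c₀ d α β η) ^ (-(α / d)))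
  rw [zero_mul, zero_mul] at h3
  refine h3.congr' ?_
  filter_upwards [eventually_gt_atTop 0, Real.tendsto_log_atTop.eventually_gt_atTop 0,
    (tendsto_meanLevel d α β ξ k).eventually_gt_atTop 0] with s hs hl hL
  rw [scaling_eq, ← Real.rpow_mul (by positivity), one_div_mul_eq_div, Real.div_rpow hL.le hl.le,
    Real.div_rpow hL.le (by positivity), Real.mul_rpow hc.le hs.le, Real.rpow_neg hc.le,
    Real.rpow_sub hs, Real.rpow_one]
  field_simp

theorem tendsto_scaling (hd : 0 < d) (hα : d < α) (hc : 0 < c₀ d α β η) :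
    Tendsto (fun s => scaling d α β η ξ k s) atTop (𝓝 0) := by
  have hd' : (0 : ℝ) < d := by exact_mod_cast hd
  have hα0 : 0 < α := hd'.trans hα
  have h1 := (tendsto_mul_scaling_rpow ξ k hd hα hc).rpow_const (p := 1 / α) (Or.inr (by positivity))
  rw [Real.zero_rpow (by positivity)] at h1
  refine squeeze_zero' ?_ ?_ h1
  · filter_upwards [eventually_gt_atTop 0, (tendsto_meanLevel d α β ξ k).eventually_gt_atTop 0] with s hs hL
    exact (scaling_pos ξ k hc hs hL).le
  · filter_upwards [eventually_ge_atTop 1, (tendsto_meanLevel d α β ξ k).eventually_gt_atTop 0] with s hs hL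
    have hr := scaling_pos ξ k hc (by linarith) hL
    calc scaling d α β η ξ k s = (scaling d α β η ξ k s ^ α) ^ (1 / α) := by
          rw [← Real.rpow_mul hr.le, mul_one_div_cancel hα0.ne', Real.rpow_one]
      _ ≤ (s * scaling d α β η ξ k s ^ α) ^ (1 / α) := by
          refine Real.rpow_le_rpow (by positivity) (le_mul_of_one_le_left (by positivity) hs)
            (by positivity)

end Scaling

/-! ### The Laplace integral over the weights -/

section Laplace

open Set

/-- The Laplace-type integral governing the expected number of vertices of degree `k`. -/
theorem integral_poissonMass_paretoMeasure {β p L : ℝ} (hβ : 0 < β) (hp : 0 < p) (hL : 0 < L)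
    (k : ℕ) :
    ∫ w, poissonMass k (w ^ p * L) ∂paretoMeasure 1 β =
      L ^ ((k : ℝ) - 1) * Real.exp (-L) * (β / p / Nat.factorial k) *
        ∫ t in Ioi (0 : ℝ), (1 + t / L) ^ (k - β / p - 1) * Real.exp (-t) := by
  rw [integral_paretoMeasure hβ, ← integral_const_mul]
  -- The substitution `t = (w ^ p - 1) L` turns the mean `w ^ p L` into `L + t`, which splits off
  -- `exp (-L)`.
  set f : ℝ → ℝ := fun w => (w ^ p - 1) * L with hf
  have hder : ∀ w ∈ Ioi (1 : ℝ), HasDerivWithinAt f (p * w ^ (p - 1) * L) (Ioi 1) w := by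
    intro w hw
    have hw0 : (0 : ℝ) < w := zero_lt_one.trans hw
    exact (((Real.hasDerivAt_rpow_const (Or.inl hw0.ne')).sub_const 1).mul_const L).hasDerivWithinAt
  have hinj : InjOn f (Ioi 1) := by
    intro a ha b hb hab
    have ha0 : (0 : ℝ) < a := zero_lt_one.trans ha
    have hb0 : (0 : ℝ) < b := zero_lt_one.trans hb
    have h1 : a ^ p = b ^ p := by
      have := mul_right_cancel₀ hL.ne' hab
      linarith
    exact (Real.rpow_left_inj ha0.le hb0.le hp.ne').1 h1
  have himg : f '' Ioi 1 = Ioi 0 := by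
    ext t
    constructor
    · rintro ⟨w, hw, rfl⟩
      have : 1 < w ^ p := Real.one_lt_rpow hw hp
      exact mul_pos (by linarith) hL
    · intro ht
      have ht : 0 < t := ht
      have h1 : 1 < 1 + t / L := by
        have : 0 < t / L := by positivity
        linarith
      refine ⟨(1 + t / L) ^ (1 / p), Real.one_lt_rpow h1 (by positivity), ?_⟩
      simp only [hf]
      rw [← Real.rpow_mul (by linarith), one_div_mul_cancel hp.ne', Real.rpow_one]
      field_simp
      ring
  rw [← himg, integral_image_eq_integral_abs_deriv_smul measurableSet_Ioi hder hinj]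
  refine setIntegral_congr_fun measurableSet_Ioi fun w hw => ?_
  have hw0 : (0 : ℝ) < w := zero_lt_one.trans hw
  have hu : 0 < w ^ p := by positivity
  simp only [hf, smul_eq_mul]
  rw [abs_of_nonneg (by positivity), mul_div_cancel_right₀ _ hL.ne', add_sub_cancel,
    show -((w ^ p - 1) * L) = L + -(w ^ p * L) by ring, Real.exp_add, Real.exp_neg L, poissonMass,
    mul_pow, Real.rpow_sub hL, Real.rpow_one, Real.rpow_natCast, Real.rpow_sub hu, Real.rpow_sub hu,
    Real.rpow_one, Real.rpow_natCast, ← Real.rpow_mul hw0.le p (β / p), mul_div_cancel₀ _ hp.ne',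
    Real.rpow_neg hw0.le, Real.rpow_add hw0, Real.rpow_one, Real.rpow_sub hw0, Real.rpow_one]
  field_simp

/-- For `q ≤ 0` the integrand is dominated by `exp (-t)`. -/
theorem tendsto_laplace {q : ℝ} (hq : q ≤ 0) :
    Tendsto (fun L : ℝ => ∫ t in Ioi (0 : ℝ), (1 + t / L) ^ q * Real.exp (-t)) atTop (𝓝 1) := by
  suffices h : Tendsto (fun L : ℝ => ∫ t in Ioi (0 : ℝ), (1 + t / L) ^ q * Real.exp (-t)) atTop
      (𝓝 (∫ t in Ioi (0 : ℝ), Real.exp (-t))) by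
    rwa [integral_exp_neg_Ioi_zero] at h
  refine tendsto_integral_filter_of_dominated_convergence (fun t => Real.exp (-t)) ?_ ?_ ?_ ?_
  · exact Eventually.of_forall fun L => (by fun_prop : Measurable fun t : ℝ =>
      (1 + t / L) ^ q * Real.exp (-t)).aestronglyMeasurable
  · filter_upwards [eventually_gt_atTop 0] with L hL
    filter_upwards [ae_restrict_mem measurableSet_Ioi] with t ht
    have ht : 0 < t := ht
    have h2 : 1 ≤ 1 + t / L := by
      have : 0 < t / L := by positivity
      linarith
    rw [Real.norm_of_nonneg (by positivity)]
    exact mul_le_of_le_one_left (Real.exp_pos _).le (Real.rpow_le_one_of_one_le_of_nonpos h2 hq)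
  · exact integrableOn_exp_neg_Ioi 0
  · refine Eventually.of_forall fun t => ?_
    have h2 : Tendsto (fun L : ℝ => 1 + t / L) atTop (𝓝 (1 + 0)) :=
      tendsto_const_nhds.add (tendsto_const_nhds.div_atTop tendsto_id)
    rw [add_zero] at h2
    have h3 := (h2.rpow_const (p := q) (Or.inl one_ne_zero)).mul_const (Real.exp (-t))
    simpa using h3

end Laplace


/-! ### Stability of the Poisson mass in its mean -/

section Perturbation

/-- The error is relative to `poissonMass k m`, so after integration it multiplies a convergent
quantity. -/
theorem abs_poissonMass_sub_le (k : ℕ) {m F e L : ℝ} (hL : 0 < L) (he : 0 ≤ e) (heL : e ≤ L)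
    (hLm : L ≤ m) (h1 : m - e ≤ F) (h2 : F ≤ m) :
    |poissonMass k F - poissonMass k m| ≤
      ((Real.exp e - 1) + (1 - (1 - e / L) ^ k)) * poissonMass k m := by
  have hm : 0 < m := hL.trans_le hLm
  have hF : 0 ≤ F := by linarith
  have hq0 : 0 ≤ 1 - e / L := by rw [sub_nonneg]; exact (div_le_one hL).2 heL
  have hq1 : 1 - e / L ≤ 1 := by
    have : 0 ≤ e / L := by positivity
    linarith
  have hpm := poissonMass_nonneg k hm.le
  have hfac : (0 : ℝ) < (Nat.factorial k : ℝ) := by exact_mod_cast Nat.factorial_pos k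
  have up : poissonMass k F ≤ Real.exp e * poissonMass k m := by
    unfold poissonMass
    rw [mul_div_assoc', ← mul_assoc, ← Real.exp_add]
    gcongr
    linarith
  have hmF : m * (1 - e / L) ≤ F := by
    have : e / m ≤ e / L := by gcongr
    have h3 : e ≤ m * (e / L) := by
      calc e = m * (e / m) := by field_simp
        _ ≤ m * (e / L) := by gcongr
    linarith
  have low : (1 - e / L) ^ k * poissonMass k m ≤ poissonMass k F := by
    unfold poissonMass
    calc (1 - e / L) ^ k * (Real.exp (-m) * m ^ k / (Nat.factorial k))
        = Real.exp (-m) * (m * (1 - e / L)) ^ k / (Nat.factorial k) := by rw [mul_pow]; ring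
      _ ≤ _ := by gcongr
  have he1 : 0 ≤ Real.exp e - 1 := by linarith [Real.add_one_le_exp e]
  have hq2 : 0 ≤ 1 - (1 - e / L) ^ k := by linarith [pow_le_one₀ (n := k) hq0 hq1]
  have t1 := mul_nonneg he1 hpm
  have t2 := mul_nonneg hq2 hpm
  rw [abs_le]
  constructor <;> nlinarith

/-- For heavy points no comparison of the means is needed: both masses are small, by
`poissonMass_le` with `θ = 1 / 2`. -/
theorem abs_poissonMass_sub_le_exp (k : ℕ) {m F a : ℝ} (ha : 0 ≤ a) (h1 : a ≤ F) (h2 : F ≤ m) :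
    |poissonMass k F - poissonMass k m| ≤ 2 ^ k * Real.exp (-(a / 2)) := by
  have hb : ∀ {x : ℝ}, a ≤ x → poissonMass k x ≤ 2 ^ k * Real.exp (-(a / 2)) := by
    intro x hx
    refine (poissonMass_le k (ha.trans hx) (one_half_pos)).trans ?_
    rw [one_div, inv_inv]
    gcongr
    linarith
  have h3 := hb h1
  have h4 := hb (h1.trans h2)
  have h5 := poissonMass_nonneg k (ha.trans h1)
  have h6 := poissonMass_nonneg k (ha.trans (h1.trans h2))
  rw [abs_le]
  constructor <;> linarith

end Perturbation

/-! ### The expected number of vertices of degree `k` -/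

section FirstMoment

variable {d : ℕ} {α β η : ℝ} (hd : 0 < d) (hα : d < α) (hη : 0 < η) (hβ : 1 < β)

/-- The rate of the correction to the mean degree due to the boundedness of the torus. -/
def tailRate (d : ℕ) (α β η : ℝ) : ℝ := tailConst d α * η * (β / (β - 1))

include hβ hη in
theorem tailRate_nonneg : 0 ≤ tailRate d α β η := by
  have := tailConst_nonneg d α
  have : 0 < β / (β - 1) := div_pos (by linarith) (by linarith)
  unfold tailRate
  positivity

include hd hα hη hβ

/-- The lower bound is not monotone in the weight, as its error grows linearly. Since `joinProb` is
monotone, it may be evaluated at any smaller weight `w`, which keeps the error bounded for heavy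
points. -/
theorem le_mul_joinProb {s r : ℝ} (hs : 0 ≤ s) (hr : 0 < r) {x : WPoint d} {w : ℝ} (h1 : 1 ≤ w)
    (hw : w ≤ max x.2 1) :
    w ^ ((d : ℝ) / α) * (c₀ d α β η * s * r ^ (d : ℝ)) - tailRate d α β η * w * (s * r ^ α) ≤
      s * joinProb (pointLaw d β) (connectPos α η r) x := by
  have h2 := le_joinProb_connectPos hd hα hη.le hβ hr ((x.1, w) : WPoint d)
  have h3 := joinProb_connectPos_mono α hη.le (by linarith : 0 < β) hr
    (x := ((x.1, w) : WPoint d)) (y := x) (by simpa [max_eq_left h1] using hw)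
  simp only [max_eq_left h1] at h2
  have h4 := mul_le_mul_of_nonneg_left (h2.trans h3) hs
  refine le_trans (le_of_eq ?_) h4
  rw [tailRate]
  ring

theorem mul_joinProb_le {s r : ℝ} (hs : 0 ≤ s) (hr : 0 < r) (x : WPoint d) :
    s * joinProb (pointLaw d β) (connectPos α η r) x ≤
      max x.2 1 ^ ((d : ℝ) / α) * (c₀ d α β η * s * r ^ (d : ℝ)) := by
  refine (mul_le_mul_of_nonneg_left (joinProb_connectPos_le hd hα hη.le hβ hr x) hs).trans
    (le_of_eq ?_)
  ring

theorem abs_poissonMass_joinProb_sub_le (k : ℕ) {s r K L : ℝ} (hs : 0 ≤ s) (hr : 0 < r) (hK : 1 ≤ K)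
    (hKp : K ^ ((d : ℝ) / α) = 3) (hL : 1 ≤ L) (hLe : c₀ d α β η * s * r ^ (d : ℝ) = L)
    (he : tailRate d α β η * K * (s * r ^ α) ≤ 1) (x : WPoint d) :
    |poissonMass k (s * joinProb (pointLaw d β) (connectPos α η r) x) -
        poissonMass k (max x.2 1 ^ ((d : ℝ) / α) * L)| ≤
      ((Real.exp (tailRate d α β η * K * (s * r ^ α)) - 1) +
        (1 - (1 - tailRate d α β η * K * (s * r ^ α) / L) ^ k)) *
          poissonMass k (max x.2 1 ^ ((d : ℝ) / α) * L) + 2 ^ k * Real.exp (-((3 * L - 1) / 2)) := by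
  have hα0 : 0 < α := (Nat.cast_nonneg d).trans_lt hα
  have hT := tailRate_nonneg (d := d) (α := α) hη hβ
  have hw := one_le_max_one x.2
  have hup := mul_joinProb_le hd hα hη hβ hs hr x
  rw [hLe] at hup
  have he0 : 0 ≤ tailRate d α β η * K * (s * r ^ α) := by positivity
  have hwp : 1 ≤ max x.2 1 ^ ((d : ℝ) / α) := Real.one_le_rpow hw (by positivity)
  have hwL : L ≤ max x.2 1 ^ ((d : ℝ) / α) * L := le_mul_of_one_le_left (by linarith) hwp
  rcases le_total (max x.2 1) K with h | h
  · have hlow := le_mul_joinProb hd hα hη hβ hs hr hw le_rfl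
    rw [hLe] at hlow
    have h5 : tailRate d α β η * max x.2 1 * (s * r ^ α) ≤ tailRate d α β η * K * (s * r ^ α) := by
      gcongr
    have h6 := abs_poissonMass_sub_le k (by linarith : 0 < L) he0 (by linarith) hwL
      (by linarith) hup
    have : 0 ≤ (2 : ℝ) ^ k * Real.exp (-((3 * L - 1) / 2)) := by positivity
    linarith
  · have hlow := le_mul_joinProb hd hα hη hβ hs hr hK h
    rw [hLe, hKp] at hlow
    have h6 := abs_poissonMass_sub_le_exp k (by linarith : 0 ≤ 3 * L - 1) (by linarith) hup
    have hq0 : 0 ≤ 1 - tailRate d α β η * K * (s * r ^ α) / L := by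
      rw [sub_nonneg]
      exact (div_le_one (by linarith)).2 (by linarith)
    have hq1 : 1 - tailRate d α β η * K * (s * r ^ α) / L ≤ 1 := by
      have : 0 ≤ tailRate d α β η * K * (s * r ^ α) / L := by positivity
      linarith
    have h7 := pow_le_one₀ (n := k) hq0 hq1
    have h8 : 1 ≤ Real.exp (tailRate d α β η * K * (s * r ^ α)) := Real.one_le_exp he0
    have h9 : 0 ≤ ((Real.exp (tailRate d α β η * K * (s * r ^ α)) - 1) +
        (1 - (1 - tailRate d α β η * K * (s * r ^ α) / L) ^ k)) *
          poissonMass k (max x.2 1 ^ ((d : ℝ) / α) * L) :=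
      mul_nonneg (by linarith) (poissonMass_nonneg k (by linarith))
    linarith

omit hd hα hη hβ in
theorem measurable_poissonMass (k : ℕ) : Measurable (poissonMass k) := by
  unfold poissonMass
  fun_prop

omit hd hα hη hβ in
theorem integrable_poissonMass_comp {Ω : Type*} [MeasurableSpace Ω] {P : Measure Ω}
    [IsProbabilityMeasure P] (k : ℕ) {f : Ω → ℝ} (hf : Measurable f) (h0 : ∀ x, 0 ≤ f x) :
    Integrable (fun x => poissonMass k (f x)) P := by
  refine Integrable.of_bound (C := 1) ((measurable_poissonMass k).comp hf).aestronglyMeasurable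
    (Eventually.of_forall fun x => ?_)
  rw [Real.norm_of_nonneg (poissonMass_nonneg k (h0 x))]
  exact poissonMass_le_one k (h0 x)

omit hd hα hη in
theorem integral_poissonMass_max (k : ℕ) (p L : ℝ) :
    ∫ x : WPoint d, poissonMass k (max x.2 1 ^ p * L) ∂pointLaw d β =
      ∫ w, poissonMass k (w ^ p * L) ∂paretoMeasure 1 β := by
  have hP' : IsProbabilityMeasure (paretoMeasure 1 β) :=
    isProbabilityMeasure_paretoMeasure one_pos (by linarith)
  have hm : Measurable fun w : ℝ => poissonMass k (max w 1 ^ p * L) :=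
    (measurable_poissonMass k).comp (by fun_prop)
  have h := (measurePreserving_snd (μ := uniformCube d)
    (ν := paretoMeasure 1 β)).integral_comp_of_measurable hm
  refine h.trans (integral_congr_ae ?_)
  filter_upwards [ae_max_one_eq β] with w hw
  rw [hw]

theorem abs_mul_integral_sub_le (k : ℕ) {s r K L : ℝ} (hs : 0 ≤ s) (hr : 0 < r) (hK : 1 ≤ K)
    (hKp : K ^ ((d : ℝ) / α) = 3) (hL : 1 ≤ L) (hLe : c₀ d α β η * s * r ^ (d : ℝ) = L)
    (he : tailRate d α β η * K * (s * r ^ α) ≤ 1) :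
    |s * ∫ x, poissonMass k (s * joinProb (pointLaw d β) (connectPos α η r) x) ∂pointLaw d β -
        s * ∫ w, poissonMass k (w ^ ((d : ℝ) / α) * L) ∂paretoMeasure 1 β| ≤
      ((Real.exp (tailRate d α β η * K * (s * r ^ α)) - 1) +
        (1 - (1 - tailRate d α β η * K * (s * r ^ α) / L) ^ k)) *
          (s * ∫ w, poissonMass k (w ^ ((d : ℝ) / α) * L) ∂paretoMeasure 1 β) +
        2 ^ k * (s * Real.exp (-((3 * L - 1) / 2))) := by
  have hβ0 : 0 < β := by linarith
  have hP : IsProbabilityMeasure (pointLaw d β) := isProbabilityMeasure_pointLaw d hβ0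
  have hg0 := connectPos_nonneg (d := d) α hη.le hr.le
  have hjm : Measurable fun x => joinProb (pointLaw d β) (connectPos α η r) x :=
    ((measurable_connectPos d α η r).stronglyMeasurable.integral_prod_right
      (ν := pointLaw d β)).measurable
  have i1 := integrable_poissonMass_comp (P := pointLaw d β) k (hjm.const_mul s)
    fun x => mul_nonneg hs (joinProb_nonneg hg0 x)
  have i2 := integrable_poissonMass_comp (P := pointLaw d β) k
    (f := fun x : WPoint d => max x.2 1 ^ ((d : ℝ) / α) * L) (by fun_prop)
    fun x => by
      have := max_one_pos x.2
      positivity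
  rw [← integral_poissonMass_max hβ, ← mul_sub, ← integral_sub i1 i2, abs_mul, abs_of_nonneg hs]
  have h1 := (abs_integral_le_integral_abs (f := fun x : WPoint d =>
    poissonMass k (s * joinProb (pointLaw d β) (connectPos α η r) x) -
      poissonMass k (max x.2 1 ^ ((d : ℝ) / α) * L)) (μ := pointLaw d β)).trans
    (integral_mono (i1.sub i2).abs ((i2.const_mul _).add (integrable_const _))
      (abs_poissonMass_joinProb_sub_le hd hα hη hβ k hs hr hK hKp hL hLe he))
  rw [integral_add' (i2.const_mul _) (integrable_const _), integral_const_mul, integral_const,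
    probReal_univ, one_smul] at h1
  refine (mul_le_mul_of_nonneg_left h1 hs).trans (le_of_eq ?_)
  ring

end FirstMoment

/-! ### Limit of the first moment -/

section FirstMomentLimit

variable {d : ℕ} {α β η : ℝ} (ξ : ℝ) (k : ℕ) (hd : 0 < d) (hα : d < α) (hη : 0 < η) (hβ : 1 < β)

include hd hα hβ in
theorem tendsto_mul_integral_poissonMass (hk : ((k : ℝ) + 1) * d < α * β) :
    Tendsto (fun s => s * ∫ w, poissonMass k (w ^ ((d : ℝ) / α) * meanLevel d α β ξ k s)
      ∂paretoMeasure 1 β) atTop (𝓝 (Real.exp (-ξ))) := by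
  have hd' : (0 : ℝ) < d := by exact_mod_cast hd
  have hα0 : 0 < α := hd'.trans hα
  have hβ0 : 0 < β := by linarith
  have hfac : (0 : ℝ) < (Nat.factorial k : ℝ) := by exact_mod_cast Nat.factorial_pos k
  have hγ : β / (d / α) = α * β / d := by field_simp
  -- Nonpositivity of this exponent gives the dominating function of the Laplace limit.
  have hq : (k : ℝ) - β / (d / α) - 1 ≤ 0 := by
    rw [hγ]
    have := (lt_div_iff₀ hd').2 hk
    linarith
  have h1 := (tendsto_laplace hq).comp (tendsto_meanLevel d α β ξ k)
  have h2 := ((tendsto_meanLevel_div_log d α β ξ k).rpow_const (p := (k : ℝ) - 1)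
    (Or.inl one_ne_zero)).mul_const (Real.exp (-ξ))
  have h3 := h2.mul h1
  rw [Real.one_rpow, one_mul, mul_one] at h3
  refine h3.congr' ?_
  filter_upwards [eventually_gt_atTop 1, (tendsto_meanLevel d α β ξ k).eventually_gt_atTop 0] with s hs hL
  have hl : 0 < Real.log s := Real.log_pos hs
  rw [integral_poissonMass_paretoMeasure hβ0 (by positivity) hL]
  have h4 := mul_exp_neg_meanLevel ξ k hd hα0 hβ0 hs
  have h5 : Real.log s ^ (1 - (k : ℝ)) = (Real.log s ^ ((k : ℝ) - 1))⁻¹ := by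
    rw [← Real.rpow_neg hl.le]
    congr 1
    ring
  rw [h5] at h4
  simp only [Function.comp_apply]
  set I := ∫ t in Set.Ioi (0 : ℝ), (1 + t / meanLevel d α β ξ k s) ^ ((k : ℝ) - β / (d / α) - 1) *
    Real.exp (-t)
  rw [Real.div_rpow hL.le hl.le, show ∀ a b c : ℝ, s * (a * b * c * I) = (s * b) * a * c * I from
    fun a b c => by ring, h4, hγ]
  field_simp

include hd hα hη hβ in
theorem tendsto_mul_integral_joinProb (hk : ((k : ℝ) + 1) * d < α * β) :
    Tendsto (fun s => s * ∫ x, poissonMass k (s * joinProb (pointLaw d β)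
      (connectPos α η (scaling d α β η ξ k s)) x) ∂pointLaw d β) atTop (𝓝 (Real.exp (-ξ))) := by
  have hd' : (0 : ℝ) < d := by exact_mod_cast hd
  have hα0 : 0 < α := hd'.trans hα
  have hβ0 : 0 < β := by linarith
  have hc := c₀_pos hd hα hβ hη
  -- At this weight the whole-space mean degree is `3 L`, and half of it still beats `s`, since `s
  -- exp (-3 L / 2) → 0`.
  set K : ℝ := 3 ^ (α / d) with hK
  have hK1 : 1 ≤ K := Real.one_le_rpow (by norm_num) (by positivity)
  have hKp : K ^ ((d : ℝ) / α) = 3 := by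
    rw [hK, ← Real.rpow_mul (by norm_num), div_mul_div_cancel₀ hd'.ne', div_self hα0.ne',
      Real.rpow_one]
  have hLt := tendsto_meanLevel d α β ξ k
  have hB := tendsto_mul_integral_poissonMass ξ k hd hα hβ hk
  have hδ := (tendsto_mul_scaling_rpow (η := η) ξ k hd hα hc).const_mul (tailRate d α β η * K)
  rw [mul_zero] at hδ
  have hζ : Tendsto (fun s => (Real.exp (tailRate d α β η * K *
      (s * scaling d α β η ξ k s ^ α)) - 1) + (1 - (1 - tailRate d α β η * K *
      (s * scaling d α β η ξ k s ^ α) / meanLevel d α β ξ k s) ^ k)) atTop (𝓝 0) := by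
    have h1 := ((Real.continuous_exp.tendsto 0).comp hδ).sub_const 1
    have h2 := (((hδ.div_atTop hLt).const_sub 1).pow k).const_sub 1
    simpa using h1.add h2
  have hexp : Tendsto (fun s => s * Real.exp (-((3 * meanLevel d α β ξ k s - 1) / 2))) atTop
      (𝓝 0) := by
    obtain ⟨C, hC, hCs⟩ := exists_mul_exp_neg_meanLevel_le ξ k hd hα0 hβ0
    have h1 := (((tendsto_rpow_mul_exp_neg_mul_atTop_nhds_zero 1 (1 / 2) one_half_pos).comp
      hLt).const_mul (C * Real.exp (1 / 2)))
    rw [mul_zero] at h1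
    refine squeeze_zero' ?_ ?_ h1
    · filter_upwards [eventually_ge_atTop 0] with s hs
      positivity
    · filter_upwards [hCs] with s hs
      simp only [Function.comp_apply, Real.rpow_one]
      set L := meanLevel d α β ξ k s
      calc s * Real.exp (-((3 * L - 1) / 2))
          = s * Real.exp (-L) * (Real.exp (-(1 / 2) * L) * Real.exp (1 / 2)) := by
            rw [mul_assoc, ← Real.exp_add, ← Real.exp_add]
            congr 2
            ring
        _ ≤ C * L * (Real.exp (-(1 / 2) * L) * Real.exp (1 / 2)) :=
            mul_le_mul_of_nonneg_right hs (by positivity)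
        _ = _ := by ring
  have hbd := (hζ.mul hB).add (hexp.const_mul (2 ^ k))
  rw [zero_mul, mul_zero, add_zero] at hbd
  have hdiff : Tendsto (fun s => s * ∫ x, poissonMass k (s * joinProb (pointLaw d β)
      (connectPos α η (scaling d α β η ξ k s)) x) ∂pointLaw d β -
      s * ∫ w, poissonMass k (w ^ ((d : ℝ) / α) * meanLevel d α β ξ k s) ∂paretoMeasure 1 β)
      atTop (𝓝 0) := by
    refine squeeze_zero_norm' ?_ hbd
    filter_upwards [eventually_gt_atTop 0, hLt.eventually_ge_atTop 1,
      hδ.eventually (ge_mem_nhds one_pos)] with s hs hL he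
    have hL0 : 0 < meanLevel d α β ξ k s := by linarith
    exact abs_mul_integral_sub_le hd hα hη hβ k hs.le (scaling_pos ξ k hc hs hL0) hK1 hKp hL
      (scaling_rpow ξ k hd hc hs hL0) he
  simpa using hdiff.add hB

end FirstMomentLimit


/-! ### The pair integral -/

section PairBound

variable {d : ℕ} {α β η : ℝ}

/-- A constant bounding the probability that a random point is joined to both of two distant points
of weight at most `K`. -/
def jointConst (d : ℕ) (α β η K : ℝ) : ℝ :=
  2 * 2 ^ (d : ℝ) * (η * K) ^ ((d : ℝ) / α) * (η * K) ^ ((d : ℝ) / α) *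
    (unitBallVolume d * Real.Gamma (1 - d / α)) * (β / (β - 2 * (d / α)))

/-- The bound for pairs of points of which one is heavy, or which are distant. -/
def farBound (d : ℕ) (α β η K : ℝ) (k : ℕ) (L q : ℝ) : ℝ :=
  L ^ (2 * k) * (Real.exp (4 - 3 * L) + ((η * K * K) ^ ((d : ℝ) / α) +
    jointConst d α β η K / c₀ d α β η * L) * q * Real.exp (5 - 2 * L))

/-- The bound for pairs of nearby points, with excess constant `e`. -/
def nearBound (k : ℕ) (L e : ℝ) : ℝ := L ^ (2 * k) * Real.exp (2 + e - (1 + e) * L)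

variable (hd : 0 < d) (hα : d < α) (hη : 0 < η) (hβ : 1 < β) (hp : 2 * (d / α) < β)

include hd hα hη hβ hp

omit hd in
theorem jointConst_nonneg {K : ℝ} (hK : 0 < K) : 0 ≤ jointConst d α β η K := by
  have hα0 : 0 < α := (Nat.cast_nonneg d).trans_lt hα
  have hp1 : d / α < 1 := (div_lt_one hα0).2 hα
  have hV := unitBallVolume_pos d
  have hG : 0 < Real.Gamma (1 - d / α) := Real.Gamma_pos_of_pos (by linarith)
  have hB : 0 < β / (β - 2 * (d / α)) := div_pos (by linarith) (by linarith)
  unfold jointConst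
  positivity

/-- The mean `M` of the joint neighbourhood is bounded below in three regimes: by `3 L - 1` if a
point is heavy, by `(1 + e) L - 1` if both are light and close, and by `2 L - 3` if both are light
and far apart. In the last case the minimum is also small. -/
theorem pairBound_connectPos_le (k : ℕ) {s r K L ρ e : ℝ} (hs : 0 ≤ s) (hr : 0 < r)
    (hr' : 2 * r ≤ 1 / 2) (hK : 1 ≤ K) (hKp : K ^ ((d : ℝ) / α) = 3) (hL : 1 ≤ L)
    (hLe : c₀ d α β η * s * r ^ (d : ℝ) = L) (hδ : tailRate d α β η * K * (s * r ^ α) ≤ 1)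
    (hρ : 0 < ρ) (he : e = excessConst d α β η K / c₀ d α β η)
    (hfar : jointConst d α β η K / c₀ d α β η * L * (r / ρ) ^ (d : ℝ) ≤ 1) (x y : WPoint d) :
    pairBound (pointLaw d β) (connectPos α η r) s k (1 / L) x y ≤
      farBound d α β η K k L ((r / ρ) ^ (d : ℝ)) +
        {y : WPoint d | torusDist x.1 y.1 < ρ}.indicator (fun _ => nearBound k L e) y := by
  have hβ0 : 0 < β := by linarith
  have hK0 : 0 < K := by linarith
  have hL0 : 0 < L := by linarith
  have hα0 : 0 < α := (Nat.cast_nonneg d).trans_lt hα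
  have hP : IsProbabilityMeasure (pointLaw d β) := isProbabilityMeasure_pointLaw d hβ0
  have hg0 := connectPos_nonneg (d := d) α hη.le hr.le
  have hg1 := connectPos_le_one (d := d) α η r
  have hc := c₀_pos hd hα hβ hη
  have hC := jointConst_nonneg hα hη hβ hp hK0
  have hT := tailRate_nonneg (d := d) (α := α) hη hβ
  have he0 : 0 < e := he ▸ div_pos (excessConst_pos d hη hβ0) hc
  have hnear : 0 ≤ nearBound k L e := by unfold nearBound; positivity
  have hind : 0 ≤ {y : WPoint d | torusDist x.1 y.1 < ρ}.indicator (fun _ => nearBound k L e) y :=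
    Set.indicator_nonneg (fun _ _ => hnear) y
  have hjle : ∀ x y : WPoint d, jointProb (pointLaw d β) (connectPos α η r) x y ≤
      joinProb (pointLaw d β) (connectPos α η r) y := fun x y =>
    integral_mono (integrable_g_mul_g _ (measurable_connectPos d α η r) hg0 hg1 x y)
      (integrable_g _ (measurable_connectPos d α η r) hg0 hg1 y)
      fun z => mul_le_of_le_one_left (hg0 y z) (hg1 x z)
  have hjcomm : ∀ x y : WPoint d, jointProb (pointLaw d β) (connectPos α η r) x y =
      jointProb (pointLaw d β) (connectPos α η r) y x := fun x y =>
    integral_congr_ae (Eventually.of_forall fun z => mul_comm _ _)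
  have hone : ∀ x : WPoint d, L - 1 ≤ s * joinProb (pointLaw d β) (connectPos α η r) x := by
    intro x
    have h1 := le_mul_joinProb hd hα hη hβ hs hr le_rfl (one_le_max_one x.2)
    rw [Real.one_rpow, hLe, one_mul, mul_one] at h1
    have h2 : tailRate d α β η * (s * r ^ α) ≤ tailRate d α β η * K * (s * r ^ α) := by
      rw [mul_right_comm]
      exact le_mul_of_one_le_right (by positivity) hK
    linarith
  have hheavy : ∀ x : WPoint d, K ≤ max x.2 1 →
      3 * L - 1 ≤ s * joinProb (pointLaw d β) (connectPos α η r) x := by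
    intro x hx
    have h1 := le_mul_joinProb hd hα hη hβ hs hr hK hx
    rw [hKp, hLe] at h1
    linarith
  have hjx := mul_le_mul_of_nonneg_left (hjle x y) hs
  have hjy := mul_le_mul_of_nonneg_left (hjle y x) hs
  rw [← hjcomm x y] at hjy
  have hJ0 : 0 ≤ s * jointProb (pointLaw d β) (connectPos α η r) x y :=
    mul_nonneg hs (jointProb_nonneg hg0 x y)
  have hθ : 0 ≤ 1 - 1 / L := by
    rw [sub_nonneg]
    exact (div_le_one hL0).2 hL
  have hinv : 0 ≤ 1 / L := by positivity
  have hLinv : 1 / L * L = 1 := one_div_mul_cancel hL0.ne'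
  unfold pairBound
  rw [one_div, inv_inv, ← one_div]
  set M := s * (joinProb (pointLaw d β) (connectPos α η r) x +
    joinProb (pointLaw d β) (connectPos α η r) y -
    jointProb (pointLaw d β) (connectPos α η r) x y) with hM
  have hM' : M = s * joinProb (pointLaw d β) (connectPos α η r) x +
    s * joinProb (pointLaw d β) (connectPos α η r) y -
    s * jointProb (pointLaw d β) (connectPos α η r) x y := by rw [hM]; ring
  -- With `θ = 1 / L` the loss of the factor `1 - θ` in the exponent is at most the constant `a`,
  -- while `θ⁻¹ ^ (2 k)` is only a power of `L`.
  have hexp : ∀ {a b : ℝ}, 0 ≤ b → a * L - b ≤ M →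
      Real.exp (-((1 - 1 / L) * M)) ≤ Real.exp (a + b - a * L) := by
    intro a b hb h1
    have h2 := mul_le_mul_of_nonneg_left h1 hθ
    have h3 : (1 - 1 / L) * (a * L - b) = a * L - b - a * (1 / L * L) + b * (1 / L) := by ring
    have h4 : 0 ≤ b * (1 / L) := by positivity
    rw [h3, hLinv] at h2
    exact Real.exp_le_exp.2 (by linarith)
  have hq : 0 ≤ (r / ρ) ^ (d : ℝ) := by positivity
  have hmin0 : 0 ≤ min 1 (connectPos α η r x y + s * jointProb (pointLaw d β)
      (connectPos α η r) x y) := le_min zero_le_one (add_nonneg (hg0 x y) hJ0)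
  have hmin1 : min 1 (connectPos α η r x y + s * jointProb (pointLaw d β)
      (connectPos α η r) x y) ≤ 1 := min_le_left _ _
  have hterm : 0 ≤ ((η * K * K) ^ ((d : ℝ) / α) + jointConst d α β η K / c₀ d α β η * L) *
      (r / ρ) ^ (d : ℝ) * Real.exp (5 - 2 * L) := by positivity
  by_cases hw : K ≤ max x.2 1 ∨ K ≤ max y.2 1
  · have hM3 : 3 * L - 1 ≤ M := by
      rcases hw with h | h
      · have := hheavy x h
        linarith
      · have := hheavy y h
        linarith
    have h1 := hexp zero_le_one hM3
    refine le_trans ?_ (le_add_of_nonneg_right hind)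
    calc _ ≤ 1 * (L ^ (2 * k) * Real.exp (3 + 1 - 3 * L)) := by gcongr
      _ = L ^ (2 * k) * (Real.exp (4 - 3 * L) + 0) := by
          rw [one_mul, add_zero]
          norm_num
      _ ≤ _ := by
          unfold farBound
          gcongr
  · rw [not_or, not_le, not_le] at hw
    obtain ⟨hx, hy⟩ := hw
    by_cases hxy : torusDist x.1 y.1 < ρ
    · have h1 := excessConst_mul_le hd hα0 hη.le hβ0 hr hr' (y := y) hx.le
      have h2 := mul_le_mul_of_nonneg_left h1 hs
      have h3 : s * (excessConst d α β η K * r ^ (d : ℝ)) = e * L := by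
        rw [he, ← hLe]
        field_simp
      have h4 := hone x
      -- The point `x` contributes at least `L - 1`, and the neighbours of `y` that avoid `x`
      -- contribute at least `e L`.
      have hMn : (1 + e) * L - 1 ≤ M := by linarith
      have h5 := hexp zero_le_one hMn
      rw [Set.indicator_of_mem (by exact hxy)]
      refine le_trans ?_ (le_add_of_nonneg_left (by unfold farBound; positivity))
      calc _ ≤ 1 * (L ^ (2 * k) * Real.exp (1 + e + 1 - (1 + e) * L)) := by gcongr
        _ = nearBound k L e := by rw [one_mul, nearBound, show 1 + e + 1 = 2 + e by ring]
    · rw [not_lt] at hxy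
      have h1 := jointProb_connectPos_le hd hα hη.le hβ0 hr hp hρ hxy hx.le hy.le
      have h2 := mul_le_mul_of_nonneg_left h1 hs
      have h3 : s * (jointConst d α β η K * (r / ρ) ^ (d : ℝ) * r ^ (d : ℝ)) =
          jointConst d α β η K / c₀ d α β η * L * (r / ρ) ^ (d : ℝ) := by
        rw [← hLe]
        field_simp
      have h4 : s * jointProb (pointLaw d β) (connectPos α η r) x y ≤
          jointConst d α β η K / c₀ d α β η * L * (r / ρ) ^ (d : ℝ) := h2.trans_eq h3
      have h5 : connectPos α η r x y ≤ (η * K * K) ^ ((d : ℝ) / α) * (r / ρ) ^ (d : ℝ) := by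
        have := max_one_pos x.2
        have := max_one_pos y.2
        refine (connectPos_le_of_le_torusDist hd hα hη.le hr.le hρ hxy).trans ?_
        gcongr
      have h6 := hone x
      have h7 := hone y
      -- Each point contributes at least `L - 1`, and by `hfar` the common neighbours take away at
      -- most 1.
      have hMn : 2 * L - 3 ≤ M := by linarith
      have h8 := hexp (by norm_num) hMn
      refine le_trans ?_ (le_add_of_nonneg_right hind)
      have h9 : min 1 (connectPos α η r x y + s * jointProb (pointLaw d β)
          (connectPos α η r) x y) ≤ ((η * K * K) ^ ((d : ℝ) / α) +
            jointConst d α β η K / c₀ d α β η * L) * (r / ρ) ^ (d : ℝ) :=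
        (min_le_right _ _).trans (by linarith)
      calc _ ≤ ((η * K * K) ^ ((d : ℝ) / α) + jointConst d α β η K / c₀ d α β η * L) *
            (r / ρ) ^ (d : ℝ) * (L ^ (2 * k) * Real.exp (2 + 3 - 2 * L)) :=
            mul_le_mul h9 (by gcongr) (by positivity) (by positivity)
        _ = L ^ (2 * k) * (0 + ((η * K * K) ^ ((d : ℝ) / α) +
            jointConst d α β η K / c₀ d α β η * L) * (r / ρ) ^ (d : ℝ) * Real.exp (5 - 2 * L)) := by
            rw [show (2 + 3 : ℝ) = 5 by norm_num]
            ring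
        _ ≤ _ := by
            unfold farBound
            gcongr
            positivity

theorem lintegral_pairBound_le (k : ℕ) {s r K L ρ e : ℝ} (hs : 0 ≤ s) (hr : 0 < r)
    (hr' : 2 * r ≤ 1 / 2) (hK : 1 ≤ K) (hKp : K ^ ((d : ℝ) / α) = 3) (hL : 1 ≤ L)
    (hLe : c₀ d α β η * s * r ^ (d : ℝ) = L) (hδ : tailRate d α β η * K * (s * r ^ α) ≤ 1)
    (hρ : 0 < ρ) (he : e = excessConst d α β η K / c₀ d α β η)
    (hfar : jointConst d α β η K / c₀ d α β η * L * (r / ρ) ^ (d : ℝ) ≤ 1) :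
    ∫⁻ x, ∫⁻ y, ENNReal.ofReal (s ^ 2 *
        pairBound (pointLaw d β) (connectPos α η r) s k (1 / L) x y) ∂pointLaw d β ∂pointLaw d β ≤
      ENNReal.ofReal (s ^ 2 * farBound d α β η K k L ((r / ρ) ^ (d : ℝ)) +
        s ^ 2 * nearBound k L e * (unitBallVolume d * ρ ^ (d : ℝ))) := by
  have hβ0 : 0 < β := by linarith
  have hK0 : 0 < K := by linarith
  have hP' : IsProbabilityMeasure (paretoMeasure 1 β) :=
    isProbabilityMeasure_paretoMeasure one_pos hβ0
  have hP : IsProbabilityMeasure (pointLaw d β) := isProbabilityMeasure_pointLaw d hβ0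
  have hc := c₀_pos hd hα hβ hη
  have hC := jointConst_nonneg hα hη hβ hp hK0
  have hV := unitBallVolume_pos d
  have hF : 0 ≤ s ^ 2 * farBound d α β η K k L ((r / ρ) ^ (d : ℝ)) := by
    unfold farBound; positivity
  have hN : 0 ≤ s ^ 2 * nearBound k L e := by unfold nearBound; positivity
  have hinner : ∀ x : WPoint d, ∫⁻ y, ENNReal.ofReal (s ^ 2 *
      pairBound (pointLaw d β) (connectPos α η r) s k (1 / L) x y) ∂pointLaw d β ≤
      ENNReal.ofReal (s ^ 2 * farBound d α β η K k L ((r / ρ) ^ (d : ℝ)) +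
        s ^ 2 * nearBound k L e * (unitBallVolume d * ρ ^ (d : ℝ))) := by
    intro x
    have hS : MeasurableSet {y : WPoint d | torusDist x.1 y.1 < ρ} :=
      measurableSet_lt (measurable_const.torusDist measurable_fst) measurable_const
    have hνS : pointLaw d β {y : WPoint d | torusDist x.1 y.1 < ρ} ≤
        ENNReal.ofReal (unitBallVolume d * ρ ^ (d : ℝ)) := by
      have e1 : {y : WPoint d | torusDist x.1 y.1 < ρ} =
          {y | torusDist x.1 y < ρ} ×ˢ (Set.univ : Set ℝ) := by
        ext y
        simp
      rw [e1, pointLaw, Measure.prod_prod, measure_univ, mul_one]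
      exact uniformCube_torusDist_lt_le x.1 hρ
    calc _ ≤ ∫⁻ y, (ENNReal.ofReal (s ^ 2 * farBound d α β η K k L ((r / ρ) ^ (d : ℝ))) +
          {y : WPoint d | torusDist x.1 y.1 < ρ}.indicator
            (fun _ => ENNReal.ofReal (s ^ 2 * nearBound k L e)) y) ∂pointLaw d β := by
          refine lintegral_mono fun y => ?_
          have h := mul_le_mul_of_nonneg_left (pairBound_connectPos_le hd hα hη hβ hp k hs hr hr' hK
            hKp hL hLe hδ hρ he hfar x y) (sq_nonneg s)
          refine (ENNReal.ofReal_le_ofReal h).trans ?_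
          rw [mul_add]
          refine ENNReal.ofReal_add_le.trans ?_
          gcongr
          by_cases hy : y ∈ {y : WPoint d | torusDist x.1 y.1 < ρ}
          · rw [Set.indicator_of_mem hy, Set.indicator_of_mem hy]
          · rw [Set.indicator_of_notMem hy, Set.indicator_of_notMem hy]
            simp
      _ ≤ ENNReal.ofReal (s ^ 2 * farBound d α β η K k L ((r / ρ) ^ (d : ℝ))) +
          ENNReal.ofReal (s ^ 2 * nearBound k L e) *
            ENNReal.ofReal (unitBallVolume d * ρ ^ (d : ℝ)) := by
          rw [lintegral_add_left measurable_const, lintegral_const, measure_univ, mul_one,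
            lintegral_indicator_const hS]
          gcongr
      _ = _ := by
          rw [← ENNReal.ofReal_mul hN, ← ENNReal.ofReal_add hF (by positivity)]
  refine (lintegral_mono hinner).trans ?_
  rw [lintegral_const, measure_univ, mul_one]

omit hd hα hη hβ hp in
theorem tendsto_pow_mul_exp_neg_mul (n : ℕ) {b : ℝ} (hb : 0 < b) :
    Tendsto (fun L : ℝ => L ^ n * Real.exp (-b * L)) atTop (𝓝 0) := by
  simpa using tendsto_rpow_mul_exp_neg_mul_atTop_nhds_zero n b hb

theorem exists_lintegral_pairBound_le (ξ : ℝ) (k : ℕ) :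
    ∃ ε : ℝ → ℝ, Tendsto ε atTop (𝓝 0) ∧ ∀ᶠ s in atTop, 0 ≤ ε s ∧
      ∫⁻ x, ∫⁻ y, ENNReal.ofReal (s ^ 2 * pairBound (pointLaw d β)
        (connectPos α η (scaling d α β η ξ k s)) s k (1 / meanLevel d α β ξ k s) x y)
          ∂pointLaw d β ∂pointLaw d β ≤ ENNReal.ofReal (ε s) := by
  have hd' : (0 : ℝ) < d := by exact_mod_cast hd
  have hα0 : 0 < α := hd'.trans hα
  have hβ0 : 0 < β := by linarith
  have hc := c₀_pos hd hα hβ hη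
  have hV := unitBallVolume_pos d
  obtain ⟨K, hK1, hKp⟩ : ∃ K : ℝ, 1 ≤ K ∧ K ^ ((d : ℝ) / α) = 3 := by
    refine ⟨3 ^ (α / d), Real.one_le_rpow (by norm_num) (by positivity), ?_⟩
    rw [← Real.rpow_mul (by norm_num), div_mul_div_cancel₀ hd'.ne', div_self hα0.ne',
      Real.rpow_one]
  obtain ⟨e, he⟩ : ∃ e, e = excessConst d α β η K / c₀ d α β η := ⟨_, rfl⟩
  have he0 : 0 < e := he ▸ div_pos (excessConst_pos d hη hβ0) hc
  have hC := jointConst_nonneg hα hη hβ hp (by linarith : 0 < K)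
  obtain ⟨C, hC0, hCs⟩ := exists_mul_exp_neg_meanLevel_le ξ k hd hα0 hβ0
  have hLt := tendsto_meanLevel d α β ξ k
  have hδ := (tendsto_mul_scaling_rpow (η := η) ξ k hd hα hc).const_mul (tailRate d α β η * K)
  rw [mul_zero] at hδ
  set C₁ := jointConst d α β η K / c₀ d α β η with hC₁
  have hC₁0 : 0 ≤ C₁ := by positivity
  set C₂ := (η * K * K) ^ ((d : ℝ) / α) with hC₂
  have hC₂0 : 0 ≤ C₂ := by positivity
  have hfarL : Tendsto (fun L : ℝ => C₁ * (L ^ 1 * Real.exp (-(e / 2) * L))) atTop (𝓝 0) := by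
    simpa using (tendsto_pow_mul_exp_neg_mul 1 (half_pos he0)).const_mul C₁
  have hH : Tendsto (fun L : ℝ =>
      C ^ 2 * Real.exp 4 * (L ^ (2 * k + 2) * Real.exp (-1 * L)) +
      C ^ 2 * Real.exp 5 * C₂ * (L ^ (2 * k + 2) * Real.exp (-(e / 2) * L)) +
      C ^ 2 * Real.exp 5 * C₁ * (L ^ (2 * k + 3) * Real.exp (-(e / 2) * L)) +
      C * (unitBallVolume d / c₀ d α β η) * Real.exp (2 + e) *
        (L ^ (2 * k + 2) * Real.exp (-(e / 2) * L))) atTop (𝓝 0) := by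
    have h1 := tendsto_pow_mul_exp_neg_mul (2 * k + 2) one_pos
    have h2 := tendsto_pow_mul_exp_neg_mul (2 * k + 2) (half_pos he0)
    have h3 := tendsto_pow_mul_exp_neg_mul (2 * k + 3) (half_pos he0)
    simpa using (((h1.const_mul (C ^ 2 * Real.exp 4)).add
      (h2.const_mul (C ^ 2 * Real.exp 5 * C₂))).add
      (h3.const_mul (C ^ 2 * Real.exp 5 * C₁))).add
      (h2.const_mul (C * (unitBallVolume d / c₀ d α β η) * Real.exp (2 + e)))
  refine ⟨_, hH.comp hLt, ?_⟩
  filter_upwards [eventually_gt_atTop 0, hLt.eventually_ge_atTop 1, hCs,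
    hδ.eventually (ge_mem_nhds one_pos),
    (tendsto_scaling (η := η) ξ k hd hα hc).eventually (ge_mem_nhds (by norm_num : (0 : ℝ) < 1 / 4)),
    (hfarL.comp hLt).eventually (ge_mem_nhds one_pos)] with s hs hL hsL hδ hr' hfar
  have hL0 : 0 < meanLevel d α β ξ k s := by linarith
  have hr := scaling_pos (η := η) ξ k hc hs hL0
  have hLe := scaling_rpow ξ k hd hc hs hL0
  simp only [Function.comp_apply] at hfar ⊢
  set L := meanLevel d α β ξ k s
  set r := scaling d α β η ξ k s
  -- This radius balances the regimes: far pairs gain `(r / ρ) ^ d = exp (-e L / 2)`, and near pairs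
  -- lose `exp (e L / 2)` in volume against their gain `exp (-e L)`.
  have hρ : 0 < r * Real.exp (e * L / (2 * d)) := by positivity
  have hρd : (r * Real.exp (e * L / (2 * d))) ^ (d : ℝ) = r ^ (d : ℝ) * Real.exp (e / 2 * L) := by
    rw [Real.mul_rpow hr.le (Real.exp_pos _).le, ← Real.exp_mul]
    congr 2
    field_simp
  have hq : (r / (r * Real.exp (e * L / (2 * d)))) ^ (d : ℝ) = Real.exp (-(e / 2) * L) := by
    rw [Real.div_rpow hr.le hρ.le, hρd, div_mul_cancel_left₀ (by positivity), ← Real.exp_neg]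
    congr 1
    ring
  refine ⟨by positivity, ?_⟩
  refine (lintegral_pairBound_le hd hα hη hβ hp k hs.le hr (by linarith) hK1 hKp hL hLe hδ hρ he
    (by rw [hq, ← hC₁]; simpa [mul_assoc] using hfar)).trans (ENNReal.ofReal_le_ofReal ?_)
  rw [hq, hρd, farBound, nearBound, ← hC₁, ← hC₂]
  have hrd : r ^ (d : ℝ) = L / (c₀ d α β η * s) := by
    rw [← hLe]
    field_simp
  -- Every factor `s` is paired with one `exp (-L)`; what remains is a power of `L` times a decaying
  -- exponential.
  have hsq : (s * Real.exp (-L)) ^ 2 ≤ (C * L) ^ 2 := by gcongr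
  set A := s * Real.exp (-L) with hA
  have e1 : s ^ 2 * Real.exp (4 - 3 * L) = A ^ 2 * (Real.exp 4 * Real.exp (-1 * L)) := by
    rw [hA, mul_pow, ← Real.exp_nat_mul, mul_assoc, ← Real.exp_add, ← Real.exp_add]
    congr 2
    push_cast
    ring
  have e2 : s ^ 2 * Real.exp (5 - 2 * L) = A ^ 2 * Real.exp 5 := by
    rw [hA, mul_pow, ← Real.exp_nat_mul, mul_assoc, ← Real.exp_add]
    congr 2
    push_cast
    ring
  have e3 : s * Real.exp (2 + e - (1 + e) * L) * Real.exp (e / 2 * L) =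
      A * (Real.exp (2 + e) * Real.exp (-(e / 2) * L)) := by
    rw [hA, mul_assoc, mul_assoc, ← Real.exp_add, ← Real.exp_add, ← Real.exp_add]
    congr 2
    ring
  calc _ = L ^ (2 * k) * (s ^ 2 * Real.exp (4 - 3 * L)) +
        L ^ (2 * k) * (C₂ + C₁ * L) * Real.exp (-(e / 2) * L) * (s ^ 2 * Real.exp (5 - 2 * L)) +
        L ^ (2 * k + 1) * (unitBallVolume d / c₀ d α β η) *
          (s * Real.exp (2 + e - (1 + e) * L) * Real.exp (e / 2 * L)) := by
        rw [hrd]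
        field_simp
        ring
    _ = L ^ (2 * k) * (A ^ 2 * (Real.exp 4 * Real.exp (-1 * L))) +
        L ^ (2 * k) * (C₂ + C₁ * L) * Real.exp (-(e / 2) * L) * (A ^ 2 * Real.exp 5) +
        L ^ (2 * k + 1) * (unitBallVolume d / c₀ d α β η) *
          (A * (Real.exp (2 + e) * Real.exp (-(e / 2) * L))) := by rw [e1, e2, e3]
    _ ≤ L ^ (2 * k) * ((C * L) ^ 2 * (Real.exp 4 * Real.exp (-1 * L))) +
        L ^ (2 * k) * (C₂ + C₁ * L) * Real.exp (-(e / 2) * L) * ((C * L) ^ 2 * Real.exp 5) +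
        L ^ (2 * k + 1) * (unitBallVolume d / c₀ d α β η) *
          ((C * L) * (Real.exp (2 + e) * Real.exp (-(e / 2) * L))) := by gcongr
    _ = _ := by ring

end PairBound


/-! ### Assembly of the bounds -/

theorem tendsto_tvDist_numDegree {d : ℕ} {α β η : ℝ} (hd : 0 < d) (hα : d < α) (hη : 0 < η)
    (hβ : 1 < β) (hp : 2 * (d / α) < β) (ξ : ℝ) (k : ℕ) (hk : ((k : ℝ) + 1) * d < α * β) :
    Tendsto (fun s : ℝ => tvDist ((sampleLaw d β (zero_lt_one.trans hβ) s).map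
      (numDegree α η (scaling d α β η ξ k s) k)) (poissonMeasure (Real.exp (-ξ)).toNNReal))
      atTop (𝓝 0) := by
  have hβ0 : 0 < β := zero_lt_one.trans hβ
  have hP : IsProbabilityMeasure (pointLaw d β) := isProbabilityMeasure_pointLaw d hβ0
  have hc := c₀_pos hd hα hβ hη
  have hLt := tendsto_meanLevel d α β ξ k
  obtain ⟨ε, hε, hεs⟩ := exists_lintegral_pairBound_le hd hα hη hβ hp ξ k
  have hM := tendsto_mul_integral_joinProb ξ k hd hα hη hβ hk
  have hl : 0 < (Real.exp (-ξ)).toNNReal := Real.toNNReal_pos.2 (Real.exp_pos _)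
  have hlim : Tendsto (fun s => Real.exp (Real.exp (-ξ)) * (4 * ε s +
      |s * ∫ x, poissonMass k (s * joinProb (pointLaw d β)
        (connectPos α η (scaling d α β η ξ k s)) x) ∂pointLaw d β - Real.exp (-ξ)|)) atTop
      (𝓝 0) := by
    simpa using ((hε.const_mul 4).add (hM.sub_const (Real.exp (-ξ))).abs).const_mul
      (Real.exp (Real.exp (-ξ)))
  refine squeeze_zero' (Eventually.of_forall fun s => ?_) ?_ hlim
  · have : IsProbabilityMeasure ((sampleLaw d β hβ0 s).map
        (numDegree α η (scaling d α β η ξ k s) k)) :=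
      Measure.isProbabilityMeasure_map (measurable_numDegree _ _ _ _).aemeasurable
    exact tvDist_nonneg _ _
  · filter_upwards [hεs, eventually_gt_atTop 0, hLt.eventually_ge_atTop 1] with s ⟨h0, hQ⟩ hs hL
    have hL0 : 0 < meanLevel d α β ξ k s := by linarith
    have hr := scaling_pos (η := η) ξ k hc hs hL0
    have hs' : ((s.toNNReal : NNReal) : ℝ) = s := Real.coe_toNNReal s hs.le
    have hl' : (((Real.exp (-ξ)).toNNReal : NNReal) : ℝ) = Real.exp (-ξ) :=
      Real.coe_toNNReal _ (Real.exp_pos _).le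
    rw [map_numDegree α η _ k hβ0 s]
    have h := tvDist_map_degreeCount_le (pointLaw d β) (measurable_connectPos d α η _)
      (connectPos_comm α η _) (connectPos_nonneg α hη.le hr.le) (connectPos_le_one α η _) k
      s.toNNReal (θ := 1 / meanLevel d α β ξ k s) (by positivity) ((div_le_one hL0).2 hL) hl h0
      (by rw [hs']; exact hQ)
    rwa [hs', hl'] at h

end ScaleFreeRCM
end

theorem theorem3p2 (d : ℕ) (hd : 2 ≤ d) (α β η ξ : ℝ) (hη : 0 < η) (hα : (d : ℝ) < α)
    (hβ : 1 < β) (k : ℕ)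
    (hαβ : max (2 * (d : ℝ)) (max (((k : ℝ) + 1) * d) ((2 * (k : ℝ) + 3) * (α - d))) < α * β) :
    Tendsto
      (fun s : ℝ => ScaleFreeRCM.tvDist
        ((ScaleFreeRCM.sampleLaw d β (zero_lt_one.trans hβ) s).map
          (ScaleFreeRCM.numDegree α η (ScaleFreeRCM.scaling d α β η ξ k s) k))
        (poissonMeasure (Real.exp (-ξ)).toNNReal))
      atTop (𝓝 0) ∧
    TendstoInDistribution
      (fun s : ℝ => ScaleFreeRCM.numDegree (d := d) α η (ScaleFreeRCM.scaling d α β η ξ k s) k)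
      atTop
      (id : ℕ → ℕ)
      (fun s : ℝ => ScaleFreeRCM.sampleLaw d β (zero_lt_one.trans hβ) s)
      (poissonMeasure (Real.exp (-ξ)).toNNReal) := by
  have hd0 : 0 < d := by omega
  have hα0 : 0 < α := (Nat.cast_nonneg d).trans_lt hα
  have hk := ((le_max_left _ _).trans (le_max_right _ _)).trans_lt hαβ
  -- Equivalently, the weight has a finite moment of order `2 d / α`, as the bound on common
  -- neighbours requires.
  have hp : 2 * (d / α) < β := by
    rw [mul_div_assoc', div_lt_iff₀ hα0, mul_comm β]
    exact (le_max_left _ _).trans_lt hαβ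
  have h := ScaleFreeRCM.tendsto_tvDist_numDegree hd0 hα hη hβ hp ξ k hk
  exact ⟨h, ScaleFreeRCM.tendstoInDistribution_of_tvDist
    (fun s => ScaleFreeRCM.measurable_numDegree _ _ _ _) h⟩
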